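/- **Setting.** Let $d,m\ge 1$, let $\mathbf F\in\{\mathbf R,\mathbf C\}$, $\mathcal H_j=\mathbf F^{n_j}$ ($j=1,\dots,m$), $\vec n=(n_1,\dots,n_m)$ and $\mathcal H=\bigotimes_{j=1}^m\mathcal H_j$ with its Hilbert space structure. Cubes $Q\subseteq\mathbf R^d$ have sides parallel to the axes, and $\langle f\rangle_Q=|Q|^{-1}\int_Q f$. A matrix weight $W_j$ is a measurable function on $\mathbf R^d$ whose values are a.e. Hermitian positive definite operators on $\mathcal H_j$; for $\vec W=(W_1,\dots,W_m)$ put $\mathbf W=\bigotimes_jW_j$. For a quasi-normed function space $X$ let $\|f\|_{X_W}=\big\|\,\|Wf\|\,\big\|_X$, and $L^p_W=(L^p(\mathbf R^d))_W$. For a tuple of spaces, $\vec X_{\vec W}=(X_1)_{W_1}\times\cdots\times(X_m)_{W_m}$, and similarly $L^{\vec p}_{\vec W}$. Let $T_Q(\vec f)=\mathbf 1_Q\bigotimes_{j=1}^m\langle f_j\rangle_Q$. An *$m$-linear Calderón–Zygmund operator* $T$ is an $m$-linear operator from Schwartz functions to tempered distributions ($\mathbf F$-valued) with a bounded extension $L^{q_1}\times\cdots\times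 L^{q_m}\to L^q$ for some $q_j\in[1,\infty)$, $\frac1q=\sum_j\frac1{q_j}$, such that $T(\vec f)(x)=\int K(x,\vec y)\prod_jf_j(y_j)\,d\vec y$ for $\vec f\in (L^\infty_c)^m$ and a.e. $x\notin\bigcap_j\operatorname{supp}f_j$. Here $K$ is a kernel defined off $\{y_0=y_1=\cdots=y_m\}$ and, with $\sigma(y)=\sum_{k,l=0}^m|y_k-y_l|$, there is $C_K>0$ with $|K(y)|\le C_K\sigma(y)^{-md}$ and $$|K(y)-K(y')|\le C_K\,\omega\!\left(\frac{|y_j-y_j'|}{\sigma(y)}\right)\sigma(y)^{-md}$$ whenever $y,y'$ differ only in the $j$-th component and $|y_j-y_j'|\le\frac12\max_k|y_j-y_k|$, where $\omega:[0,\infty)\to[0,\infty)$ is increasing, continuous, doubling, $\omega(0)=0$ and $\int_0^1\omega(t)\frac{dt}t<\infty$. The extension $\widetilde T$ to tuples $\vec f$ with $f_j\in L^\infty_c(\mathbf R^d;\mathcal H_j)$ is $\widetilde T(\vec f)=\sum_{k_1,\dots,k_m}T(f_{1,k_1},\dots,f_{m,k_m})\,e_{k_1}\otimes\cdots\otimes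 e_{k_m}$. Its norm $\|\widetilde T\|_{\vec{\mathbf X}\to\mathbf Y}$ is the least $B\in[0,\infty]$ such that $\|\widetilde T(\vec f)\|_{\mathbf Y}\le B\prod_j\|f_j\|_{\mathbf X_j}$ for all $\vec f$ with $f_j\in L^\infty_c(\mathbf R^d;\mathcal H_j)\cap\mathbf X_j$. $T$ is *directionally non-degenerate with constants $C(\alpha)>0$, $0<\alpha<1$*, if for every $0<\alpha<1$ and every cube $Q$ there is a cube $Q'$ such that: (a) for all $0\le h_1,\dots,h_m\in L^\infty_c(\mathbf R^d)$ supported in $Q'$ with $\prod_jh_j=\mathbf 1_{Q'}$, one has $1\le C(\alpha)|T(\vec h)(x)|$ for a.e. $x\in Q$; (b) there is a measurable $S:Q'\times Q^m\to\mathbf F$ with $|S|\le|Q|^{-m}$ a.e. such that for all $f_j\in L^\infty_c(\mathbf R^d;\mathcal H_j)$ supported in $Q$, $$\bigotimes_{j=1}^m\langle f_j\rangle_Q=(1-\alpha)C(\alpha)\widetilde T(\vec f)(x)+\alpha\int_{Q^m}S(x,\vec y)\bigotimes_{j=1}^mf_j(y_j)\,d\vec y\quad\text{for a.e. }x\in Q'.$$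 $T$ is *directionally non-degenerate* if this holds for some constants $C(\alpha)$. **Theorem.** (1) Let $\vec p\in(1,\infty]^m$, $\frac1p=\sum_j\frac1{p_j}>0$. There are $\alpha\in(0,1)$ and $c<\infty$, depending only on $m,\vec n,\vec p$ (and $\mathbf F$), such that the following holds in every dimension $d$. Let $T$ be directionally non-degenerate with constants $C(\cdot)$, and let $\vec W$ be matrix weights such that $W_j^{-1}$ is locally $p_j'$-integrable for all $j$ and $\|\widetilde T\|_{L^{\vec p}_{\vec W}\to L^p_{\mathbf W}}<\infty$. Then $\vec W\in A_{\vec p}$, i.e. $[\vec W]_{\vec p}:=\sup_Q\|T_Q\|_{L^{\vec p}_{\vec W}\to L^p_{\mathbf W}}<\infty$, and $$[\vec W]_{\vec p}\le c\,C(\alpha)^2\,\|\widetilde T\|^2_{L^{\vec p}_{\vec W}\to L^p_{\mathbf W}}.$$ (2) Let $K_X\in[0,\infty)$. There are $\alpha\in(0,1)$ and $c<\infty$, depending only on $m,\vec n,K_X$ (and $\mathbf F$), such that the following holds in every dimension $d$. Let $T$ be directionally non-degenerate with constants $C(\cdot)$, and let $X_1,\dots,X_m$ be Banach function spaces over $\mathbf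 R^d$ with the Fatou property, whose product $X=\prod_jX_j$, quasi-normed by $\|f\|_X=\inf\{\prod_j\|f_j\|_{X_j}:|f|\le\prod_jf_j,\ 0\le f_j\in X_j\}$, has $K_X$ as a quasi-triangle constant. Let $\vec W$ be matrix weights with $\mathbf 1_Q\|W_j^{-1}\|\in X_j'$ (the Köthe dual) for all cubes $Q$ and all $j$, and suppose that $\|\widetilde T\|_{\vec X_{\vec W}\to X_{\mathbf W}}<\infty$. Then $$\sup_Q\|T_Q\|_{\vec X_{\vec W}\to X_{\mathbf W}}\le c\,C(\alpha)^2\,\|\widetilde T\|_{\vec X_{\vec W}\to(X_{\mathbf W})_{\mathrm{weak}}}\,\|\widetilde T\|_{\vec X_{\vec W}\to X_{\mathbf W}},$$ where $\|f\|_{(X_{\mathbf W})_{\mathrm{weak}}}=\sup_{u\in\mathcal H}\|\mathbf 1_{\{x:\,u\in\mathcal K(f)(x)\}}u\|_{X_{\mathbf W}}$ and $\mathcal K(f)(x)$ is the smallest closed convex set that contains $f(x)$ and is invariant under multiplication by scalars of modulus $1$. (3) The $m$-linear Riesz transform, i.e. every $m$-linear Calderón–Zygmund operator with kernel $$K(x,\vec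 y)=\frac{\sum_{j=1}^m(x^1-y_j^1)}{\big(\sum_{j=1}^m|x-y_j|\big)^{md+1}},$$ where $x^1$ denotes the first coordinate of $x$, is directionally non-degenerate. -/

import Mathlib

open MeasureTheory Set Filter Topology
open scoped ENNReal NNReal ComplexOrder SchwartzMap

namespace MatrixCZ

noncomputable section

/-! ### Cubes, averages, tensors -/

/-- The domain `ℝ^d` with its Euclidean norm. -/
abbrev Rd (d : ℕ) : Type := EuclideanSpace ℝ (Fin d)

/-- The Hilbert space `𝕜^{k}`. -/
abbrev Hil (𝕜 : Type*) [RCLike 𝕜] (k : ℕ) : Type _ := EuclideanSpace 𝕜 (Fin k)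

/-- The Hilbert space tensor product `⨂_j 𝕜^{n_j}`, realised as `𝕜^{n_1 × ⋯ × n_m}`: coordinates
are indexed by multi-indices, `⨂_j e_{k_j}` being the standard basis vector of index `k`. -/
abbrev HilT (𝕜 : Type*) [RCLike 𝕜] {m : ℕ} (n : Fin m → ℕ) : Type _ :=
  EuclideanSpace 𝕜 (∀ j, Fin (n j))

/-- The elementary tensor `⨂_j u_j`. -/
def tensor {𝕜 : Type*} [RCLike 𝕜] {m : ℕ} {n : Fin m → ℕ} (u : ∀ j, Hil 𝕜 (n j)) : HilT 𝕜 n :=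
  WithLp.toLp 2 (fun k => ∏ j, u j (k j))

/-- The tensor product `⨂_j A_j` of operators, as a (Kronecker product) matrix. -/
def tensorMat {𝕜 : Type*} [RCLike 𝕜] {m : ℕ} {n : Fin m → ℕ}
    (A : ∀ j, Matrix (Fin (n j)) (Fin (n j)) 𝕜) :
    Matrix (∀ j, Fin (n j)) (∀ j, Fin (n j)) 𝕜 :=
  Matrix.of (fun k l => ∏ j, A j (k j) (l j))

/-- The defining property of `⨂_j A_j`. -/
theorem tensorMat_tensor {𝕜 : Type*} [RCLike 𝕜] {m : ℕ} {n : Fin m → ℕ}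
    (A : ∀ j, Matrix (Fin (n j)) (Fin (n j)) 𝕜) (u : ∀ j, Hil 𝕜 (n j)) :
    Matrix.toEuclideanLin (tensorMat A) (tensor u)
      = tensor (fun j => Matrix.toEuclideanLin (A j) (u j)) := by
  ext k
  simp only [Matrix.toLpLin_apply, tensor, tensorMat, Matrix.mulVec, dotProduct, Matrix.of_apply,
    ← Finset.prod_mul_distrib]
  rw [Finset.prod_univ_sum]
  simp

/-- The inner product on the tensor product is the product of the inner products. -/
theorem inner_tensor {𝕜 : Type*} [RCLike 𝕜] {m : ℕ} {n : Fin m → ℕ} (u v : ∀ j, Hil 𝕜 (n j)) :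
    inner 𝕜 (tensor u) (tensor v) = ∏ j, inner 𝕜 (u j) (v j) := by
  simp only [PiLp.inner_apply, tensor, RCLike.inner_apply, map_prod, ← Finset.prod_mul_distrib]
  rw [Finset.prod_univ_sum]
  simp

/-- A (closed) cube with sides parallel to the coordinate axes. -/
structure Cube (d : ℕ) where
  corner : Rd d
  side : ℝ
  side_pos : 0 < side

/-- The set of points of a cube. -/
def Cube.set {d : ℕ} (Q : Cube d) : Set (Rd d) :=
  {x | ∀ i, Q.corner i ≤ x i ∧ x i ≤ Q.corner i + Q.side}

/-- The Lebesgue measure `|Q|`. -/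
def Cube.vol {d : ℕ} (Q : Cube d) : ℝ := (volume Q.set).toReal

/-- `L^∞_c`: (essentially) bounded measurable functions of compact support. -/
def IsLinfc {d : ℕ} {V : Type*} [NormedAddCommGroup V] (f : Rd d → V) : Prop :=
  MemLp f ⊤ (volume : Measure (Rd d)) ∧ HasCompactSupport f

/-- The exponent `p` with `1/p = ∑_j 1/p_j`. -/
def totalExp {m : ℕ} (p : Fin m → ℝ≥0∞) : ℝ≥0∞ := (∑ j, (p j)⁻¹)⁻¹

/-- The conjugate exponent `p'`, `1/p' = 1 - 1/p`. -/
def conjExp (p : ℝ≥0∞) : ℝ≥0∞ := (1 - p⁻¹)⁻¹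

/-! ### Multilinear Calderón–Zygmund operators -/

/-- A modulus of continuity on `[0,∞)`: increasing, continuous, vanishing at `0`, doubling, and
satisfying the Dini condition. -/
structure IsDiniModulus (ω : ℝ → ℝ) : Prop where
  mono : MonotoneOn ω (Ici 0)
  cont : ContinuousOn ω (Ici 0)
  zero : ω 0 = 0
  doubling : ∃ D : ℝ, 1 ≤ D ∧ ∀ t, 0 ≤ t → ω (2 * t) ≤ D * ω t
  dini : IntegrableOn (fun t => ω t / t) (Ioc 0 1)

/-- The set `Δ` of points of `(ℝ^d)^{m+1}` all of whose components agree. -/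
def fullDiagonal (d m : ℕ) : Set (Fin (m + 1) → Rd d) := {y | ∀ k l, y k = y l}

/-- `∑_{k,l=0}^m |y_k - y_l|`. -/
def spread {d m : ℕ} (y : Fin (m + 1) → Rd d) : ℝ := ∑ k, ∑ l, ‖y k - y l‖

/-- `m`-linear Calderón–Zygmund kernels with modulus of continuity `ω`; only the values off the
diagonal matter. -/
structure IsCZKernel {𝕜 : Type*} [RCLike 𝕜] {d m : ℕ} (ω : ℝ → ℝ)
    (K : (Fin (m + 1) → Rd d) → 𝕜) : Prop where
  bounds : ∃ CK : ℝ, 0 < CK ∧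
    (∀ y, y ∉ fullDiagonal d m → ‖K y‖ ≤ CK / spread y ^ (m * d)) ∧
    (∀ (j : Fin (m + 1)) (y : Fin (m + 1) → Rd d) (z : Rd d),
      y ∉ fullDiagonal d m → Function.update y j z ∉ fullDiagonal d m →
      (∃ k, ‖y j - z‖ ≤ (1 / 2) * ‖y j - y k‖) →
      ‖K y - K (Function.update y j z)‖
        ≤ CK * ω (‖y j - z‖ / spread y) * (1 / spread y ^ (m * d)))

/-- The value, on a tuple of functions, of an operator on tuples of `L^{q_j}` classes. -/
def evalLp {𝕜 : Type*} [RCLike 𝕜] {d m : ℕ} (q : Fin m → ℝ≥0∞)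
    (S : MultilinearMap 𝕜 (fun j => Lp 𝕜 (q j) (volume : Measure (Rd d)))
      (Lp 𝕜 (totalExp q) (volume : Measure (Rd d))))
    (f : Fin m → Rd d → 𝕜) : Rd d → 𝕜 :=
  open Classical in
  if h : ∀ j, MemLp (f j) (q j) (volume : Measure (Rd d)) then
    ⇑(S (fun j => (h j).toLp (f j)))
  else 0

/-- An `m`-linear Calderón–Zygmund operator: an `m`-linear operator from Schwartz functions to
tempered distributions with a bounded extension `L^{q_1} × ⋯ × L^{q_m} → L^q` for some
`q_j ∈ [1,∞)`, represented off the support by a Calderón–Zygmund kernel. -/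
structure CZOperator (𝕜 : Type*) [RCLike 𝕜] (d m : ℕ) where
  /-- the operator on Schwartz functions -/
  onSchwartz : MultilinearMap 𝕜 (fun _ : Fin m => 𝓢(Rd d, 𝕜)) (𝓢(Rd d, 𝕜) →L[𝕜] 𝕜)
  /-- the exponents of the bounded extension -/
  q : Fin m → ℝ≥0∞
  one_le_q : ∀ j, 1 ≤ q j
  q_ne_top : ∀ j, q j ≠ ⊤
  /-- the bounded extension -/
  ext : MultilinearMap 𝕜 (fun j => Lp 𝕜 (q j) (volume : Measure (Rd d)))
      (Lp 𝕜 (totalExp q) (volume : Measure (Rd d)))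
  ext_bounded : ∃ B : ℝ≥0, ∀ f : (∀ j, Lp 𝕜 (q j) (volume : Measure (Rd d))),
    eLpNorm (ext f) (totalExp q) volume ≤ B * ∏ j, eLpNorm (f j) (q j) volume
  ext_extends : ∀ (f : Fin m → 𝓢(Rd d, 𝕜)) (φ : 𝓢(Rd d, 𝕜)),
    Integrable (fun x => evalLp q ext (fun j => ⇑(f j)) x * φ x) ∧
    onSchwartz f φ = ∫ x, evalLp q ext (fun j => ⇑(f j)) x * φ x
  /-- the kernel -/
  kernel : (Fin (m + 1) → Rd d) → 𝕜
  /-- the modulus of continuity of the kernel -/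
  ω : ℝ → ℝ
  isDiniModulus : IsDiniModulus ω
  isCZKernel : IsCZKernel ω kernel
  representation : ∀ f : Fin m → Rd d → 𝕜, (∀ j, IsLinfc (f j)) →
    ∀ᵐ x : Rd d, x ∉ (⋂ j, tsupport (f j)) →
      evalLp q ext f x
        = ∫ y : Fin m → Rd d, kernel (Fin.cons (α := fun _ => Rd d) x y) * ∏ j, f j (y j)

/-- `T(f_1,…,f_m)`. -/
def CZOperator.app {𝕜 : Type*} [RCLike 𝕜] {d m : ℕ} (T : CZOperator 𝕜 d m)
    (f : Fin m → Rd d → 𝕜) : Rd d → 𝕜 := evalLp T.q T.ext f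

/-- The extension `T̃`, obtained by letting `T` act on all tuples of components:
`T̃(f)(x) = ∑_k T(f_{1,k_1},…,f_{m,k_m})(x) ⨂_j e_{k_j}`. -/
def CZOperator.tilde {𝕜 : Type*} [RCLike 𝕜] {d m : ℕ} (T : CZOperator 𝕜 d m) {n : Fin m → ℕ}
    (f : ∀ j, Rd d → Hil 𝕜 (n j)) : Rd d → HilT 𝕜 n :=
  fun x => WithLp.toLp 2 (fun k => T.app (fun j y => f j y (k j)) x)

/-! ### Directional non-degeneracy -/

/-- Property (a) for the cubes `Q, Q'` with constant `C`. -/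
def LowerBoundOnCube {𝕜 : Type*} [RCLike 𝕜] {d m : ℕ} (T : CZOperator 𝕜 d m) (C : ℝ)
    (Q Q' : Cube d) : Prop :=
  ∀ h : Fin m → Rd d → ℝ, (∀ j, IsLinfc (h j)) → (∀ j x, 0 ≤ h j x) →
    (∀ j, Function.support (h j) ⊆ Q'.set) →
    (∀ x, ∏ j, h j x = Q'.set.indicator (fun _ => (1 : ℝ)) x) →
    ∀ᵐ x : Rd d, x ∈ Q.set → 1 ≤ C * ‖T.app (fun j y => (h j y : 𝕜)) x‖

/-- Property (b) for the cubes `Q, Q'`, the number `α` and the constant `C`: on `Q'`, the averaging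
operator of `Q` is `(1-α) C T̃` up to `α` times an integral operator with kernel bounded by
`|Q|^{-m}`. -/
def AverageRepresentation {𝕜 : Type*} [RCLike 𝕜] {d m : ℕ} (n : Fin m → ℕ)
    (T : CZOperator 𝕜 d m) (α C : ℝ) (Q Q' : Cube d) : Prop :=
  ∃ S : Rd d → (Fin m → Rd d) → 𝕜,
    AEStronglyMeasurable (Function.uncurry S)
      (volume.restrict (Q'.set ×ˢ Set.pi Set.univ (fun _ : Fin m => Q.set))) ∧
    (∀ᵐ z ∂(volume.restrict (Q'.set ×ˢ Set.pi Set.univ (fun _ : Fin m => Q.set))),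
      ‖Function.uncurry S z‖ ≤ (Q.vol ^ m)⁻¹) ∧
    ∀ f : (∀ j, Rd d → Hil 𝕜 (n j)), (∀ j, IsLinfc (f j)) →
      (∀ j, Function.support (f j) ⊆ Q.set) →
      ∀ᵐ x : Rd d, x ∈ Q'.set →
        tensor (fun j => ⨍ y in Q.set, f j y)
          = (((1 - α) * C : ℝ) : 𝕜) • T.tilde f x
            + (α : 𝕜) • ∫ y in Set.pi Set.univ (fun _ : Fin m => Q.set),
                S x y • tensor (fun j => f j (y j))

/-- `T` is directionally non-degenerate with constants `C(α) > 0`, `0 < α < 1`: for every `α` and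
every cube `Q` there is a cube `Q'` with properties (a) and (b), with the constant `C(α)`. -/
def DirNonDegWith {𝕜 : Type*} [RCLike 𝕜] {d m : ℕ} (n : Fin m → ℕ) (T : CZOperator 𝕜 d m)
    (C : ℝ → ℝ) : Prop :=
  ∀ α : ℝ, 0 < α → α < 1 → 0 < C α ∧
    ∀ Q : Cube d, ∃ Q' : Cube d,
      LowerBoundOnCube T (C α) Q Q' ∧ AverageRepresentation n T α (C α) Q Q'

/-- Directional non-degeneracy (for functions with values in `𝕜^{n_1}, …, 𝕜^{n_m}`). -/
def DirectionallyNonDegenerate {𝕜 : Type*} [RCLike 𝕜] {d m : ℕ} (n : Fin m → ℕ)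
    (T : CZOperator 𝕜 d m) : Prop :=
  ∃ C : ℝ → ℝ, DirNonDegWith n T C

/-- The kernel of the `m`-linear Riesz transform of the first coordinate:
`∑_j (x^1 - y_j^1) / (∑_j |x - y_j|)^{md+1}` at `(x, y_1, …, y_m)`. -/
def rieszKernel (𝕜 : Type*) [RCLike 𝕜] {d m : ℕ} (hd : 0 < d) (y : Fin (m + 1) → Rd d) : 𝕜 :=
  (((∑ j : Fin m, (y 0 ⟨0, hd⟩ - y j.succ ⟨0, hd⟩))
    / (∑ j : Fin m, ‖y 0 - y j.succ‖) ^ (m * d + 1) : ℝ) : 𝕜)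

/-! ### Matrix weights and operator norms -/

/-- Matrix weights: measurable, almost everywhere Hermitian and positive definite. -/
structure IsMatrixWeight {𝕜 : Type*} [RCLike 𝕜] {d k : ℕ}
    (W : Rd d → Matrix (Fin k) (Fin k) 𝕜) : Prop where
  meas : ∀ i l, AEMeasurable (fun x => W x i l)
  posDef : ∀ᵐ x, (W x).PosDef

/-- The pointwise tensor product `𝐖 = ⨂_j W_j`. -/
def tensorWeight {𝕜 : Type*} [RCLike 𝕜] {d m : ℕ} {n : Fin m → ℕ}
    (W : ∀ j, Rd d → Matrix (Fin (n j)) (Fin (n j)) 𝕜) (x : Rd d) :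
    Matrix (∀ j, Fin (n j)) (∀ j, Fin (n j)) 𝕜 :=
  tensorMat (fun j => W j x)

/-- The operator norm of `W(x)^{-1}`. -/
def invOpNorm {𝕜 : Type*} [RCLike 𝕜] {d k : ℕ} (W : Rd d → Matrix (Fin k) (Fin k) 𝕜)
    (x : Rd d) : ℝ :=
  ‖Matrix.toEuclideanCLM (n := Fin k) (𝕜 := 𝕜) (W x)⁻¹‖

/-- The least `B ∈ [0,∞]` such that `N (A f) ≤ B ∏_j N_j(f_j)` for all tuples `f` in the domain
`D` of the operator `A` for which all `N_j(f_j)` are finite. -/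
def multiNorm {I : Type*} [Fintype I] {V : I → Type*} {U : Type*} (D : (∀ j, V j) → Prop)
    (A : (∀ j, V j) → U) (Nsrc : ∀ j, V j → ℝ≥0∞) (Ntgt : U → ℝ≥0∞) : ℝ≥0∞ :=
  sInf {B : ℝ≥0∞ | ∀ f, D f → (∀ j, Nsrc j (f j) < ⊤) → Ntgt (A f) ≤ B * ∏ j, Nsrc j (f j)}

/-- The domain of `T̃`: tuples in `L^∞_c`. -/
def domLinfc {𝕜 : Type*} [RCLike 𝕜] {d m : ℕ} {n : Fin m → ℕ}
    (f : ∀ j, Rd d → Hil 𝕜 (n j)) : Prop := ∀ j, IsLinfc (f j)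

/-- The domain of the averaging operators: tuples of measurable functions (integrability on cubes
follows from the finiteness of the weighted norms, as the inverse weights are locally in the
associate space). -/
def domMeas {𝕜 : Type*} [RCLike 𝕜] {d m : ℕ} {n : Fin m → ℕ}
    (f : ∀ j, Rd d → Hil 𝕜 (n j)) : Prop :=
  ∀ j, AEStronglyMeasurable (f j) (volume : Measure (Rd d))

/-- The averaging operator `T_Q(f) = 1_Q ⨂_j ⟨f_j⟩_Q`. -/
def avgOp {𝕜 : Type*} [RCLike 𝕜] {d m : ℕ} {n : Fin m → ℕ} (Q : Cube d)
    (f : ∀ j, Rd d → Hil 𝕜 (n j)) : Rd d → HilT 𝕜 n :=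
  Q.set.indicator (fun _ => tensor (fun j => ⨍ y in Q.set, f j y))

/-! ### Weighted Lebesgue spaces and the Muckenhoupt condition -/

/-- The norm of `L^p_W`. -/
def lebNorm {𝕜 : Type*} [RCLike 𝕜] {d : ℕ} {I : Type*} [Fintype I] [DecidableEq I] (p : ℝ≥0∞)
    (W : Rd d → Matrix I I 𝕜) (f : Rd d → EuclideanSpace 𝕜 I) : ℝ≥0∞ :=
  eLpNorm (fun x => Matrix.toEuclideanLin (W x) (f x)) p (volume : Measure (Rd d))

/-- `W^{-1}` is locally `r`-integrable. -/
def InvLocallyIntegrable {𝕜 : Type*} [RCLike 𝕜] {d k : ℕ} (r : ℝ≥0∞)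
    (W : Rd d → Matrix (Fin k) (Fin k) 𝕜) : Prop :=
  ∀ Q : Cube d, eLpNorm (invOpNorm W) r (volume.restrict Q.set) < ⊤

/-- The norm of `T̃` from `L^{p_1}_{W_1} × ⋯ × L^{p_m}_{W_m}` to `L^p_𝐖`. -/
def tildeLebNorm {𝕜 : Type*} [RCLike 𝕜] {d m : ℕ} {n : Fin m → ℕ} (T : CZOperator 𝕜 d m)
    (p : Fin m → ℝ≥0∞) (W : ∀ j, Rd d → Matrix (Fin (n j)) (Fin (n j)) 𝕜) : ℝ≥0∞ :=
  multiNorm domLinfc T.tilde (fun j => lebNorm (p j) (W j)) (lebNorm (totalExp p) (tensorWeight W))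

/-- The Muckenhoupt characteristic `[W]_p = sup_Q ‖T_Q‖`. -/
def muckenhouptConst {𝕜 : Type*} [RCLike 𝕜] {d m : ℕ} {n : Fin m → ℕ}
    (p : Fin m → ℝ≥0∞) (W : ∀ j, Rd d → Matrix (Fin (n j)) (Fin (n j)) 𝕜) : ℝ≥0∞ :=
  ⨆ Q : Cube d, multiNorm domMeas (avgOp Q) (fun j => lebNorm (p j) (W j))
    (lebNorm (totalExp p) (tensorWeight W))

/-- The multilinear matrix Muckenhoupt condition `W ∈ A_p`. -/
def MuckenhouptCondition {𝕜 : Type*} [RCLike 𝕜] {d m : ℕ} {n : Fin m → ℕ}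
    (p : Fin m → ℝ≥0∞) (W : ∀ j, Rd d → Matrix (Fin (n j)) (Fin (n j)) 𝕜) : Prop :=
  (∀ j, InvLocallyIntegrable (conjExp (p j)) (W j)) ∧ muckenhouptConst p W < ⊤

/-! ### Banach function spaces -/

/-- A Banach function space over `ℝ^d`, given by its norm, extended by `∞` to all measurable
functions; the space consists of the measurable functions (modulo equality almost everywhere) of
finite norm. -/
structure BFS (𝕜 : Type*) [RCLike 𝕜] (d : ℕ) where
  nrm : (Rd d → 𝕜) → ℝ≥0∞
  nrm_eq_zero : ∀ f, AEStronglyMeasurable f (volume : Measure (Rd d)) →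
    (nrm f = 0 ↔ f =ᵐ[volume] 0)
  nrm_smul : ∀ (c : 𝕜) (f), AEStronglyMeasurable f (volume : Measure (Rd d)) →
    nrm (fun x => c * f x) = ‖c‖ₑ * nrm f
  nrm_add : ∀ f g, AEStronglyMeasurable f (volume : Measure (Rd d)) →
    AEStronglyMeasurable g (volume : Measure (Rd d)) →
    nrm (fun x => f x + g x) ≤ nrm f + nrm g
  ideal : ∀ f g, AEStronglyMeasurable f (volume : Measure (Rd d)) →
    AEStronglyMeasurable g (volume : Measure (Rd d)) →
    (∀ᵐ x, ‖g x‖ ≤ ‖f x‖) → nrm g ≤ nrm f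
  complete : ∀ f : ℕ → Rd d → 𝕜,
    (∀ k, AEStronglyMeasurable (f k) (volume : Measure (Rd d)) ∧ nrm (f k) < ⊤) →
    (∀ ε : ℝ≥0∞, 0 < ε → ∃ N, ∀ k ≥ N, ∀ l ≥ N, nrm (fun x => f k x - f l x) < ε) →
    ∃ g, AEStronglyMeasurable g (volume : Measure (Rd d)) ∧ nrm g < ⊤ ∧
      Tendsto (fun k => nrm (fun x => f k x - g x)) atTop (𝓝 0)
  nondegenerate : ∀ g, AEStronglyMeasurable g (volume : Measure (Rd d)) →
    (∀ f, AEStronglyMeasurable f (volume : Measure (Rd d)) → nrm f < ⊤ →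
      Integrable (fun x => f x * star (g x)) ∧ ∫ x, f x * star (g x) = 0) →
    g =ᵐ[volume] 0

/-- The Fatou property. -/
def BFS.Fatou {𝕜 : Type*} [RCLike 𝕜] {d : ℕ} (X : BFS 𝕜 d) : Prop :=
  ∀ (f : ℕ → Rd d → 𝕜) (g : Rd d → 𝕜),
    (∀ k, AEStronglyMeasurable (f k) (volume : Measure (Rd d)) ∧ X.nrm (f k) < ⊤) →
    (∀ᵐ x, Tendsto (fun k => f k x) atTop (𝓝 (g x))) →
    X.nrm g ≤ liminf (fun k => X.nrm (f k)) atTop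

/-- The norm of the Köthe dual `X'`. -/
def BFS.dualNrm {𝕜 : Type*} [RCLike 𝕜] {d : ℕ} (X : BFS 𝕜 d) (g : Rd d → 𝕜) : ℝ≥0∞ :=
  ⨆ (f : Rd d → 𝕜) (_ : AEStronglyMeasurable f (volume : Measure (Rd d))) (_ : X.nrm f ≤ 1),
    ∫⁻ x, ‖f x‖ₑ * ‖g x‖ₑ

/-- The quasi-norm of the product space `∏_j X_j`. -/
def prodNrm {𝕜 : Type*} [RCLike 𝕜] {d m : ℕ} (X : Fin m → BFS 𝕜 d) (f : Rd d → 𝕜) : ℝ≥0∞ :=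
  sInf {a : ℝ≥0∞ | ∃ g : Fin m → Rd d → ℝ,
    (∀ j, AEStronglyMeasurable (g j) (volume : Measure (Rd d))) ∧ (∀ j x, 0 ≤ g j x) ∧
    (∀ j, (X j).nrm (fun x => (g j x : 𝕜)) < ⊤) ∧
    (∀ᵐ x, ‖f x‖ ≤ ∏ j, g j x) ∧
    a = ∏ j, (X j).nrm (fun x => (g j x : 𝕜))}

/-- `K` is a quasi-triangle constant of `∏_j X_j`. -/
def IsQuasiConst {𝕜 : Type*} [RCLike 𝕜] {d m : ℕ} (X : Fin m → BFS 𝕜 d) (K : ℝ≥0) : Prop :=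
  ∀ f g : Rd d → 𝕜, AEStronglyMeasurable f (volume : Measure (Rd d)) →
    AEStronglyMeasurable g (volume : Measure (Rd d)) →
    prodNrm X (fun x => f x + g x) ≤ K * (prodNrm X f + prodNrm X g)

/-- The norm of the weighted space `X_W`, where `N` is the (quasi-)norm of `X`. -/
def weightedNrm {𝕜 : Type*} [RCLike 𝕜] {d : ℕ} {I : Type*} [Fintype I] [DecidableEq I]
    (N : (Rd d → 𝕜) → ℝ≥0∞) (W : Rd d → Matrix I I 𝕜) (f : Rd d → EuclideanSpace 𝕜 I) : ℝ≥0∞ :=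
  N (fun x => (‖Matrix.toEuclideanLin (W x) (f x)‖ : 𝕜))

/-- The smallest closed convex symmetric set containing the vector `v`. -/
def symHull {𝕜 : Type*} [RCLike 𝕜] {V : Type*} [NormedAddCommGroup V] [NormedSpace 𝕜 V]
    (v : V) : Set V :=
  ⋂₀ {K : Set V | v ∈ K ∧ IsClosed K ∧
    (∀ u ∈ K, ∀ w ∈ K, ∀ t : ℝ, 0 ≤ t → t ≤ 1 → (((1 - t : ℝ) : 𝕜) • u + (t : 𝕜) • w) ∈ K) ∧
    (∀ u ∈ K, ∀ c : 𝕜, ‖c‖ = 1 → c • u ∈ K)}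

/-- The weak variant of a (quasi-)norm `N` on `𝕜^I`-valued functions: the supremum over all vectors
`u` of `N (1_{{x : u ∈ 𝒦(f)(x)}} u)`. -/
def weakNrm {𝕜 : Type*} [RCLike 𝕜] {d : ℕ} {I : Type*} [Fintype I]
    (N : (Rd d → EuclideanSpace 𝕜 I) → ℝ≥0∞) (f : Rd d → EuclideanSpace 𝕜 I) : ℝ≥0∞ :=
  ⨆ u : EuclideanSpace 𝕜 I, N ({x | u ∈ symHull (𝕜 := 𝕜) (f x)}.indicator (fun _ => u))

/-- The norm of `T̃` from `(X_1)_{W_1} × ⋯ × (X_m)_{W_m}` to `X_𝐖`, `X = ∏_j X_j`. -/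
def tildeNorm {𝕜 : Type*} [RCLike 𝕜] {d m : ℕ} {n : Fin m → ℕ} (T : CZOperator 𝕜 d m)
    (X : Fin m → BFS 𝕜 d) (W : ∀ j, Rd d → Matrix (Fin (n j)) (Fin (n j)) 𝕜) : ℝ≥0∞ :=
  multiNorm domLinfc T.tilde (fun j => weightedNrm (X j).nrm (W j))
    (weightedNrm (prodNrm X) (tensorWeight W))

/-- The norm of `T̃` from `(X_1)_{W_1} × ⋯ × (X_m)_{W_m}` to `(X_𝐖)_weak`, `X = ∏_j X_j`. -/
def tildeWeakNorm {𝕜 : Type*} [RCLike 𝕜] {d m : ℕ} {n : Fin m → ℕ} (T : CZOperator 𝕜 d m)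
    (X : Fin m → BFS 𝕜 d) (W : ∀ j, Rd d → Matrix (Fin (n j)) (Fin (n j)) 𝕜) : ℝ≥0∞ :=
  multiNorm domLinfc T.tilde (fun j => weightedNrm (X j).nrm (W j))
    (weakNrm (weightedNrm (prodNrm X) (tensorWeight W)))

/-- The norm of `T_Q` from `(X_1)_{W_1} × ⋯ × (X_m)_{W_m}` to `X_𝐖`, `X = ∏_j X_j`. -/
def avgNorm {𝕜 : Type*} [RCLike 𝕜] {d m : ℕ} {n : Fin m → ℕ} (Q : Cube d)
    (X : Fin m → BFS 𝕜 d) (W : ∀ j, Rd d → Matrix (Fin (n j)) (Fin (n j)) 𝕜) : ℝ≥0∞ :=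
  multiNorm domMeas (avgOp Q) (fun j => weightedNrm (X j).nrm (W j))
    (weightedNrm (prodNrm X) (tensorWeight W))

end

end MatrixCZ

open MatrixCZ

namespace MatrixCZ

/-! ### Tensors -/

section Tensor

variable {𝕜 : Type*} [RCLike 𝕜] {m : ℕ} {n : Fin m → ℕ}

/-! Fix a cube `Q` and the companion cube `Q'` that directional non-degeneracy provides, and write
`W` for the tensor product of the weights. The bound for the averaging operator of `Q` splits into
two estimates: one carries averages over `Q` to the cube `Q'`, the other carries a constant
elementary tensor from `Q'` back to `Q`. Each costs one factor `C(α)` and one norm of the extended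
operator, which explains the squares.

From `Q` to `Q'` (`shiftedNorm_le`). Let `M` be the norm of the operator sending `f` to the tensor
product of the averages of `f_j` over `Q`, put on `Q'`. Applying `W(x)` to property (b) bounds it
pointwise by `C |W T̃f|` plus `α` times the product of the averages of `|W_j(x) f_j|`. By a convex
body argument (`exists_average_norm_le`), each of these averages is at most a dimensional constant
times a finite sum of terms `|W_j(x) ⟨φ f_j⟩_Q|`, where the multipliers `φ`, of modulus at most one,
do not depend on `x`. The error term is therefore a sum of expressions of the same type as the left
side, with norm at most a constant times `α M`. For small `α` it is absorbed. Absorption needs `M <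
∞`, which follows from the duality hypothesis on the inverse weights and from testing property (b)
on bump functions (`AverageRepresentation.weightedNrm_tensor_lt_top`). Truncation extends the
estimate to unbounded functions (`weightedNrm_shiftedAvg_le`).

From `Q'` to `Q` (`LowerBoundOnCube.weightedNrm_indicator_tensor_le`). For an elementary tensor `v`,
take a factorization `|W v| ≤ ∏ g_j` on `Q'` and divide `g_j / |W_j v_j|` by the `m`-th root of the
product of these quotients. The resulting `h_j` have product one on `Q'` and satisfy `|W_j h_j v_j|
≤ g_j`, while `T̃(h_j v_j) = T(h) v` with `|T(h)|` bounded below on `Q` by property (a). So a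
multiple of `v` lies in the symmetric hull of the values, and the weak norm suffices. Since `h_j`
need not be bounded, it is truncated and the limit is taken by a Fatou property for the product
space.

That Fatou property (`prodNrm_le_of_monotone`) is proved by passing to square roots of the factors.
On a cube these form bounded closed convex sets in a weighted `L²` space, convexity of the product
constraint being the weighted arithmetic-geometric mean inequality. Decreasing sequences of such
sets have a common point.

For Lebesgue spaces the product of the `L^{p_j}` is `L^p` with equal norms (`prodNrm_lebesgueBFS`).
For the Riesz transform, `Q'` is `Q` pushed far along the first axis: there the kernel has one sign
and is nearly constant, so suitably normalized it differs little from the averaging kernel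
(`exists_ratio_le`). -/

theorem norm_tensor (u : ∀ j, Hil 𝕜 (n j)) : ‖tensor u‖ = ∏ j, ‖u j‖ := by
  have h := inner_tensor u u
  simp only [inner_self_eq_norm_sq_to_K] at h
  have h2 : ((‖tensor u‖ ^ 2 : ℝ) : 𝕜) = ((∏ j, ‖u j‖) ^ 2 : ℝ) := by
    push_cast
    rw [h, Finset.prod_pow]
  have h3 := RCLike.ofReal_injective h2
  exact (pow_left_inj₀ (norm_nonneg _) (Finset.prod_nonneg fun j _ => norm_nonneg _)
    two_ne_zero).1 h3

theorem tensor_smul (c : Fin m → 𝕜) (u : ∀ j, Hil 𝕜 (n j)) :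
    tensor (fun j => c j • u j) = (∏ j, c j) • tensor u := by
  ext k
  simp [tensor, Finset.prod_mul_distrib]

theorem tensor_apply (u : ∀ j, Hil 𝕜 (n j)) (k : ∀ j, Fin (n j)) :
    tensor u k = ∏ j, u j (k j) := rfl

theorem tensor_single (k : ∀ j, Fin (n j)) :
    tensor (fun j => EuclideanSpace.single (k j) (1 : 𝕜)) = EuclideanSpace.single k 1 := by
  ext l
  simp only [tensor_apply, PiLp.single_apply]
  by_cases h : l = k
  · subst h; simp
  · obtain ⟨j, hj⟩ := Function.ne_iff.1 h
    rw [Finset.prod_eq_zero (Finset.mem_univ j) (by simp [hj])]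
    simp [h]

theorem eq_sum_tensor_single (v : HilT 𝕜 n) :
    v = ∑ k, v k • tensor (fun j => EuclideanSpace.single (k j) (1 : 𝕜)) := by
  ext l
  simp only [tensor_single, WithLp.ofLp_sum, WithLp.ofLp_smul, Finset.sum_apply, Pi.smul_apply,
    PiLp.single_apply, smul_eq_mul, mul_ite, mul_one, mul_zero]
  simp

theorem continuous_tensor : Continuous (tensor : (∀ j, Hil 𝕜 (n j)) → HilT 𝕜 n) := by
  unfold tensor
  fun_prop

theorem norm_tensorWeight_tensor {d : ℕ} (W : ∀ j, Rd d → Matrix (Fin (n j)) (Fin (n j)) 𝕜)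
    (x : Rd d) (u : ∀ j, Hil 𝕜 (n j)) :
    ‖Matrix.toEuclideanLin (tensorWeight W x) (tensor u)‖
      = ∏ j, ‖Matrix.toEuclideanLin (W j x) (u j)‖ := by
  rw [tensorWeight, tensorMat_tensor, norm_tensor]

theorem tensorWeight_aemeasurable {d : ℕ}
    {W : ∀ j, Rd d → Matrix (Fin (n j)) (Fin (n j)) 𝕜} (hW : ∀ j, IsMatrixWeight (W j)) :
    ∀ k l, AEMeasurable (fun x => tensorWeight W x k l) := by
  intro k l
  simp only [tensorWeight, tensorMat, Matrix.of_apply]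
  exact Finset.aemeasurable_fun_prod _ fun j _ => (hW j).meas _ _

end Tensor

/-! ### Weights -/

section Weight

variable {𝕜 : Type*} [RCLike 𝕜]

theorem aestronglyMeasurable_toEuclideanLin {α : Type*} [MeasurableSpace α] {μ : Measure α}
    {I : Type*} [Fintype I] [DecidableEq I]
    {W : α → Matrix I I 𝕜} (hW : ∀ k l, AEMeasurable (fun x => W x k l) μ)
    {f : α → EuclideanSpace 𝕜 I} (hf : AEStronglyMeasurable f μ) :
    AEStronglyMeasurable (fun x => Matrix.toEuclideanLin (W x) (f x)) μ := by
  have hf' : ∀ l, AEMeasurable (fun x => f x l) μ := fun l =>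
    (((EuclideanSpace.proj (𝕜 := 𝕜) l).continuous.comp_aestronglyMeasurable hf)).aemeasurable
  have : AEMeasurable (fun x => (fun k => ∑ l, W x k l * f x l : I → 𝕜)) μ :=
    aemeasurable_pi_lambda _ fun k =>
      Finset.aemeasurable_fun_sum _ fun l _ => (hW k l).mul (hf' l)
  have h2 := (PiLp.continuous_toLp 2 (fun _ : I => 𝕜)).comp_aestronglyMeasurable
    this.aestronglyMeasurable
  exact h2

variable {d k : ℕ} {W : Rd d → Matrix (Fin k) (Fin k) 𝕜}

theorem norm_le_invOpNorm_mul {x : Rd d} (h : (W x).PosDef) (v : Hil 𝕜 k) :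
    ‖v‖ ≤ invOpNorm W x * ‖Matrix.toEuclideanLin (W x) v‖ := by
  have hu : IsUnit (W x).det := (Matrix.isUnit_iff_isUnit_det _).1 h.isUnit
  have : Matrix.toEuclideanCLM (n := Fin k) (𝕜 := 𝕜) (W x)⁻¹ (Matrix.toEuclideanLin (W x) v)
      = v := by
    ext i
    simp [Matrix.toLpLin_apply, Matrix.mulVec_mulVec, Matrix.nonsing_inv_mul _ hu]
  conv_lhs => rw [← this]
  exact ContinuousLinearMap.le_opNorm _ _

theorem toEuclideanLin_ne_zero {x : Rd d} (h : (W x).PosDef) {v : Hil 𝕜 k} (hv : v ≠ 0) :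
    0 < ‖Matrix.toEuclideanLin (W x) v‖ := by
  rcases (norm_nonneg (Matrix.toEuclideanLin (W x) v)).eq_or_lt with h0 | h0
  · have := norm_le_invOpNorm_mul h v
    rw [← h0, mul_zero] at this
    exact absurd (norm_le_zero_iff.1 this) hv
  · exact h0

theorem invOpNorm_pos {x : Rd d} (h : (W x).PosDef) (hk : 0 < k) : 0 < invOpNorm W x := by
  have h1 := norm_le_invOpNorm_mul h (EuclideanSpace.single ⟨0, hk⟩ (1 : 𝕜))
  rw [PiLp.norm_single, norm_one] at h1
  have h0' : 0 ≤ invOpNorm W x := norm_nonneg _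
  rcases h0'.eq_or_lt with h0 | h0
  · rw [← h0, zero_mul] at h1; linarith
  · exact h0

/-- Inversion is not continuous on all matrices, but it is the inverse determinant times the
adjugate, hence measurable. The operator norm is then a continuous function of the entries. -/
theorem aemeasurable_invOpNorm (hW : IsMatrixWeight W) : AEMeasurable (invOpNorm W) := by
  have h1 : AEMeasurable (fun x => (fun i j => W x i j : Fin k → Fin k → 𝕜)) :=
    aemeasurable_pi_lambda _ fun i => aemeasurable_pi_lambda _ fun j => hW.meas i j
  have hc : Continuous fun A : Fin k → Fin k → 𝕜 => (Matrix.of A : Matrix (Fin k) (Fin k) 𝕜) :=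
    continuous_id
  have hdet : Measurable fun A : Fin k → Fin k → 𝕜 => (Matrix.of A).det :=
    (Continuous.matrix_det hc).measurable
  have hadj : Continuous fun A : Fin k → Fin k → 𝕜 => (Matrix.of A).adjugate :=
    Continuous.matrix_adjugate hc
  have h2 : Measurable fun A : Fin k → Fin k → 𝕜 =>
      (fun i j => (Matrix.of A)⁻¹ i j : Fin k → Fin k → 𝕜) := by
    simp only [Matrix.inv_def, Ring.inverse_eq_inv']
    refine measurable_pi_lambda _ fun i => measurable_pi_lambda _ fun j => ?_
    simp only [Matrix.smul_apply, smul_eq_mul]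
    exact hdet.inv.mul ((continuous_apply_apply i j).comp hadj).measurable
  have h3 : Continuous fun A : Fin k → Fin k → 𝕜 =>
      ‖Matrix.toEuclideanCLM (n := Fin k) (𝕜 := 𝕜) (Matrix.of A)‖ :=
    continuous_norm.comp (LinearMap.continuous_of_finiteDimensional
      ((Matrix.toEuclideanCLM (n := Fin k) (𝕜 := 𝕜)).toAlgEquiv.toLinearMap ∘ₗ
        (Matrix.ofLinearEquiv 𝕜).toLinearMap))
  exact h3.measurable.comp_aemeasurable (h2.comp_aemeasurable h1)

end Weight

/-! ### Symmetric convex hulls -/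

section SymHull

variable {𝕜 : Type*} [RCLike 𝕜] {V : Type*} [NormedAddCommGroup V] [NormedSpace 𝕜 V]

/-- A symmetric convex set containing `v` contains `-v`, hence `0` as their midpoint, hence `‖c‖ v`.
A rotation by the phase of `c` does the rest. -/
theorem smul_mem_symHull (v : V) {c : 𝕜} (hc : ‖c‖ ≤ 1) : c • v ∈ symHull (𝕜 := 𝕜) v := by
  rintro K ⟨hv, -, hconv, hsym⟩
  have h0 : (0 : V) ∈ K := by
    have := hconv v hv _ (hsym v hv (-1) (by simp)) (1 / 2) (by norm_num) (by norm_num)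
    convert this using 1
    rw [smul_smul, ← add_smul]
    push_cast
    norm_num
  have hr : ((‖c‖ : ℝ) : 𝕜) • v ∈ K := by
    simpa using hconv 0 h0 v hv ‖c‖ (norm_nonneg _) hc
  by_cases hc0 : c = 0
  · simpa [hc0] using h0
  · have := hsym _ hr (c / ((‖c‖ : ℝ) : 𝕜)) (by simp [hc0])
    rwa [smul_smul, div_mul_cancel₀] at this
    simpa using hc0

/-- The sublevel set of `‖A ·‖` at height `‖A v‖` is closed, convex and symmetric, so it takes part
in the intersection defining the hull. -/
theorem norm_map_le_of_mem_symHull {V' : Type*} [NormedAddCommGroup V'] [NormedSpace 𝕜 V']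
    (A : V →L[𝕜] V') {u v : V} (h : u ∈ symHull (𝕜 := 𝕜) v) : ‖A u‖ ≤ ‖A v‖ := by
  refine h {w | ‖A w‖ ≤ ‖A v‖} ⟨le_refl ‖A v‖, ?_, ?_, ?_⟩
  · exact isClosed_le (by fun_prop) continuous_const
  · intro u hu w hw t h0 h1
    simp only [mem_ofPred_eq, map_add, map_smul] at *
    calc _ ≤ ‖((1 - t : ℝ) : 𝕜) • A u‖ + ‖(t : 𝕜) • A w‖ := norm_add_le _ _
      _ = (1 - t) * ‖A u‖ + t * ‖A w‖ := by
        rw [norm_smul, norm_smul, RCLike.norm_ofReal, RCLike.norm_ofReal,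
          abs_of_nonneg h0, abs_of_nonneg (sub_nonneg.2 h1)]
      _ ≤ (1 - t) * ‖A v‖ + t * ‖A v‖ := by
        gcongr
      _ = _ := by ring
  · intro u hu c hc
    simpa [norm_smul, hc] using hu

end SymHull

/-! ### Nested closed convex sets in a Hilbert space -/

/-- The points of least norm of the sets have increasing bounded norms, so the parallelogram law
makes them a Cauchy sequence. Its limit lies in every set. -/
theorem nonempty_iInter_of_antitone_convex {H : Type*} [NormedAddCommGroup H]
    [InnerProductSpace ℝ H] [CompleteSpace H] {A : ℕ → Set H} (hA : Antitone A)
    (hclosed : ∀ N, IsClosed (A N)) (hconv : ∀ N, Convex ℝ (A N)) {R : ℝ}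
    (hR : ∀ N, ∃ v ∈ A N, ‖v‖ ≤ R) : (⋂ N, A N).Nonempty := by
  have hmin : ∀ N, ∃ v ∈ A N, ∀ w ∈ A N, ‖v‖ ≤ ‖w‖ := by
    intro N
    obtain ⟨v, hv, hvmin⟩ := exists_norm_eq_iInf_of_complete_convex
      (let ⟨v, hv, _⟩ := hR N; ⟨v, hv⟩) (hclosed N).isComplete (hconv N) 0
    refine ⟨v, hv, fun w hw => ?_⟩
    simp only [zero_sub, norm_neg] at hvmin
    rw [hvmin]
    exact ciInf_le (f := fun w : A N => ‖(w : H)‖) ⟨0, by rintro _ ⟨w, rfl⟩; positivity⟩ ⟨w, hw⟩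
  choose v hv hvmin using hmin
  have hmono : Monotone fun N => ‖v N‖ := fun k l hkl => hvmin k _ (hA hkl (hv l))
  have hbdd : BddAbove (range fun N => ‖v N‖) := by
    refine ⟨R, ?_⟩
    rintro _ ⟨N, rfl⟩
    obtain ⟨w, hw, hwR⟩ := hR N
    exact (hvmin N w hw).trans hwR
  set L := ⨆ N, ‖v N‖
  have hlim : Tendsto (fun N => ‖v N‖) atTop (𝓝 L) := tendsto_atTop_ciSup hmono hbdd
  have hle : ∀ N, ‖v N‖ ≤ L := fun N => le_ciSup hbdd N
  have hcauchy : CauchySeq v := by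
    refine cauchySeq_of_le_tendsto_0' (fun N => Real.sqrt (2 * (L ^ 2 - ‖v N‖ ^ 2))) ?_ ?_
    · intro k l hkl
      refine Real.le_sqrt_of_sq_le ?_
      have hpar := parallelogram_law_with_norm ℝ (v k) (v l)
      -- The midpoint lies in `A k` by convexity, so its norm is at least the minimum over `A k`.
      have hmid : ‖v k‖ ≤ ‖(1 / 2 : ℝ) • v k + (1 / 2 : ℝ) • v l‖ :=
        hvmin k _ (hconv k (hv k) (hA hkl (hv l)) (by norm_num) (by norm_num) (by norm_num))
      rw [← smul_add, norm_smul, Real.norm_of_nonneg (by norm_num)] at hmid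
      rw [dist_eq_norm]
      have h1 : (2 * ‖v k‖) ^ 2 ≤ ‖v k + v l‖ ^ 2 :=
        pow_le_pow_left₀ (by positivity) (by linarith) 2
      have h2 : ‖v l‖ ^ 2 ≤ L ^ 2 := pow_le_pow_left₀ (norm_nonneg _) (hle l) 2
      nlinarith
    · have : Tendsto (fun N => Real.sqrt (2 * (L ^ 2 - ‖v N‖ ^ 2))) atTop
          (𝓝 (Real.sqrt (2 * (L ^ 2 - L ^ 2)))) :=
        (Real.continuous_sqrt.tendsto _).comp
          ((tendsto_const_nhds.sub (hlim.pow 2)).const_mul 2)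
      simpa using this
  obtain ⟨u, hu⟩ := cauchySeq_tendsto_of_complete hcauchy
  refine ⟨u, mem_iInter.2 fun N => (hclosed N).mem_of_tendsto hu ?_⟩
  filter_upwards [eventually_ge_atTop N] with k hk
  exact hA hk (hv k)

/-- The weighted arithmetic-geometric mean inequality holds in each factor. Multiplying these gives
a geometric mean of the two products, and `c = c ^ s * c ^ t` lies below it. This makes the product
constraint on square roots of factors convex. -/
theorem le_prod_sq_convexComb {m : ℕ} {a b : Fin m → ℝ} {c s t : ℝ}
    (ha : ∀ j, 0 ≤ a j) (hb : ∀ j, 0 ≤ b j) (hc : 0 ≤ c)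
    (hac : c ≤ ∏ j, a j ^ 2) (hbc : c ≤ ∏ j, b j ^ 2) (hs : 0 ≤ s) (ht : 0 ≤ t)
    (hst : s + t = 1) : c ≤ ∏ j, (s * a j + t * b j) ^ 2 := by
  have h1 : ∀ j, (a j ^ 2) ^ s * (b j ^ 2) ^ t ≤ (s * a j + t * b j) ^ 2 := by
    intro j
    have := Real.geom_mean_le_arith_mean2_weighted hs ht (ha j) (hb j) hst
    calc (a j ^ 2) ^ s * (b j ^ 2) ^ t = (a j ^ s * b j ^ t) ^ 2 := by
          rw [mul_pow, ← Real.rpow_natCast (a j ^ s), ← Real.rpow_natCast (b j ^ t),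
            ← Real.rpow_natCast (a j), ← Real.rpow_natCast (b j), ← Real.rpow_mul (ha j),
            ← Real.rpow_mul (hb j), ← Real.rpow_mul (ha j), ← Real.rpow_mul (hb j),
            mul_comm s, mul_comm t]
      _ ≤ _ := by
        have h0 : 0 ≤ a j ^ s * b j ^ t :=
          mul_nonneg (Real.rpow_nonneg (ha j) _) (Real.rpow_nonneg (hb j) _)
        exact pow_le_pow_left₀ h0 this 2
  calc c = c ^ s * c ^ t := by
        rcases hc.eq_or_lt with h0 | h0
        · rcases hs.eq_or_lt with hs0 | hs0
          · have : t = 1 := by linarith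
            simp [← h0, ← hs0, this]
          · simp [← h0, Real.zero_rpow hs0.ne']
        · rw [← Real.rpow_add h0, hst, Real.rpow_one]
    _ ≤ (∏ j, a j ^ 2) ^ s * (∏ j, b j ^ 2) ^ t := by
        gcongr
    _ = ∏ j, (a j ^ 2) ^ s * (b j ^ 2) ^ t := by
        rw [Finset.prod_mul_distrib, Real.finsetProd_rpow _ _ (fun j _ => sq_nonneg _),
          Real.finsetProd_rpow _ _ (fun j _ => sq_nonneg _)]
    _ ≤ _ := Finset.prod_le_prod (fun j _ => mul_nonneg (Real.rpow_nonneg (sq_nonneg _) _)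
        (Real.rpow_nonneg (sq_nonneg _) _)) fun j _ => h1 j

/-! ### Banach function spaces and their products -/

section BFS

variable {𝕜 : Type*} [RCLike 𝕜] {d : ℕ}

theorem BFS.nrm_mono (X : BFS 𝕜 d) {f g : Rd d → ℝ}
    (hf : AEStronglyMeasurable f (volume : Measure (Rd d)))
    (hg : AEStronglyMeasurable g (volume : Measure (Rd d))) (h : ∀ᵐ x, |f x| ≤ |g x|) :
    X.nrm (fun x => (f x : 𝕜)) ≤ X.nrm (fun x => (g x : 𝕜)) :=
  X.ideal _ _ (RCLike.continuous_ofReal.comp_aestronglyMeasurable hg)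
    (RCLike.continuous_ofReal.comp_aestronglyMeasurable hf) (by simpa using h)

theorem BFS.nrm_ofReal_mul (X : BFS 𝕜 d) {c : ℝ} (hc : 0 ≤ c) {f : Rd d → ℝ}
    (hf : AEStronglyMeasurable f (volume : Measure (Rd d))) :
    X.nrm (fun x => ((c * f x : ℝ) : 𝕜)) = ENNReal.ofReal c * X.nrm (fun x => (f x : 𝕜)) := by
  have := X.nrm_smul (c : 𝕜) _ (RCLike.continuous_ofReal.comp_aestronglyMeasurable hf)
  simp only [RCLike.ofReal_mul]
  rw [this, ← ofReal_norm, RCLike.norm_ofReal, abs_of_nonneg hc]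

theorem BFS.nrm_zero (X : BFS 𝕜 d) : X.nrm (fun _ => 0) = 0 :=
  (X.nrm_eq_zero _ aestronglyMeasurable_const).2 (ae_of_all _ fun _ => rfl)

/-- Normalize `f` and use the definition of the dual norm. If `f` has norm zero it vanishes almost
everywhere, so the bound holds even where the dual norm is infinite. -/
theorem BFS.lintegral_mul_le (X : BFS 𝕜 d) {f g : Rd d → 𝕜}
    (hf : AEStronglyMeasurable f (volume : Measure (Rd d))) (hfin : X.nrm f < ⊤) :
    ∫⁻ x, ‖f x‖ₑ * ‖g x‖ₑ ≤ X.nrm f * X.dualNrm g := by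
  by_cases h0 : X.nrm f = 0
  · have := (X.nrm_eq_zero f hf).1 h0
    rw [h0, zero_mul, nonpos_iff_eq_zero]
    refine lintegral_eq_zero_of_ae_eq_zero ?_
    filter_upwards [this] with x hx
    simp [hx]
  · have ht : (X.nrm f).toReal ≠ 0 := (ENNReal.toReal_pos h0 hfin.ne).ne'
    set t := (X.nrm f).toReal
    have hte : ‖((t : ℝ) : 𝕜)‖ₑ = X.nrm f := by
      rw [← ofReal_norm, RCLike.norm_ofReal, abs_of_nonneg ENNReal.toReal_nonneg,
        ENNReal.ofReal_toReal hfin.ne]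
    have h1 : X.nrm (fun x => ((t : 𝕜))⁻¹ * f x) ≤ 1 := by
      rw [X.nrm_smul _ _ hf, enorm_inv (by simpa using ht), hte, ENNReal.inv_mul_cancel h0 hfin.ne]
    have h2 : ∫⁻ x, ‖((t : 𝕜))⁻¹ * f x‖ₑ * ‖g x‖ₑ ≤ X.dualNrm g :=
      le_iSup₂_of_le (fun x => ((t : 𝕜))⁻¹ * f x) (hf.const_mul _) (le_iSup_of_le h1 le_rfl)
    calc ∫⁻ x, ‖f x‖ₑ * ‖g x‖ₑ
        = ∫⁻ x, X.nrm f * (‖((t : 𝕜))⁻¹ * f x‖ₑ * ‖g x‖ₑ) := by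
          refine lintegral_congr fun x => ?_
          rw [enorm_mul, enorm_inv (by simpa using ht), hte, ← mul_assoc, ← mul_assoc,
            ENNReal.mul_inv_cancel h0 hfin.ne, one_mul]
      _ = X.nrm f * ∫⁻ x, ‖((t : 𝕜))⁻¹ * f x‖ₑ * ‖g x‖ₑ := lintegral_const_mul' _ _ hfin.ne
      _ ≤ _ := by gcongr

variable {m : ℕ} (X : Fin m → BFS 𝕜 d)

theorem prodNrm_le {f : Rd d → 𝕜} {g : Fin m → Rd d → ℝ}
    (hg : ∀ j, AEStronglyMeasurable (g j) (volume : Measure (Rd d))) (h0 : ∀ j x, 0 ≤ g j x)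
    (hfin : ∀ j, (X j).nrm (fun x => (g j x : 𝕜)) < ⊤) (hfg : ∀ᵐ x, ‖f x‖ ≤ ∏ j, g j x) :
    prodNrm X f ≤ ∏ j, (X j).nrm (fun x => (g j x : 𝕜)) :=
  sInf_le ⟨g, hg, h0, hfin, hfg, rfl⟩

theorem prodNrm_mono {f g : Rd d → 𝕜} (h : ∀ᵐ x, ‖f x‖ ≤ ‖g x‖) :
    prodNrm X f ≤ prodNrm X g := by
  refine sInf_le_sInf ?_
  rintro a ⟨w, h1, h2, h3, h4, h5⟩
  refine ⟨w, h1, h2, h3, ?_, h5⟩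
  filter_upwards [h, h4] with x hx hx'
  exact hx.trans hx'

theorem prodNrm_zero (hm : 0 < m) : prodNrm X (fun _ => 0) = 0 := by
  refine nonpos_iff_eq_zero.1 ?_
  refine (prodNrm_le X (g := fun _ _ => 0) (fun j => aestronglyMeasurable_const)
    (fun _ _ => le_rfl) (fun j => ?_) (ae_of_all _ fun x => ?_)).trans ?_
  · simp [BFS.nrm_zero]
  · simp only [norm_zero]
    exact Finset.prod_nonneg fun _ _ => le_rfl
  · simp only [RCLike.ofReal_zero, BFS.nrm_zero]
    simp [Finset.prod_const, hm.ne']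

theorem prodNrm_ofReal_mul_le (hm : 0 < m) {c : ℝ} (hc : 0 ≤ c) (f : Rd d → 𝕜) :
    prodNrm X (fun x => (c : 𝕜) * f x) ≤ ENNReal.ofReal c * prodNrm X f := by
  rcases hc.eq_or_lt with h0 | h0
  · simp [← h0, prodNrm_zero X hm]
  have hc' : ENNReal.ofReal c ≠ 0 := by simpa using h0
  conv_rhs => rw [prodNrm, sInf_eq_iInf', ENNReal.mul_iInf_of_ne hc' ENNReal.ofReal_ne_top]
  refine le_iInf ?_
  rintro ⟨a, g, h1, h2, h3, h4, rfl⟩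
  set j0 : Fin m := ⟨0, hm⟩
  -- The whole scalar is put into one factor, and the other factors stay as they are.
  set e : Fin m → ℝ := Function.update 1 j0 c with he
  have he0 : ∀ j, 0 ≤ e j := by
    intro j
    by_cases hj : j = j0 <;> simp [he, hj, hc]
  have heprod : ∏ j, e j = c := by
    rw [he, Finset.prod_update_of_mem (Finset.mem_univ _)]; simp
  have hn : ∀ j, (X j).nrm (fun x => ((e j * g j x : ℝ) : 𝕜))
      = ENNReal.ofReal (e j) * (X j).nrm (fun x => (g j x : 𝕜)) := fun j =>
    (X j).nrm_ofReal_mul (he0 j) (h1 j)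
  refine (prodNrm_le X (g := fun j x => e j * g j x) (fun j => (h1 j).const_mul _)
    (fun j x => mul_nonneg (he0 j) (h2 j x)) (fun j => ?_) ?_).trans ?_
  · rw [hn]
    exact ENNReal.mul_lt_top ENNReal.ofReal_lt_top (h3 j)
  · filter_upwards [h4] with x hx
    rw [norm_mul, RCLike.norm_ofReal, abs_of_nonneg hc, Finset.prod_mul_distrib, heprod]
    gcongr
  · simp_rw [hn, Finset.prod_mul_distrib]
    rw [← ENNReal.ofReal_prod_of_nonneg fun j _ => he0 j, heprod]

/-- Each added summand costs one quasi-triangle constant. Replacing `K` by `max 1 K` makes its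
powers increasing, so that a single power serves all summands. -/
theorem prodNrm_sum_le (hm : 0 < m) {K : ℝ≥0} (hK : IsQuasiConst X K) {ι : Type*} (s : Finset ι)
    {f : ι → Rd d → 𝕜} (hf : ∀ i, AEStronglyMeasurable (f i) (volume : Measure (Rd d))) :
    prodNrm X (fun x => ∑ i ∈ s, f i x)
      ≤ ((max 1 K : ℝ≥0) : ℝ≥0∞) ^ s.card * ∑ i ∈ s, prodNrm X (f i) := by
  classical
  induction s using Finset.induction_on with
  | empty => simp [prodNrm_zero X hm]
  | insert a s ha ih =>
    have h1 : (1 : ℝ≥0∞) ≤ ((max 1 K : ℝ≥0) : ℝ≥0∞) := by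
      exact_mod_cast le_max_left 1 K
    have hKK : (K : ℝ≥0∞) ≤ ((max 1 K : ℝ≥0) : ℝ≥0∞) := by
      exact_mod_cast le_max_right 1 K
    simp_rw [Finset.sum_insert ha, Finset.card_insert_of_notMem ha]
    refine (hK (f a) (fun x => ∑ i ∈ s, f i x) (hf a)
      (Finset.aestronglyMeasurable_fun_sum s fun i _ => hf i)).trans ?_
    rw [pow_succ']
    set K' := ((max 1 K : ℝ≥0) : ℝ≥0∞)
    calc (K : ℝ≥0∞) * (prodNrm X (f a) + prodNrm X fun x => ∑ i ∈ s, f i x)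
        ≤ K' * (K' ^ s.card * prodNrm X (f a) + K' ^ s.card * ∑ i ∈ s, prodNrm X (f i)) := by
          gcongr
          calc prodNrm X (f a) = 1 * prodNrm X (f a) := (one_mul _).symm
            _ ≤ _ := by gcongr; exact one_le_pow₀ h1
      _ = _ := by rw [← mul_add, mul_assoc]

end BFS

/-! ### The Fatou property of products -/

section ProdFatou

variable {𝕜 : Type*} [RCLike 𝕜] {d m : ℕ}

/-- Tuples `ψ` of functions whose squares on `S` have norm at most `β` and whose product dominates
`f` on `S`. -/
def IsSqrtFactorization (X : Fin m → BFS 𝕜 d) (S : Set (Rd d)) (β : ℝ≥0∞) (f : Rd d → 𝕜)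
    (ψ : Rd d → EuclideanSpace ℝ (Fin m)) : Prop :=
  (∀ᵐ x ∂(volume.restrict S), (∀ j, 0 ≤ ψ x j) ∧ ‖f x‖ ≤ ∏ j, ψ x j ^ 2) ∧
    ∀ j, (X j).nrm (fun x => ((S.indicator (fun x => ψ x j ^ 2) x : ℝ) : 𝕜)) ≤ β

variable {X : Fin m → BFS 𝕜 d} {S : Set (Rd d)} {β : ℝ≥0∞}

theorem aestronglyMeasurable_indicator_sq (hS : MeasurableSet S)
    {ψ : Rd d → EuclideanSpace ℝ (Fin m)}
    (hψ : AEStronglyMeasurable ψ (volume.restrict S)) (j : Fin m) :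
    AEStronglyMeasurable (S.indicator (fun x => ψ x j ^ 2)) (volume : Measure (Rd d)) := by
  rw [aestronglyMeasurable_indicator_iff hS]
  exact ((EuclideanSpace.proj (𝕜 := ℝ) j).continuous.comp_aestronglyMeasurable hψ).pow 2

theorem IsSqrtFactorization.congr (hS : MeasurableSet S) {f : Rd d → 𝕜}
    {ψ φ : Rd d → EuclideanSpace ℝ (Fin m)}
    (hψ : AEStronglyMeasurable ψ (volume.restrict S)) (h : ψ =ᵐ[volume.restrict S] φ)
    (hF : IsSqrtFactorization X S β f ψ) : IsSqrtFactorization X S β f φ := by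
  refine ⟨?_, fun j => ?_⟩
  · filter_upwards [hF.1, h] with x hx hx'
    rwa [← hx']
  · refine ((X j).nrm_mono (aestronglyMeasurable_indicator_sq hS (hψ.congr h) j)
      (aestronglyMeasurable_indicator_sq hS hψ j) ?_).trans (hF.2 j)
    filter_upwards [(ae_restrict_iff' hS).1 h] with x hx
    by_cases hxS : x ∈ S
    · simp [hxS, hx hxS]
    · simp [hxS]

/-- Two convexities are at work: `t ↦ t²` is convex, so the norm bounds on the squares survive in a
Banach function space, and the product constraint survives by `le_prod_sq_convexComb`. For the
factors themselves one would get the same, but only their square roots live naturally in a Hilbert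
space. -/
theorem IsSqrtFactorization.convexComb (hS : MeasurableSet S) {f : Rd d → 𝕜}
    {ψ φ : Rd d → EuclideanSpace ℝ (Fin m)}
    (hψm : AEStronglyMeasurable ψ (volume.restrict S))
    (hφm : AEStronglyMeasurable φ (volume.restrict S))
    (hψ : IsSqrtFactorization X S β f ψ) (hφ : IsSqrtFactorization X S β f φ)
    {s t : ℝ} (hs : 0 ≤ s) (ht : 0 ≤ t) (hst : s + t = 1) :
    IsSqrtFactorization X S β f (fun x => s • ψ x + t • φ x) := by
  refine ⟨?_, fun j => ?_⟩
  · filter_upwards [hψ.1, hφ.1] with x hx hx'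
    refine ⟨fun j => ?_, ?_⟩
    · simpa using add_nonneg (mul_nonneg hs (hx.1 j)) (mul_nonneg ht (hx'.1 j))
    · simpa using le_prod_sq_convexComb hx.1 hx'.1 (norm_nonneg (f x)) hx.2 hx'.2 hs ht hst
  · have h1 := aestronglyMeasurable_indicator_sq hS hψm j
    have h2 := aestronglyMeasurable_indicator_sq hS hφm j
    have hm : AEStronglyMeasurable (fun x => s • ψ x + t • φ x) (volume.restrict S) :=
      (hψm.const_smul s).add (hφm.const_smul t)
    calc (X j).nrm (fun x => ((S.indicator (fun x => (s • ψ x + t • φ x) j ^ 2) x : ℝ) : 𝕜))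
        ≤ (X j).nrm (fun x => ((s * S.indicator (fun x => ψ x j ^ 2) x
            + t * S.indicator (fun x => φ x j ^ 2) x : ℝ) : 𝕜)) := by
          refine (X j).nrm_mono (aestronglyMeasurable_indicator_sq hS hm j)
            ((h1.const_mul s).add (h2.const_mul t)) (ae_of_all _ fun x => ?_)
          by_cases hxS : x ∈ S
          · simp only [hxS, indicator_of_mem]
            rw [abs_of_nonneg (sq_nonneg _), abs_of_nonneg (by positivity)]
            simp only [WithLp.ofLp_add, WithLp.ofLp_smul, Pi.add_apply, Pi.smul_apply, smul_eq_mul]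
            obtain rfl : t = 1 - s := by linarith
            nlinarith [mul_nonneg (mul_nonneg hs ht) (sq_nonneg (ψ x j - φ x j))]
          · simp [hxS]
      _ ≤ (X j).nrm (fun x => ((s * S.indicator (fun x => ψ x j ^ 2) x : ℝ) : 𝕜))
            + (X j).nrm (fun x => ((t * S.indicator (fun x => φ x j ^ 2) x : ℝ) : 𝕜)) := by
          simp only [RCLike.ofReal_add]
          exact (X j).nrm_add _ _
            (RCLike.continuous_ofReal.comp_aestronglyMeasurable (h1.const_mul s))
            (RCLike.continuous_ofReal.comp_aestronglyMeasurable (h2.const_mul t))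
      _ ≤ ENNReal.ofReal s * β + ENNReal.ofReal t * β := by
          rw [(X j).nrm_ofReal_mul hs h1, (X j).nrm_ofReal_mul ht h2]
          gcongr
          · exact hψ.2 j
          · exact hφ.2 j
      _ = β := by rw [← add_mul, ← ENNReal.ofReal_add hs ht, hst, ENNReal.ofReal_one, one_mul]

/-- The pointwise constraints pass to almost everywhere limits, and the norm bounds pass by the
Fatou property of each `X j`. This yields closedness in `L²`. -/
theorem IsSqrtFactorization.of_tendsto (hX : ∀ j, (X j).Fatou) (hS : MeasurableSet S)
    (hβ : β < ⊤) {f : Rd d → 𝕜}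
    {ψ : ℕ → Rd d → EuclideanSpace ℝ (Fin m)} {φ : Rd d → EuclideanSpace ℝ (Fin m)}
    (hm : ∀ k, AEStronglyMeasurable (ψ k) (volume.restrict S))
    (hψ : ∀ k, IsSqrtFactorization X S β f (ψ k))
    (hlim : ∀ᵐ x ∂(volume.restrict S), Tendsto (fun k => ψ k x) atTop (𝓝 (φ x))) :
    IsSqrtFactorization X S β f φ := by
  have hc : ∀ j, Continuous fun v : EuclideanSpace ℝ (Fin m) => v j := fun j =>
    (EuclideanSpace.proj (𝕜 := ℝ) j).continuous
  refine ⟨?_, fun j => ?_⟩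
  · filter_upwards [hlim, ae_all_iff.2 fun k => (hψ k).1] with x hx hx'
    refine ⟨fun j => ge_of_tendsto' (((hc j).tendsto _).comp hx) fun k => (hx' k).1 j,
      ge_of_tendsto' (x := atTop) (f := fun k => ∏ j, ψ k x j ^ 2) ?_ fun k => (hx' k).2⟩
    exact tendsto_finsetProd _ fun j _ => (((hc j).tendsto _).comp hx).pow 2
  · refine (hX j (fun k x => ((S.indicator (fun x => ψ k x j ^ 2) x : ℝ) : 𝕜)) _
      (fun k => ⟨RCLike.continuous_ofReal.comp_aestronglyMeasurable
        (aestronglyMeasurable_indicator_sq hS (hm k) j), ((hψ k).2 j).trans_lt hβ⟩) ?_).trans ?_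
    · filter_upwards [(ae_restrict_iff' hS).1 hlim] with x hx
      refine (RCLike.continuous_ofReal.tendsto _).comp ?_
      by_cases hxS : x ∈ S
      · simp only [hxS, indicator_of_mem]
        exact (((hc j).tendsto _).comp (hx hxS)).pow 2
      · simp [hxS]
    · exact liminf_le_of_le (by isBoundedDefault) fun b hb => by
        obtain ⟨k, hk⟩ := hb.exists
        exact hk.trans ((hψ k).2 j)

variable {w : Fin m → Rd d → ℝ}

/-- With the weight `min_j w_j`, the squared length of `ψ` is at most `∑ ψ_j² w_j`, and each term is
controlled by the duality between `X j` and its Köthe dual. The bound does not depend on `ψ` or `f`.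
-/
theorem IsSqrtFactorization.eLpNorm_le (hS : MeasurableSet S)
    (hβ : β < ⊤) {f : Rd d → 𝕜}
    {ψ : Rd d → EuclideanSpace ℝ (Fin m)} (hw : ∀ j, AEMeasurable (w j) (volume.restrict S))
    (hm : AEStronglyMeasurable ψ (volume.restrict S))
    (hψ : IsSqrtFactorization X S β f ψ) :
    eLpNorm ψ 2 ((volume.restrict S).withDensity (fun x => ⨅ j, ENNReal.ofReal (w j x)))
      ≤ (∑ j, β * (X j).dualNrm (S.indicator (fun x => (w j x : 𝕜)))) ^ (1 / 2 : ℝ) := by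
  rw [eLpNorm_eq_lintegral_rpow_enorm_toReal two_ne_zero ENNReal.ofNat_ne_top]
  simp only [ENNReal.toReal_ofNat]
  gcongr
  have hwm : AEMeasurable (fun x => ⨅ j, ENNReal.ofReal (w j x)) (volume.restrict S) :=
    AEMeasurable.iInf fun j => (hw j).ennreal_ofReal
  rw [lintegral_withDensity_eq_lintegral_mul₀ hwm (by
    exact (hm.enorm.pow_const _))]
  calc ∫⁻ x in S, ((fun x => ⨅ j, ENNReal.ofReal (w j x)) * fun x => ‖ψ x‖ₑ ^ (2 : ℝ)) x
      ≤ ∫⁻ x in S, ∑ j, ‖((ψ x j ^ 2 : ℝ) : 𝕜)‖ₑ * ‖(w j x : 𝕜)‖ₑ := by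
        refine lintegral_mono fun x => ?_
        have h1 : ‖ψ x‖ₑ ^ (2 : ℝ) = ∑ j, ENNReal.ofReal (ψ x j ^ 2) := by
          rw [← ENNReal.ofReal_sum_of_nonneg fun j _ => sq_nonneg _, ← ofReal_norm,
            ENNReal.ofReal_rpow_of_nonneg (norm_nonneg _) (by norm_num)]
          congr 1
          rw [Real.rpow_two, EuclideanSpace.real_norm_sq_eq]
        simp only [Pi.mul_apply]
        rw [h1, Finset.mul_sum]
        refine Finset.sum_le_sum fun j _ => ?_
        rw [mul_comm]
        refine mul_le_mul' ?_ ?_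
        · rw [← ofReal_norm, RCLike.norm_ofReal, abs_of_nonneg (sq_nonneg _)]
        · refine (iInf_le _ j).trans ?_
          rw [← ofReal_norm, RCLike.norm_ofReal]
          exact ENNReal.ofReal_le_ofReal (le_abs_self _)
    _ = ∑ j, ∫⁻ x in S, ‖((ψ x j ^ 2 : ℝ) : 𝕜)‖ₑ * ‖(w j x : 𝕜)‖ₑ := by
        refine lintegral_finsetSum' _ fun j _ => ?_
        have h1 : AEStronglyMeasurable (fun x => ((ψ x j ^ 2 : ℝ) : 𝕜)) (volume.restrict S) :=
          RCLike.continuous_ofReal.comp_aestronglyMeasurable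
            (((EuclideanSpace.proj (𝕜 := ℝ) j).continuous.comp_aestronglyMeasurable hm).pow 2)
        have h2 : AEStronglyMeasurable (fun x => (w j x : 𝕜)) (volume.restrict S) :=
          RCLike.continuous_ofReal.comp_aestronglyMeasurable (hw j).aestronglyMeasurable
        exact h1.enorm.mul h2.enorm
    _ ≤ _ := by
        refine Finset.sum_le_sum fun j _ => ?_
        rw [← lintegral_indicator hS]
        calc _ = ∫⁻ x, ‖((S.indicator (fun x => ψ x j ^ 2) x : ℝ) : 𝕜)‖ₑ
                * ‖S.indicator (fun x => (w j x : 𝕜)) x‖ₑ := by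
              refine lintegral_congr fun x => ?_
              by_cases hxS : x ∈ S <;> simp [hxS]
          _ ≤ _ := (X j).lintegral_mul_le (RCLike.continuous_ofReal.comp_aestronglyMeasurable
              (aestronglyMeasurable_indicator_sq hS hm j)) ((hψ.2 j).trans_lt hβ)
          _ ≤ _ := by gcongr; exact hψ.2 j

theorem exists_isSqrtFactorization (hm : 0 < m) (hS : MeasurableSet S) (hβ : β < ⊤)
    {f : Rd d → 𝕜} (h : prodNrm X f < β ^ m) :
    ∃ ψ : Rd d → EuclideanSpace ℝ (Fin m), AEStronglyMeasurable ψ (volume.restrict S) ∧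
      IsSqrtFactorization X S β f ψ := by
  have hβ0 : 0 < β := by
    rcases eq_zero_or_pos (a := β) with h0 | h0
    · simp [h0, hm.ne'] at h
    · exact h0
  obtain ⟨a, ⟨g, hg, hg0, hgfin, hfg, rfl⟩, ha⟩ := sInf_lt_iff.1 h
  -- If one factor has norm zero it vanishes almost everywhere, so `f` does too, and the zero tuple
  -- is admissible.
  by_cases hz : ∃ j, (X j).nrm (fun x => (g j x : 𝕜)) = 0
  · obtain ⟨j0, hj0⟩ := hz
    have h0 := ((X j0).nrm_eq_zero _ (RCLike.continuous_ofReal.comp_aestronglyMeasurable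
      (hg j0))).1 hj0
    refine ⟨fun _ => 0, aestronglyMeasurable_const, ae_restrict_of_ae ?_, fun j => ?_⟩
    · filter_upwards [hfg, h0] with x hx hx0
      refine ⟨fun j => le_rfl, hx.trans ?_⟩
      rw [Finset.prod_eq_zero (Finset.mem_univ j0) (by simpa using hx0)]
      exact Finset.prod_nonneg fun j _ => sq_nonneg _
    · simp [BFS.nrm_zero]
  push Not at hz
  -- Rescaling by `c j` gives every factor norm exactly `β`. The product of the norms is below `β ^
  -- m`, so the `c j` multiply to at least one and the product still dominates `f`.
  set c : Fin m → ℝ := fun j => (β / (X j).nrm (fun x => (g j x : 𝕜))).toReal with hc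
  have hcfin : ∀ j, β / (X j).nrm (fun x => (g j x : 𝕜)) ≠ ⊤ := fun j =>
    (ENNReal.div_lt_top hβ.ne (hz j)).ne
  have hc0 : ∀ j, 0 ≤ c j := fun j => ENNReal.toReal_nonneg
  have hcn : ∀ j, ENNReal.ofReal (c j) * (X j).nrm (fun x => (g j x : 𝕜)) = β := by
    intro j
    rw [hc, ENNReal.ofReal_toReal (hcfin j), ENNReal.div_mul_cancel (hz j) (hgfin j).ne]
  have hcprod : 1 ≤ ∏ j, c j := by
    have h1 : (∏ j, ENNReal.ofReal (c j)) * ∏ j, (X j).nrm (fun x => (g j x : 𝕜)) = β ^ m := by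
      rw [← Finset.prod_mul_distrib]
      simp [hcn]
    rw [← ENNReal.ofReal_prod_of_nonneg fun j _ => hc0 j] at h1
    by_contra hlt
    push Not at hlt
    have h2 : ENNReal.ofReal (∏ j, c j) ≤ 1 := by
      rw [← ENNReal.ofReal_one]; exact ENNReal.ofReal_le_ofReal hlt.le
    have h3 : β ^ m ≤ ∏ j, (X j).nrm (fun x => (g j x : 𝕜)) := by
      rw [← h1]
      calc _ ≤ 1 * ∏ j, (X j).nrm (fun x => (g j x : 𝕜)) := by gcongr
        _ = _ := one_mul _
    exact absurd ha (not_lt.2 h3)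
  have hmeas : ∀ j, AEStronglyMeasurable (fun x => c j * g j x) (volume : Measure (Rd d)) :=
    fun j => (hg j).const_mul _
  have hmeas2 : AEStronglyMeasurable
      (fun x => (WithLp.toLp 2 (fun j => Real.sqrt (c j * g j x)) : EuclideanSpace ℝ (Fin m)))
      (volume : Measure (Rd d)) :=
    (PiLp.continuous_toLp 2 (fun _ : Fin m => ℝ)).comp_aestronglyMeasurable
      (aemeasurable_pi_lambda _ fun j =>
        (Real.continuous_sqrt.comp_aestronglyMeasurable (hmeas j)).aemeasurable).aestronglyMeasurable
  have hsq : ∀ j x, Real.sqrt (c j * g j x) ^ 2 = c j * g j x := fun j x =>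
    Real.sq_sqrt (mul_nonneg (hc0 j) (hg0 j x))
  refine ⟨_, hmeas2.restrict, ae_restrict_of_ae ?_, fun j => ?_⟩
  · filter_upwards [hfg] with x hx
    refine ⟨fun j => Real.sqrt_nonneg _, hx.trans ?_⟩
    simp only [hsq, Finset.prod_mul_distrib]
    exact le_mul_of_one_le_left (Finset.prod_nonneg fun j _ => hg0 j x) hcprod
  · rw [← hcn j, ← (X j).nrm_ofReal_mul (hc0 j) (hg j)]
    refine (X j).nrm_mono (aestronglyMeasurable_indicator_sq hS hmeas2.restrict j) (hmeas j)
      (ae_of_all _ fun x => ?_)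
    by_cases hxS : x ∈ S
    · simp [hxS, hsq]
    · simp only [hxS, not_false_eq_true, indicator_of_notMem, abs_zero]
      positivity

/-- The Fatou property of product spaces, for functions supported on a set `S` on which all the
factors embed into weighted `L¹` spaces. -/
theorem prodNrm_le_of_monotone (hm : 0 < m) (hX : ∀ j, (X j).Fatou) (hS : MeasurableSet S)
    (hw : ∀ j, AEMeasurable (w j) (volume.restrict S))
    (hw0 : ∀ j, ∀ᵐ x ∂(volume.restrict S), 0 < w j x)
    (hdual : ∀ j, (X j).dualNrm (S.indicator (fun x => (w j x : 𝕜))) < ⊤)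
    {f : ℕ → Rd d → 𝕜} {F : Rd d → 𝕜} (hf : ∀ x, Monotone fun N => ‖f N x‖)
    (hfS : ∀ N x, x ∉ S → f N x = 0) (hF : ∀ᵐ x, ∃ N, ‖F x‖ ≤ ‖f N x‖) {b : ℝ≥0∞}
    (hb : ∀ N, prodNrm X (f N) ≤ b) : prodNrm X F ≤ b := by
  -- The strict room between `b` and `c` guarantees that each `f N` has a factorization of size
  -- below `c`, although the infimum need not be attained.
  refine le_of_forall_gt_imp_ge_of_dense fun c hc => ?_
  rcases eq_or_ne c ⊤ with rfl | hctop
  · exact le_top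
  -- With the `m`-th root as bound for each factor, the factors multiply to `c`.
  set β : ℝ≥0∞ := c ^ (1 / m : ℝ) with hβdef
  have hm' : (m : ℝ) ≠ 0 := by exact_mod_cast hm.ne'
  have hβm : β ^ m = c := by
    rw [hβdef, ← ENNReal.rpow_natCast, ← ENNReal.rpow_mul, one_div, inv_mul_cancel₀ hm',
      ENNReal.rpow_one]
  have hβ : β < ⊤ := ENNReal.rpow_lt_top_of_nonneg (by positivity) hctop
  set v : Rd d → ℝ≥0∞ := fun x => ⨅ j, ENNReal.ofReal (w j x) with hv
  -- The weights are positive almost everywhere on `S`, so `μ` has the same null sets as Lebesgue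
  -- measure on `S`, and almost everywhere statements can be moved both ways.
  set μ := (volume.restrict S).withDensity v with hμ
  have hvm : AEMeasurable v (volume.restrict S) :=
    AEMeasurable.iInf fun j => (hw j).ennreal_ofReal
  have hac : volume.restrict S ≪ μ := by
    refine withDensity_absolutelyContinuous' hvm ?_
    filter_upwards [ae_all_iff.2 hw0] with x hx
    have : Nonempty (Fin m) := ⟨⟨0, hm⟩⟩
    obtain ⟨j, hj⟩ := exists_eq_ciInf_of_finite (f := fun j => ENNReal.ofReal (w j x))
    simp only [hv]
    rw [← hj]
    simpa using hx j
  have hac' : μ ≪ volume.restrict S := withDensity_absolutelyContinuous _ _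
  set D := (∑ j, β * (X j).dualNrm (S.indicator (fun x => (w j x : 𝕜)))) ^ (1 / 2 : ℝ) with hD
  have hDtop : D < ⊤ := ENNReal.rpow_lt_top_of_nonneg (by norm_num)
    (ENNReal.sum_lt_top.2 fun j _ => ENNReal.mul_lt_top hβ (hdual j)).ne
  -- These sets decrease, because the functions `‖f N‖` increase and only the lower bound on the
  -- product depends on `N`.
  set A : ℕ → Set (Lp (EuclideanSpace ℝ (Fin m)) 2 μ) := fun N =>
    {ψ | IsSqrtFactorization X S β (f N) ψ}
  have hsm : ∀ ψ : Lp (EuclideanSpace ℝ (Fin m)) 2 μ,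
      AEStronglyMeasurable (ψ : Rd d → EuclideanSpace ℝ (Fin m)) (volume.restrict S) :=
    fun ψ => (Lp.stronglyMeasurable ψ).aestronglyMeasurable
  obtain ⟨ψ, hψ⟩ : (⋂ N, A N).Nonempty := by
    refine nonempty_iInter_of_antitone_convex (R := D.toReal) ?_ ?_ ?_ ?_
    · intro k l hkl ψ hψ
      refine ⟨?_, hψ.2⟩
      filter_upwards [hψ.1] with x hx
      exact ⟨hx.1, (hf x hkl).trans hx.2⟩
    · intro N
      refine IsSeqClosed.isClosed fun ψ φ hψ hlim => ?_
      have h1 : TendstoInMeasure μ (fun k => (ψ k : Rd d → EuclideanSpace ℝ (Fin m))) atTop φ :=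
        tendstoInMeasure_of_tendsto_Lp hlim
      obtain ⟨ns, -, hns⟩ := h1.exists_seq_tendsto_ae
      exact IsSqrtFactorization.of_tendsto hX hS hβ (fun k => hsm (ψ (ns k)))
        (fun k => hψ (ns k)) (hac.ae_le hns)
    · intro N ψ hψ φ hφ s t hs ht hst
      refine IsSqrtFactorization.congr hS ?_ ?_
        (IsSqrtFactorization.convexComb hS (hsm ψ) (hsm φ) hψ hφ hs ht hst)
      · exact ((hsm ψ).const_smul s).add ((hsm φ).const_smul t)
      · refine hac.ae_le ?_
        filter_upwards [Lp.coeFn_add (s • ψ) (t • φ), Lp.coeFn_smul s ψ, Lp.coeFn_smul t φ]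
          with x h1 h2 h3
        rw [h1, Pi.add_apply, h2, h3]
        rfl
    · intro N
      obtain ⟨ψ, hψm, hψ⟩ := exists_isSqrtFactorization (X := X) (β := β) hm hS hβ
        (((hb N).trans_lt hc).trans_eq hβm.symm)
      have hle := hψ.eLpNorm_le hS hβ hw hψm
      have hmem : MemLp ψ 2 μ := ⟨hψm.mono_ac hac', hle.trans_lt hDtop⟩
      refine ⟨hmem.toLp ψ, ?_, ?_⟩
      · exact IsSqrtFactorization.congr hS hψm (hac.ae_le hmem.coeFn_toLp.symm) hψ
      · rw [Lp.norm_toLp]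
        exact ENNReal.toReal_mono hDtop.ne hle
  rw [mem_iInter] at hψ
  have hg : ∀ j, AEStronglyMeasurable (S.indicator fun x => ψ x j ^ 2)
      (volume : Measure (Rd d)) := fun j => aestronglyMeasurable_indicator_sq hS (hsm ψ) j
  refine (prodNrm_le X hg (fun j x => indicator_nonneg (fun _ _ => sq_nonneg _) x)
    (fun j => ((hψ 0).2 j).trans_lt hβ) ?_).trans ?_
  · filter_upwards [hF, ae_all_iff.2 fun N => (ae_restrict_iff' hS).1 (hψ N).1] with x ⟨N, hN⟩ hx
    refine hN.trans ?_
    by_cases hxS : x ∈ S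
    · simpa [hxS] using (hx N hxS).2
    · rw [hfS N x hxS, norm_zero]
      exact Finset.prod_nonneg fun j _ => indicator_nonneg (fun _ _ => sq_nonneg _) x
  · calc _ ≤ ∏ _j : Fin m, β := Finset.prod_le_prod' fun j _ => (hψ 0).2 j
      _ = c := by simp [hβm]

end ProdFatou

/-! ### Cubes -/

section Cube

variable {d : ℕ} (Q : Cube d)

theorem Cube.set_eq_preimage :
    Q.set = (MeasurableEquiv.toLp 2 (Fin d → ℝ)).symm ⁻¹'
      Icc (fun i => Q.corner i) (fun i => Q.corner i + Q.side) := by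
  ext x
  simp [Cube.set, Pi.le_def, forall_and]

theorem Cube.volume_set : volume Q.set = ENNReal.ofReal Q.side ^ d := by
  rw [Q.set_eq_preimage, (EuclideanSpace.volume_preserving_symm_measurableEquiv_toLp
    (Fin d)).measure_preimage measurableSet_Icc.nullMeasurableSet, Real.volume_Icc_pi]
  simp

theorem Cube.isClosed : IsClosed Q.set := by
  have hc : ∀ i, Continuous fun x : Rd d => x i := fun i => by fun_prop
  have h : Q.set = ⋂ i, {x : Rd d | Q.corner i ≤ x i} ∩ {x | x i ≤ Q.corner i + Q.side} := by
    ext x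
    simp [Cube.set]
  rw [h]
  exact isClosed_iInter fun i => (isClosed_le continuous_const (hc i)).inter
    (isClosed_le (hc i) continuous_const)

theorem Cube.measurableSet : MeasurableSet Q.set := Q.isClosed.measurableSet

theorem Cube.isCompact : IsCompact Q.set := by
  refine Metric.isCompact_of_isClosed_isBounded Q.isClosed ?_
  rw [Metric.isBounded_iff_subset_closedBall 0]
  refine ⟨∑ i, (|Q.corner i| + Q.side), fun x hx => ?_⟩
  rw [mem_closedBall_zero_iff]
  have h1 : ‖x‖ ≤ ∑ i, ‖x i‖ := by
    conv_lhs => rw [← (EuclideanSpace.basisFun (Fin d) ℝ).sum_repr x]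
    refine (norm_sum_le _ _).trans (Finset.sum_le_sum fun i _ => ?_)
    simp [norm_smul]
  refine h1.trans (Finset.sum_le_sum fun i _ => ?_)
  have h2 := hx i
  rw [Real.norm_eq_abs, abs_le]
  have h3 := le_abs_self (Q.corner i)
  have h4 := neg_abs_le (Q.corner i)
  have := Q.side_pos
  constructor <;> linarith

theorem Cube.volume_lt_top : volume Q.set < ⊤ := Q.isCompact.measure_lt_top

theorem Cube.vol_eq : Q.vol = Q.side ^ d := by
  rw [Cube.vol, Q.volume_set, ENNReal.toReal_pow, ENNReal.toReal_ofReal Q.side_pos.le]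

theorem Cube.vol_pos : 0 < Q.vol := by
  rw [Q.vol_eq]
  exact pow_pos Q.side_pos d

theorem Cube.volume_ne_zero : volume Q.set ≠ 0 := by
  rw [Q.volume_set]
  exact pow_ne_zero _ (by simpa using Q.side_pos)

theorem Cube.convex : Convex ℝ Q.set := by
  intro x hx y hy s t hs ht hst i
  have h1 := hx i
  have h2 := hy i
  simp only [WithLp.ofLp_add, WithLp.ofLp_smul, Pi.add_apply, Pi.smul_apply, smul_eq_mul]
  obtain rfl : t = 1 - s := by linarith
  constructor <;> nlinarith

/-- The frontier of a convex set is null. Interior points are needed because the kernel bound only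
holds off a closed support set. -/
theorem Cube.ae_mem_interior : ∀ᵐ x, x ∈ Q.set → x ∈ interior Q.set := by
  have h : volume (frontier Q.set) = 0 := Q.convex.addHaar_frontier volume
  filter_upwards [compl_mem_ae_iff.2 h] with x hx hxQ
  by_contra hn
  exact hx ⟨subset_closure hxQ, hn⟩

theorem Cube.setAverage_eq {E : Type*} [NormedAddCommGroup E] [NormedSpace ℝ E] (f : Rd d → E) :
    ⨍ y in Q.set, f y = (Q.vol)⁻¹ • ∫ y in Q.set, f y := by
  rw [MeasureTheory.setAverage_eq]
  rfl

end Cube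

/-! ### Bounded functions of compact support -/

section Linfc

variable {d : ℕ} {V : Type*} [NormedAddCommGroup V]

theorem IsLinfc.memLp {f : Rd d → V} (hf : IsLinfc f) (q : ℝ≥0∞) : MemLp f q volume := by
  have hc : MeasurableSet (tsupport f) := (isClosed_tsupport f).measurableSet
  have : IsFiniteMeasure ((volume : Measure (Rd d)).restrict (tsupport f)) :=
    ⟨by simpa using hf.2.isCompact.measure_lt_top⟩
  have h1 : MemLp f q (volume.restrict (tsupport f)) :=
    (hf.1.restrict (tsupport f)).mono_exponent le_top
  rw [← memLp_indicator_iff_restrict hc] at h1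
  rwa [indicator_eq_self.2 (subset_tsupport f)] at h1

theorem IsLinfc.integrable {f : Rd d → V} (hf : IsLinfc f) : Integrable f :=
  memLp_one_iff_integrable.1 (hf.memLp 1)

theorem IsLinfc.aestronglyMeasurable {f : Rd d → V} (hf : IsLinfc f) :
    AEStronglyMeasurable f (volume : Measure (Rd d)) := hf.1.1

/-- Bounded measurable functions supported in a cube. -/
theorem isLinfc_of_bound {f : Rd d → V} {Q : Cube d} {B : ℝ}
    (hf : AEStronglyMeasurable f (volume : Measure (Rd d)))
    (hQ : Function.support f ⊆ Q.set) (hB : ∀ x, ‖f x‖ ≤ B) : IsLinfc f :=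
  ⟨memLp_top_of_bound hf B (ae_of_all _ hB),
    HasCompactSupport.of_support_subset_isCompact Q.isCompact hQ⟩

theorem IsLinfc.add {f g : Rd d → V} (hf : IsLinfc f) (hg : IsLinfc g) :
    IsLinfc (fun x => f x + g x) :=
  ⟨hf.1.add hg.1, hf.2.add hg.2⟩

theorem IsLinfc.indicator {f : Rd d → V} (hf : IsLinfc f) {S : Set (Rd d)}
    (hS : MeasurableSet S) : IsLinfc (S.indicator f) :=
  ⟨hf.1.indicator hS, hf.2.mono (by
    rw [support_indicator]; exact inter_subset_right)⟩

theorem IsLinfc.clm_comp {𝕜 : Type*} [RCLike 𝕜] [NormedSpace 𝕜 V] {V' : Type*}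
    [NormedAddCommGroup V'] [NormedSpace 𝕜 V'] {f : Rd d → V} (hf : IsLinfc f)
    (A : V →L[𝕜] V') : IsLinfc (fun x => A (f x)) :=
  ⟨A.comp_memLp' hf.1, hf.2.comp_left (g := A) (map_zero A)⟩

theorem IsLinfc.mul_bdd {𝕜 : Type*} [RCLike 𝕜] [NormedSpace 𝕜 V] {f : Rd d → V} (hf : IsLinfc f)
    {φ : Rd d → 𝕜} (hφ : AEStronglyMeasurable φ (volume : Measure (Rd d)))
    (hφ1 : ∀ x, ‖φ x‖ ≤ 1) : IsLinfc (fun x => φ x • f x) := by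
  refine ⟨hf.1.mono (hφ.smul hf.1.1) (ae_of_all _ fun x => ?_), hf.2.mono ?_⟩
  · rw [norm_smul]
    exact mul_le_of_le_one_left (norm_nonneg _) (hφ1 x)
  · intro x hx hx0
    exact hx (by simp [hx0])

end Linfc

/-! ### Algebra of Calderón–Zygmund operators -/

section App

variable {𝕜 : Type*} [RCLike 𝕜] {d m : ℕ} (T : CZOperator 𝕜 d m)

theorem CZOperator.app_eq {f : Fin m → Rd d → 𝕜} (hf : ∀ j, IsLinfc (f j)) :
    T.app f = T.ext (fun j => ((hf j).memLp (T.q j)).toLp (f j)) := by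
  rw [CZOperator.app, evalLp, dif_pos fun j => (hf j).memLp (T.q j)]

theorem CZOperator.aestronglyMeasurable_app {f : Fin m → Rd d → 𝕜} (hf : ∀ j, IsLinfc (f j)) :
    AEStronglyMeasurable (T.app f) (volume : Measure (Rd d)) := by
  rw [T.app_eq hf]
  exact Lp.aestronglyMeasurable _

theorem CZOperator.app_mul {f : Fin m → Rd d → 𝕜} (hf : ∀ j, IsLinfc (f j)) (c : Fin m → 𝕜) :
    T.app (fun j x => f j x * c j) =ᵐ[volume] fun x => T.app f x * ∏ j, c j := by
  have hf' : ∀ j, IsLinfc (fun x => f j x * c j) := fun j => by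
    simpa [mul_comm] using (hf j).clm_comp (ContinuousLinearMap.mul 𝕜 𝕜 (c j))
  rw [T.app_eq hf', T.app_eq hf]
  have h1 : (fun j => ((hf' j).memLp (T.q j)).toLp (fun x => f j x * c j))
      = fun j => c j • ((hf j).memLp (T.q j)).toLp (f j) := by
    funext j
    rw [← MemLp.toLp_const_smul]
    refine MemLp.toLp_congr _ _ (ae_of_all _ fun x => ?_)
    simp [mul_comm]
  rw [h1, MultilinearMap.map_smul_univ]
  filter_upwards [Lp.coeFn_smul (∏ j, c j)
    (T.ext fun j => ((hf j).memLp (T.q j)).toLp (f j))] with x hx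
  rw [hx, Pi.smul_apply, smul_eq_mul, mul_comm]

theorem isLinfc_piecewise {V : Type*} [NormedAddCommGroup V] {u v : Fin m → Rd d → V}
    (hu : ∀ j, IsLinfc (u j)) (hv : ∀ j, IsLinfc (v j)) (s : Finset (Fin m)) (j : Fin m) :
    IsLinfc (s.piecewise u v j) := by
  by_cases hj : j ∈ s
  · simpa [hj] using hu j
  · simpa [hj] using hv j

theorem CZOperator.app_add {u v : Fin m → Rd d → 𝕜} (hu : ∀ j, IsLinfc (u j))
    (hv : ∀ j, IsLinfc (v j)) :
    T.app (fun j x => u j x + v j x)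
      =ᵐ[volume] fun x => ∑ s : Finset (Fin m), T.app (s.piecewise u v) x := by
  have huv : ∀ j, IsLinfc (fun x => u j x + v j x) := fun j => (hu j).add (hv j)
  rw [T.app_eq huv]
  have h1 : (fun j => ((huv j).memLp (T.q j)).toLp (fun x => u j x + v j x))
      = (fun j => ((hu j).memLp (T.q j)).toLp (u j))
        + fun j => ((hv j).memLp (T.q j)).toLp (v j) := by
    funext j
    exact MemLp.toLp_add _ _
  rw [h1, MultilinearMap.map_add_univ]
  have h2 : ∀ s : Finset (Fin m), T.app (s.piecewise u v)
      = T.ext (s.piecewise (fun j => ((hu j).memLp (T.q j)).toLp (u j))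
          fun j => ((hv j).memLp (T.q j)).toLp (v j)) := by
    intro s
    rw [T.app_eq (isLinfc_piecewise hu hv s)]
    refine congrArg (fun g => (T.ext g : Rd d → 𝕜)) (funext fun j => ?_)
    by_cases hj : j ∈ s
    · simp only [hj, Finset.piecewise_eq_of_mem]
    · simp only [hj, not_false_eq_true, Finset.piecewise_eq_of_notMem]
  filter_upwards [Lp.coeFn_finsetSum Finset.univ fun s : Finset (Fin m) =>
    T.ext (s.piecewise (fun j => ((hu j).memLp (T.q j)).toLp (u j))
          fun j => ((hv j).memLp (T.q j)).toLp (v j))] with x hx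
  rw [hx]
  simp [h2]

variable {n : Fin m → ℕ}

theorem CZOperator.aestronglyMeasurable_tilde {f : ∀ j, Rd d → Hil 𝕜 (n j)}
    (hf : ∀ j, IsLinfc (f j)) :
    AEStronglyMeasurable (T.tilde f) (volume : Measure (Rd d)) := by
  refine (PiLp.continuous_toLp 2 (fun _ : ∀ j, Fin (n j) => 𝕜)).comp_aestronglyMeasurable
    (aemeasurable_pi_lambda _ fun k => ?_).aestronglyMeasurable
  exact (T.aestronglyMeasurable_app fun j =>
    (hf j).clm_comp (EuclideanSpace.proj (𝕜 := 𝕜) (k j))).aemeasurable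

theorem CZOperator.tilde_smul {u : Fin m → Rd d → 𝕜} (hu : ∀ j, IsLinfc (u j))
    (v : ∀ j, Hil 𝕜 (n j)) :
    T.tilde (fun j x => u j x • v j) =ᵐ[volume] fun x => T.app u x • tensor v := by
  have h := ae_all_iff.2 fun k : ∀ j, Fin (n j) => T.app_mul hu (fun j => v j (k j))
  filter_upwards [h] with x hx
  ext k
  simpa [CZOperator.tilde, tensor] using hx k

theorem isLinfc_smul_const {u : Rd d → 𝕜} (hu : IsLinfc u) {V : Type*} [NormedAddCommGroup V]
    [NormedSpace 𝕜 V] (v : V) : IsLinfc (fun x => u x • v) :=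
  hu.clm_comp ((ContinuousLinearMap.id 𝕜 𝕜).smulRight v)

end App

/-! ### Pointwise kernel bounds -/

section Kernel

variable {𝕜 : Type*} [RCLike 𝕜] {d m : ℕ}

theorem norm_sub_le_spread (y : Fin (m + 1) → Rd d) (k l : Fin (m + 1)) :
    ‖y k - y l‖ ≤ spread y :=
  (Finset.single_le_sum (f := fun l => ‖y k - y l‖) (fun _ _ => norm_nonneg _)
    (Finset.mem_univ l)).trans
  (Finset.single_le_sum (f := fun k => ∑ l, ‖y k - y l‖)
    (fun _ _ => Finset.sum_nonneg fun _ _ => norm_nonneg _) (Finset.mem_univ k))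

theorem integrable_prod_norm {V : Type*} [NormedAddCommGroup V] {u : Fin m → Rd d → V}
    (hu : ∀ j, IsLinfc (u j)) :
    Integrable (fun y : Fin m → Rd d => ∏ j, ‖u j (y j)‖) :=
  Integrable.fintype_prod fun j => (hu j).integrable.norm

/-- When `x` is outside `F` and one argument `y i` is in `F`, the spread is at least the distance of
`x` to `F`, so the size condition bounds the kernel by a quantity depending on `x` alone. It is
enough that a single function is supported in `F`. -/
theorem CZOperator.exists_kernel_bound (T : CZOperator 𝕜 d m) (F : Set (Rd d))
    (hF : IsClosed F) : ∃ M : Rd d → ℝ, ∀ u : Fin m → Rd d → 𝕜,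
      (∀ j, IsLinfc (u j)) → ∀ i, Function.support (u i) ⊆ F →
      ∀ᵐ x, x ∉ F → ‖T.app u x‖ ≤ M x * ∏ j, ∫ y, ‖u j y‖ := by
  obtain ⟨CK, hCK, hbd, -⟩ := T.isCZKernel.bounds
  refine ⟨fun x => CK / Metric.infDist x F ^ (m * d), fun u hu i hi => ?_⟩
  filter_upwards [T.representation u hu] with x hx hxF
  have hts : tsupport (u i) ⊆ F := closure_minimal hi hF
  rw [CZOperator.app, hx fun h => hxF (hts (mem_iInter.1 h i))]
  calc ‖∫ y : Fin m → Rd d, T.kernel (Fin.cons (α := fun _ => Rd d) x y) * ∏ j, u j (y j)‖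
      ≤ ∫ y : Fin m → Rd d, (CK / Metric.infDist x F ^ (m * d)) * ∏ j, ‖u j (y j)‖ := by
        refine norm_integral_le_of_norm_le ((integrable_prod_norm hu).const_mul _)
          (ae_of_all _ fun y => ?_)
        rw [norm_mul, norm_prod]
        by_cases h0 : u i (y i) = 0
        · have : ∏ j, ‖u j (y j)‖ = 0 := Finset.prod_eq_zero (Finset.mem_univ i) (by simp [h0])
          simp [this]
        · have hyF : y i ∈ F := hi h0
          have hpos : 0 < Metric.infDist x F :=
            (hF.notMem_iff_infDist_pos ⟨_, hyF⟩).1 hxF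
          have hle : Metric.infDist x F ≤ spread (Fin.cons (α := fun _ => Rd d) x y) := by
            refine (Metric.infDist_le_dist_of_mem hyF).trans ?_
            rw [dist_eq_norm]
            simpa using norm_sub_le_spread (Fin.cons (α := fun _ => Rd d) x y) 0 i.succ
          gcongr
          refine (hbd _ fun hdiag => ?_).trans ?_
          · have := hdiag 0 i.succ
            simp only [Fin.cons_zero, Fin.cons_succ] at this
            exact hxF (this ▸ hyF)
          · gcongr
    _ = _ := by
      rw [integral_const_mul, integral_fintype_prod_volume_eq_prod (f := fun j y => ‖u j y‖)]

end Kernel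

/-! ### Consequences of the averaging representation -/

section Multi

/-- The infimum is itself admissible: divide by the product of the norms if it is positive. If the
product is zero, any admissible finite constant forces the left side to vanish. -/
theorem multiNorm_spec {I : Type*} [Fintype I] {V : I → Type*} {U : Type*}
    {D : (∀ j, V j) → Prop} {A : (∀ j, V j) → U} {Nsrc : ∀ j, V j → ℝ≥0∞} {Ntgt : U → ℝ≥0∞}
    (h : multiNorm D A Nsrc Ntgt < ⊤) {f : ∀ j, V j} (hf : D f) (hfin : ∀ j, Nsrc j (f j) < ⊤) :
    Ntgt (A f) ≤ multiNorm D A Nsrc Ntgt * ∏ j, Nsrc j (f j) := by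
  have hp : ∏ j, Nsrc j (f j) ≠ ⊤ := (ENNReal.prod_lt_top fun j _ => hfin j).ne
  by_cases h0 : ∏ j, Nsrc j (f j) = 0
  · obtain ⟨B, hB, -⟩ := sInf_lt_iff.1 h
    have := hB f hf hfin
    rw [h0, mul_zero] at this ⊢
    exact this
  · rw [← ENNReal.div_le_iff h0 hp]
    exact le_sInf fun B hB => (ENNReal.div_le_iff h0 hp).2 (hB f hf hfin)

end Multi

section Average

variable {𝕜 : Type*} [RCLike 𝕜] {d m : ℕ}

/-- The bound on `S` supplies the normalization of the averages, and Fubini turns the integral of a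
product into a product of integrals. -/
theorem norm_map_setIntegral_smul_le {E E' : Type*} [NormedAddCommGroup E] [NormedSpace ℝ E]
    [NormedSpace 𝕜 E] [CompleteSpace E] [NormedAddCommGroup E'] [NormedSpace ℝ E']
    [NormedSpace 𝕜 E'] [CompleteSpace E']
    (A : E →L[𝕜] E') {Q : Cube d} {S : (Fin m → Rd d) → 𝕜} {F : (Fin m → Rd d) → E}
    {g : Fin m → Rd d → ℝ}
    (hS : ∀ᵐ y ∂(volume.restrict (Set.pi Set.univ fun _ : Fin m => Q.set)),
      ‖S y‖ ≤ (Q.vol ^ m)⁻¹)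
    (hg : ∀ j, IntegrableOn (g j) Q.set) (hF : ∀ y, ‖A (F y)‖ ≤ ∏ j, g j (y j)) :
    ‖A (∫ y in Set.pi Set.univ fun _ : Fin m => Q.set, S y • F y)‖
      ≤ ∏ j, ⨍ y in Q.set, g j y := by
  have hres : (volume : Measure (Fin m → Rd d)).restrict (Set.pi Set.univ fun _ => Q.set)
      = Measure.pi fun _ => volume.restrict Q.set := by
    rw [volume_pi, Measure.restrict_pi_pi]
  have hvol := Q.vol_pos
  have hprod : ∏ j, ⨍ y in Q.set, g j y
      = ∫ y in Set.pi Set.univ fun _ : Fin m => Q.set, (Q.vol ^ m)⁻¹ * ∏ j, g j (y j) := by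
    rw [integral_const_mul, hres, integral_fintype_prod_eq_prod (f := fun j y => g j y)]
    simp only [Q.setAverage_eq, smul_eq_mul, Finset.prod_mul_distrib]
    simp
  have hint : Integrable (fun y : Fin m → Rd d => (Q.vol ^ m)⁻¹ * ∏ j, g j (y j))
      (volume.restrict (Set.pi Set.univ fun _ => Q.set)) := by
    rw [hres]
    exact (Integrable.fintype_prod hg).const_mul _
  have hle : ∀ᵐ y ∂(volume.restrict (Set.pi Set.univ fun _ : Fin m => Q.set)),
      ‖A (S y • F y)‖ ≤ (Q.vol ^ m)⁻¹ * ∏ j, g j (y j) := by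
    filter_upwards [hS] with y hy
    rw [map_smul, norm_smul]
    exact mul_le_mul hy (hF y) (norm_nonneg _) (by positivity)
  rw [hprod]
  -- Without integrability the Bochner integral is zero by convention, and only the nonnegativity of
  -- the right side is needed.
  by_cases hi : Integrable (fun y => S y • F y)
      (volume.restrict (Set.pi Set.univ fun _ : Fin m => Q.set))
  · rw [← A.integral_comp_comm hi]
    exact norm_integral_le_of_norm_le hint hle
  · rw [integral_undef hi, map_zero, norm_zero]
    refine integral_nonneg_of_ae ?_
    filter_upwards [hle] with y hy
    exact (norm_nonneg _).trans hy

theorem AverageRepresentation.ae_bound {S : Rd d → (Fin m → Rd d) → 𝕜} {Q Q' : Cube d}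
    (hS : ∀ᵐ z ∂(volume.restrict (Q'.set ×ˢ Set.pi Set.univ (fun _ : Fin m => Q.set))),
      ‖Function.uncurry S z‖ ≤ (Q.vol ^ m)⁻¹) :
    ∀ᵐ x, x ∈ Q'.set → ∀ᵐ y ∂(volume.restrict (Set.pi Set.univ fun _ : Fin m => Q.set)),
      ‖S x y‖ ≤ (Q.vol ^ m)⁻¹ := by
  rw [Measure.volume_eq_prod, ← Measure.prod_restrict] at hS
  exact (ae_restrict_iff' Q'.measurableSet).1 (Measure.ae_ae_of_ae_prod hS)

variable {n : Fin m → ℕ} {T : CZOperator 𝕜 d m} {α C : ℝ} {Q Q' : Cube d}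

theorem setAverage_smul_const (u : Rd d → 𝕜) {E : Type*} [NormedAddCommGroup E]
    [NormedSpace ℝ E] [NormedSpace 𝕜 E] [CompleteSpace E] (v : E) :
    ⨍ y in Q.set, u y • v = (⨍ y in Q.set, u y) • v := by
  rw [average, average, integral_smul_const]

/-- Testing on functions of fixed direction `v j` makes all terms multiples of one elementary
tensor, which leaves an identity between scalars. -/
theorem AverageRepresentation.scalar (h : AverageRepresentation n T α C Q Q')
    {u : Fin m → Rd d → 𝕜} (hu : ∀ j, IsLinfc (u j)) (huQ : ∀ j, Function.support (u j) ⊆ Q.set)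
    (v : ∀ j, Hil 𝕜 (n j)) :
    ∀ᵐ x, x ∈ Q'.set → ∃ s : 𝕜, ‖s‖ ≤ ∏ j, ⨍ y in Q.set, ‖u j y‖ ∧
      (∏ j, ⨍ y in Q.set, u j y) • tensor v
        = (((1 - α) * C : ℝ) : 𝕜) • (T.app u x • tensor v) + (α : 𝕜) • (s • tensor v) := by
  obtain ⟨S, -, hS, hrep⟩ := h
  filter_upwards [AverageRepresentation.ae_bound hS,
    hrep (fun j x => u j x • v j) (fun j => isLinfc_smul_const (hu j) (v j))
      (fun j => (Function.support_smul_subset_left _ _).trans (huQ j)),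
    T.tilde_smul hu v] with x hx1 hx2 hx3 hxQ
  refine ⟨∫ y in Set.pi Set.univ fun _ : Fin m => Q.set, S x y • ∏ j, u j (y j), ?_, ?_⟩
  · exact norm_map_setIntegral_smul_le (ContinuousLinearMap.id 𝕜 𝕜) (hx1 hxQ)
      (fun j => (hu j).integrable.norm.integrableOn) (fun y => by simp)
  · have h2 := hx2 hxQ
    simp only [setAverage_smul_const, tensor_smul] at h2
    rw [h2, hx3]
    congr 2
    rw [← integral_smul_const]
    simp only [smul_assoc]

theorem tensor_single_ne_zero (k : ∀ j, Fin (n j)) :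
    tensor (fun j => EuclideanSpace.single (k j) (1 : 𝕜)) ≠ 0 := by
  rw [tensor_single]
  simp

/-- The scalar identity is solved for `T u`. Dividing by the elementary tensor needs a nonzero one,
hence the positive dimensions. The kernel bound says nothing at points where the supports may meet,
and this estimate replaces it there. -/
theorem AverageRepresentation.norm_app_le (h : AverageRepresentation n T α C Q Q')
    (hn : ∀ j, 0 < n j) (h0 : 0 < α) (h1 : α < 1) (hC : 0 < C)
    {u : Fin m → Rd d → 𝕜} (hu : ∀ j, IsLinfc (u j))
    (huQ : ∀ j, Function.support (u j) ⊆ Q.set) :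
    ∀ᵐ x, x ∈ Q'.set → ‖T.app u x‖
      ≤ ((1 - α) * C)⁻¹ * (1 + α) * (Q.vol ^ m)⁻¹ * ∏ j, ∫ y, ‖u j y‖ := by
  filter_upwards [h.scalar hu huQ fun j => EuclideanSpace.single ⟨0, hn j⟩ (1 : 𝕜)] with x hx hxQ
  obtain ⟨s, hs, heq⟩ := hx hxQ
  rw [smul_smul, smul_smul, ← add_smul] at heq
  have heq' := smul_left_injective 𝕜 (tensor_single_ne_zero (𝕜 := 𝕜) fun j => ⟨0, hn j⟩) heq
  have hP : ∏ j, ⨍ y in Q.set, ‖u j y‖ = (Q.vol ^ m)⁻¹ * ∏ j, ∫ y, ‖u j y‖ := by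
    have : ∀ j, ⨍ y in Q.set, ‖u j y‖ = Q.vol⁻¹ * ∫ y, ‖u j y‖ := by
      intro j
      rw [Q.setAverage_eq, smul_eq_mul, setIntegral_eq_integral_of_forall_compl_eq_zero]
      intro y hy
      have : u j y = 0 := by
        by_contra hne
        exact hy (huQ j hne)
      simp [this]
    simp only [this, Finset.prod_mul_distrib]
    simp
  have hle : ‖∏ j, ⨍ y in Q.set, u j y‖ ≤ ∏ j, ⨍ y in Q.set, ‖u j y‖ := by
    rw [norm_prod]
    refine Finset.prod_le_prod (fun j _ => norm_nonneg _) fun j _ => ?_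
    rw [Q.setAverage_eq, Q.setAverage_eq, norm_smul, Real.norm_of_nonneg (inv_nonneg.2 Q.vol_pos.le),
      smul_eq_mul]
    exact mul_le_mul_of_nonneg_left (norm_integral_le_integral_norm _) (inv_nonneg.2 Q.vol_pos.le)
  have hpos : 0 < (1 - α) * C := mul_pos (by linarith) hC
  have hT : (1 - α) * C * ‖T.app u x‖ ≤ (1 + α) * ∏ j, ⨍ y in Q.set, ‖u j y‖ := by
    have h2 : (((1 - α) * C : ℝ) : 𝕜) * T.app u x
        = (∏ j, ⨍ y in Q.set, u j y) - (α : 𝕜) * s := eq_sub_of_add_eq heq'.symm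
    have h3 := congrArg norm h2
    rw [norm_mul, RCLike.norm_ofReal, abs_of_pos hpos] at h3
    rw [h3]
    refine (norm_sub_le _ _).trans ?_
    rw [norm_mul, RCLike.norm_ofReal, abs_of_pos h0]
    nlinarith
  rw [mul_assoc, mul_assoc, inv_mul_eq_div, le_div_iff₀ hpos, ← hP]
  linarith

/-- On `Q`, the values `T u` for `u` supported in `Q'` are controlled pointwise by products of
`L¹` norms. -/
theorem AverageRepresentation.exists_L1_bound (h : AverageRepresentation n T α C Q Q')
    (hm : 0 < m) (hn : ∀ j, 0 < n j) (h0 : 0 < α) (h1 : α < 1) (hC : 0 < C) :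
    ∃ M : Rd d → ℝ, ∀ u : Fin m → Rd d → 𝕜, (∀ j, IsLinfc (u j)) →
      (∀ j, Function.support (u j) ⊆ Q'.set) →
      ∀ᵐ x, x ∈ Q.set → ‖T.app u x‖ ≤ M x * ∏ j, ∫ y, ‖u j y‖ := by
  obtain ⟨M1, hM1⟩ := T.exists_kernel_bound Q'.set Q'.isClosed
  -- The cubes may overlap. `M1` handles points of `Q` outside `Q'`, and `M2` handles terms having a
  -- factor that lives outside `Q`.
  obtain ⟨M2, hM2⟩ := T.exists_kernel_bound (closure Q.setᶜ) isClosed_closure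
  set a := ((1 - α) * C)⁻¹ * (1 + α) * (Q.vol ^ m)⁻¹ with ha
  have ha0 : 0 ≤ a := by
    have := Q.vol_pos
    have : 0 < 1 - α := by linarith
    positivity
  refine ⟨fun x => |M1 x| + ∑ _s : Finset (Fin m), (a + |M2 x|), fun u hu huQ' => ?_⟩
  set u1 : Fin m → Rd d → 𝕜 := fun j => Q.set.indicator (u j) with hu1
  set u2 : Fin m → Rd d → 𝕜 := fun j => Q.setᶜ.indicator (u j) with hu2
  have hu1' : ∀ j, IsLinfc (u1 j) := fun j => (hu j).indicator Q.measurableSet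
  have hu2' : ∀ j, IsLinfc (u2 j) := fun j => (hu j).indicator Q.measurableSet.compl
  have hsum : (fun j x => u1 j x + u2 j x) = u := by
    funext j x
    exact congrFun (indicator_self_add_compl Q.set (u j)) x
  have hadd := T.app_add hu1' hu2'
  rw [hsum] at hadd
  set P := ∏ j, ∫ y, ‖u j y‖ with hP
  have hP0 : 0 ≤ P := Finset.prod_nonneg fun j _ => integral_nonneg fun _ => norm_nonneg _
  have hPle : ∀ s : Finset (Fin m), ∏ j, ∫ y, ‖s.piecewise u1 u2 j y‖ ≤ P := by
    intro s
    refine Finset.prod_le_prod (fun j _ => integral_nonneg fun _ => norm_nonneg _) fun j _ => ?_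
    refine integral_mono (isLinfc_piecewise hu1' hu2' s j).integrable.norm
      (hu j).integrable.norm fun y => ?_
    by_cases hj : j ∈ s
    · simp only [hj, Finset.piecewise_eq_of_mem]
      exact norm_indicator_le_norm_self _ _
    · simp only [hj, not_false_eq_true, Finset.piecewise_eq_of_notMem]
      exact norm_indicator_le_norm_self _ _
  -- On the overlap each function is split into its parts inside and outside `Q`. The term with all
  -- parts inside is bounded by property (b), which holds on `Q'`; every other term has a factor off
  -- `Q` and is bounded by the kernel in the interior of `Q`.
  have hpw : ∀ s : Finset (Fin m), ∀ᵐ x, x ∈ Q'.set → x ∈ interior Q.set →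
      ‖T.app (s.piecewise u1 u2) x‖ ≤ (a + |M2 x|) * P := by
    intro s
    by_cases hs : s = Finset.univ
    · subst hs
      filter_upwards [h.norm_app_le hn h0 h1 hC (isLinfc_piecewise hu1' hu2' Finset.univ)
        (fun j => by simp [hu1, support_indicator])] with x hx hxQ' _
      refine (hx hxQ').trans ?_
      exact mul_le_mul (le_add_of_nonneg_right (abs_nonneg _)) (hPle _)
        (Finset.prod_nonneg fun j _ => integral_nonneg fun _ => norm_nonneg _)
        (add_nonneg ha0 (abs_nonneg _))
    · obtain ⟨i, hi⟩ : ∃ i, i ∉ s := by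
        by_contra hc
        push Not at hc
        exact hs (Finset.eq_univ_iff_forall.2 hc)
      filter_upwards [hM2 _ (isLinfc_piecewise hu1' hu2' s) i (by
        simp only [hi, not_false_eq_true, Finset.piecewise_eq_of_notMem, hu2, support_indicator]
        exact inter_subset_left.trans subset_closure)] with x hx _ hxQ
      have hxn : x ∉ closure Q.setᶜ := by
        rw [closure_compl]
        exact fun hc => hc hxQ
      refine (hx hxn).trans ?_
      exact mul_le_mul ((le_abs_self _).trans (le_add_of_nonneg_left ha0)) (hPle _)
        (Finset.prod_nonneg fun j _ => integral_nonneg fun _ => norm_nonneg _)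
        (add_nonneg ha0 (abs_nonneg _))
  filter_upwards [hM1 u hu ⟨0, hm⟩ (huQ' _), ae_all_iff.2 hpw, hadd, Q.ae_mem_interior]
    with x hx1 hx2 hx3 hx4 hxQ
  rw [add_mul]
  have hs0 : 0 ≤ ∑ _s : Finset (Fin m), (a + |M2 x|) :=
    Finset.sum_nonneg fun _ _ => add_nonneg ha0 (abs_nonneg _)
  by_cases hxQ' : x ∈ Q'.set
  · refine le_trans ?_ (le_add_of_nonneg_left (mul_nonneg (abs_nonneg _) hP0))
    rw [hx3, Finset.sum_mul]
    exact (norm_sum_le _ _).trans (Finset.sum_le_sum fun s _ => hx2 s hxQ' (hx4 hxQ))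
  · refine (hx1 hxQ').trans (le_add_of_le_of_nonneg ?_ (mul_nonneg hs0 hP0))
    exact mul_le_mul_of_nonneg_right (le_abs_self _) hP0

end Average

/-! ### Weighted norms -/

section WeightedNorm

variable {𝕜 : Type*} [RCLike 𝕜] {d m : ℕ} {n : Fin m → ℕ} {X : Fin m → BFS 𝕜 d}
  {W : ∀ j, Rd d → Matrix (Fin (n j)) (Fin (n j)) 𝕜}

theorem weightedNrm_prodNrm_le {I : Type*} [Fintype I] [DecidableEq I] {V : Rd d → Matrix I I 𝕜}
    (hm : 0 < m) {c : ℝ} (hc : 0 ≤ c)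
    {f g : Rd d → EuclideanSpace 𝕜 I}
    (h : ∀ᵐ x, ‖Matrix.toEuclideanLin (V x) (f x)‖ ≤ c * ‖Matrix.toEuclideanLin (V x) (g x)‖) :
    weightedNrm (prodNrm X) V f ≤ ENNReal.ofReal c * weightedNrm (prodNrm X) V g := by
  refine le_trans (prodNrm_mono X ?_) (prodNrm_ofReal_mul_le X hm hc _)
  filter_upwards [h] with x hx
  simpa [abs_of_nonneg hc] using hx

theorem weightedNrm_mono {k : ℕ} (Y : BFS 𝕜 d) {V : Rd d → Matrix (Fin k) (Fin k) 𝕜}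
    (hV : IsMatrixWeight V) {f g : Rd d → Hil 𝕜 k}
    (hf : AEStronglyMeasurable f (volume : Measure (Rd d)))
    (hg : AEStronglyMeasurable g (volume : Measure (Rd d)))
    (h : ∀ᵐ x, ‖Matrix.toEuclideanLin (V x) (f x)‖ ≤ ‖Matrix.toEuclideanLin (V x) (g x)‖) :
    weightedNrm Y.nrm V f ≤ weightedNrm Y.nrm V g :=
  Y.nrm_mono (aestronglyMeasurable_toEuclideanLin hV.meas hf).norm
    (aestronglyMeasurable_toEuclideanLin hV.meas hg).norm (by simpa using h)

theorem weightedNrm_sum_le (hm : 0 < m) {K : ℝ≥0} (hK : IsQuasiConst X K)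
    (hW : ∀ j, IsMatrixWeight (W j)) {ι : Type*} (s : Finset ι) {f : ι → Rd d → HilT 𝕜 n}
    (hf : ∀ i, AEStronglyMeasurable (f i) (volume : Measure (Rd d))) :
    prodNrm X (fun x => ((∑ i ∈ s, ‖Matrix.toEuclideanLin (tensorWeight W x) (f i x)‖ : ℝ) : 𝕜))
      ≤ ((max 1 K : ℝ≥0) : ℝ≥0∞) ^ s.card
        * ∑ i ∈ s, weightedNrm (prodNrm X) (tensorWeight W) (f i) := by
  simp only [RCLike.ofReal_sum]
  exact prodNrm_sum_le X hm hK s fun i => RCLike.continuous_ofReal.comp_aestronglyMeasurable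
    (aestronglyMeasurable_toEuclideanLin (tensorWeight_aemeasurable hW) (hf i)).norm

/-- Pointwise `|f| ≤ ‖V⁻¹‖ |V f|`, and the Köthe dual norm integrates this. Hence functions in the
weighted space have averages over cubes. -/
theorem lintegral_enorm_le_dualNrm_mul {k : ℕ} (Y : BFS 𝕜 d) {V : Rd d → Matrix (Fin k) (Fin k) 𝕜}
    (hV : IsMatrixWeight V) (Q : Cube d) {f : Rd d → Hil 𝕜 k}
    (hf : AEStronglyMeasurable f (volume : Measure (Rd d)))
    (hfin : weightedNrm Y.nrm V f < ⊤) :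
    ∫⁻ x in Q.set, ‖f x‖ₑ ≤ weightedNrm Y.nrm V f
      * Y.dualNrm (Q.set.indicator (fun x => (invOpNorm V x : 𝕜))) := by
  refine le_trans ?_ (Y.lintegral_mul_le (RCLike.continuous_ofReal.comp_aestronglyMeasurable
    (aestronglyMeasurable_toEuclideanLin hV.meas hf).norm) hfin)
  rw [← lintegral_indicator Q.measurableSet]
  refine lintegral_mono_ae ?_
  filter_upwards [hV.posDef] with x hx
  by_cases hxQ : x ∈ Q.set
  · simp only [hxQ, indicator_of_mem]
    rw [← ofReal_norm, ← ofReal_norm, ← ofReal_norm, RCLike.norm_ofReal, RCLike.norm_ofReal,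
      abs_norm, ← ENNReal.ofReal_mul (norm_nonneg _)]
    refine ENNReal.ofReal_le_ofReal ((norm_le_invOpNorm_mul hx (f x)).trans ?_)
    rw [mul_comm]
    gcongr
    exact le_abs_self _
  · simp [hxQ]

theorem enorm_setAverage_le {k : ℕ} (Y : BFS 𝕜 d) {V : Rd d → Matrix (Fin k) (Fin k) 𝕜}
    (hV : IsMatrixWeight V) (Q : Cube d) {f : Rd d → Hil 𝕜 k}
    (hf : AEStronglyMeasurable f (volume : Measure (Rd d)))
    (hfin : weightedNrm Y.nrm V f < ⊤) :
    ‖⨍ y in Q.set, f y‖ₑ ≤ ENNReal.ofReal (Q.vol⁻¹)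
      * Y.dualNrm (Q.set.indicator (fun x => (invOpNorm V x : 𝕜))) * weightedNrm Y.nrm V f := by
  rw [Q.setAverage_eq, enorm_smul, Real.enorm_of_nonneg (inv_nonneg.2 Q.vol_pos.le), mul_assoc,
    mul_comm (BFS.dualNrm _ _)]
  gcongr
  exact (enorm_integral_le_lintegral_enorm _).trans
    (lintegral_enorm_le_dualNrm_mul Y hV Q hf hfin)

/-- Expand `v` in the standard basis, whose coordinates are at most `‖v‖`. Finiteness on `Q'` is
known only for elementary tensors, and the basis vectors are of this kind. -/
theorem weightedNrm_indicator_le_of_basis (hm : 0 < m) {K : ℝ≥0} (hK : IsQuasiConst X K)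
    (hW : ∀ j, IsMatrixWeight (W j)) (Q : Cube d) (v : HilT 𝕜 n) :
    weightedNrm (prodNrm X) (tensorWeight W) (Q.set.indicator fun _ => v)
      ≤ ‖v‖ₑ * (((max 1 K : ℝ≥0) : ℝ≥0∞) ^ Fintype.card (∀ j, Fin (n j))
        * ∑ k : ∀ j, Fin (n j), weightedNrm (prodNrm X) (tensorWeight W)
          (Q.set.indicator fun _ => tensor fun j => EuclideanSpace.single (k j) (1 : 𝕜))) := by
  have h := weightedNrm_sum_le (X := X) hm hK hW Finset.univ
    (f := fun k : ∀ j, Fin (n j) => Q.set.indicator fun _ =>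
      tensor fun j => EuclideanSpace.single (k j) (1 : 𝕜))
    (fun k => aestronglyMeasurable_const.indicator Q.measurableSet)
  refine le_trans ?_ (mul_le_mul_right h _)
  rw [← ofReal_norm]
  refine le_trans (prodNrm_mono X (ae_of_all _ fun x => ?_))
    (prodNrm_ofReal_mul_le X hm (norm_nonneg v) _)
  rw [norm_mul, RCLike.norm_ofReal, RCLike.norm_ofReal, RCLike.norm_ofReal, abs_norm, abs_norm,
    abs_of_nonneg (Finset.sum_nonneg fun _ _ => norm_nonneg _)]
  by_cases hxQ : x ∈ Q.set
  · simp only [hxQ, indicator_of_mem]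
    conv_lhs => rw [eq_sum_tensor_single v]
    rw [map_sum, Finset.mul_sum]
    refine (norm_sum_le _ _).trans (Finset.sum_le_sum fun k _ => ?_)
    rw [map_smul, norm_smul]
    gcongr
    exact PiLp.norm_apply_le v k
  · simp [hxQ]

/-- If every function of finite norm vanished on `Q`, nondegeneracy would make the indicator of `Q`
zero. So some `f` of finite norm does not, and `min 1 (‖f‖ / (1 + ρ))` restricted to `Q` works,
since its product with `ρ` is at most `‖f‖`. -/
theorem BFS.exists_bump (Y : BFS 𝕜 d) (Q : Cube d) {ρ : Rd d → ℝ}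
    (hρ : AEStronglyMeasurable ρ (volume : Measure (Rd d))) (hρ0 : ∀ x, 0 ≤ ρ x) :
    ∃ φ : Rd d → ℝ, AEStronglyMeasurable φ (volume : Measure (Rd d)) ∧ (∀ x, 0 ≤ φ x) ∧
      (∀ x, φ x ≤ 1) ∧ Function.support φ ⊆ Q.set ∧ 0 < ∫ x in Q.set, φ x ∧
      Y.nrm (fun x => ((φ x * ρ x : ℝ) : 𝕜)) < ⊤ := by
  have hne : ¬ (Q.set.indicator (fun _ => (1 : 𝕜)) =ᵐ[volume] 0) := by
    intro h
    rw [indicator_ae_eq_zero] at h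
    have h1 : Function.support (fun _ : Rd d => (1 : 𝕜)) = Set.univ := by
      ext; simp
    rw [h1, inter_univ] at h
    exact Q.volume_ne_zero h
  obtain ⟨f, hf, hfin, hbad⟩ : ∃ f : Rd d → 𝕜, AEStronglyMeasurable f (volume : Measure (Rd d)) ∧
      Y.nrm f < ⊤ ∧ ¬ (f =ᵐ[volume.restrict Q.set] 0) := by
    by_contra hcon
    push Not at hcon
    refine hne (Y.nondegenerate _ (aestronglyMeasurable_const.indicator Q.measurableSet)
      fun f hf hfin => ?_)
    have h0 := hcon f hf hfin
    have h1 : (fun x => f x * star (Q.set.indicator (fun _ => (1 : 𝕜)) x)) =ᵐ[volume] 0 := by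
      filter_upwards [(ae_restrict_iff' Q.measurableSet).1 h0] with x hx
      by_cases hxQ : x ∈ Q.set
      · simp [hx hxQ]
      · simp [hxQ]
    exact ⟨(integrable_zero _ _ _).congr h1.symm, by rw [integral_congr_ae h1]; simp⟩
  have hpos : ∀ x, 0 < 1 + ρ x := fun x => by linarith [hρ0 x]
  have hmeas : AEStronglyMeasurable (fun x => min 1 (‖f x‖ / (1 + ρ x)))
      (volume : Measure (Rd d)) :=
    (aemeasurable_const.min (hf.norm.aemeasurable.div
      (aemeasurable_const.add hρ.aemeasurable))).aestronglyMeasurable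
  have hmin0 : ∀ x, 0 ≤ min 1 (‖f x‖ / (1 + ρ x)) := fun x =>
    le_min zero_le_one (div_nonneg (norm_nonneg _) (hpos x).le)
  have hφm := hmeas.indicator Q.measurableSet
  refine ⟨_, hφm, fun x => indicator_nonneg (fun x _ => hmin0 x) x,
    fun x => indicator_apply_le' (fun _ => min_le_left _ _) fun _ => zero_le_one,
    support_indicator_subset, ?_, ?_⟩
  · rw [setIntegral_indicator Q.measurableSet, inter_self, integral_pos_iff_support_of_nonneg hmin0]
    · rw [pos_iff_ne_zero]
      intro h0
      apply hbad
      have h1 : ∀ᵐ x ∂(volume.restrict Q.set), min 1 (‖f x‖ / (1 + ρ x)) = 0 := by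
        rw [ae_iff]; exact h0
      filter_upwards [h1] with x hx
      rcases min_eq_iff.1 hx with h | h
      · norm_num at h
      · simpa [(hpos x).ne'] using h.1
    · refine Measure.integrableOn_of_bounded (M := 1) Q.volume_lt_top.ne hmeas (ae_of_all _ fun x => ?_)
      rw [Real.norm_of_nonneg (hmin0 x)]
      exact min_le_left _ _
  · refine (Y.ideal f _ hf (RCLike.continuous_ofReal.comp_aestronglyMeasurable (hφm.mul hρ))
      (ae_of_all _ fun x => ?_)).trans_lt hfin
    rw [RCLike.norm_ofReal]
    by_cases hxQ : x ∈ Q.set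
    · simp only [hxQ, indicator_of_mem, Pi.mul_apply]
      rw [abs_of_nonneg (mul_nonneg (hmin0 x) (hρ0 x))]
      calc _ ≤ ‖f x‖ / (1 + ρ x) * ρ x := by
            gcongr
            · exact hρ0 x
            · exact min_le_right _ _
        _ = ‖f x‖ * (ρ x / (1 + ρ x)) := by ring
        _ ≤ ‖f x‖ := by
            refine mul_le_of_le_one_right (norm_nonneg _) ?_
            rw [div_le_one (hpos x)]
            linarith
    · simp [hxQ]

/-- For nonnegative bumps `φ j` the product `P` of their averages also bounds the error scalar `s`.
Hence `|P - α s| ≥ (1 - α) P > 0`, and property (b) dominates the constant `tensor v` on `Q'` by a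
multiple of `T̃` applied to the bumps. -/
theorem AverageRepresentation.weightedNrm_tensor_lt_top {T : CZOperator 𝕜 d m} {α C : ℝ}
    {Q Q' : Cube d} (h : AverageRepresentation n T α C Q Q') (hm : 0 < m) (h0 : 0 < α)
    (h1 : α < 1) (hC : 0 < C) (hW : ∀ j, IsMatrixWeight (W j)) (hT : tildeNorm T X W < ⊤)
    (v : ∀ j, Hil 𝕜 (n j)) :
    weightedNrm (prodNrm X) (tensorWeight W) (Q'.set.indicator fun _ => tensor v) < ⊤ := by
  have hρ : ∀ j, AEStronglyMeasurable (fun x => ‖Matrix.toEuclideanLin (W j x) (v j)‖)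
      (volume : Measure (Rd d)) := fun j =>
    (aestronglyMeasurable_toEuclideanLin (hW j).meas aestronglyMeasurable_const).norm
  choose φ hφm hφ0 hφ1 hφQ hφpos hφfin using fun j =>
    (X j).exists_bump Q (hρ j) fun x => norm_nonneg _
  set u : Fin m → Rd d → 𝕜 := fun j x => (φ j x : 𝕜) with hu
  have hnu : ∀ j x, ‖u j x‖ = φ j x := fun j x => by
    rw [hu, RCLike.norm_ofReal, abs_of_nonneg (hφ0 j x)]
  have huQ : ∀ j, Function.support (u j) ⊆ Q.set := fun j x hx => hφQ j (by
    intro hx0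
    exact hx (by simp [hu, hx0]))
  have hul : ∀ j, IsLinfc (u j) := fun j =>
    isLinfc_of_bound (B := 1) (RCLike.continuous_ofReal.comp_aestronglyMeasurable (hφm j)) (huQ j)
      fun x => by rw [hnu]; exact hφ1 j x
  have hfin : ∀ j, weightedNrm (X j).nrm (W j) (fun x => u j x • v j) < ⊤ := by
    intro j
    convert hφfin j using 1
    simp only [weightedNrm, map_smul, norm_smul, hnu]
  have hspec := multiNorm_spec hT (f := fun j x => u j x • v j)
    (fun j => isLinfc_smul_const (hul j) (v j)) hfin
  set P : ℝ := ∏ j, ⨍ y in Q.set, φ j y with hP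
  have hPpos : 0 < P := Finset.prod_pos fun j _ => by
    rw [Q.setAverage_eq]
    exact mul_pos (inv_pos.2 Q.vol_pos) (hφpos j)
  have hPu : ∏ j, ⨍ y in Q.set, u j y = (P : 𝕜) := by
    rw [hP, RCLike.ofReal_prod]
    refine Finset.prod_congr rfl fun j _ => ?_
    rw [average, average]
    exact integral_ofReal
  have hPn : ∏ j, ⨍ y in Q.set, ‖u j y‖ = P := by simp only [hnu, hP]
  refine lt_of_le_of_lt (weightedNrm_prodNrm_le hm (c := C / P) (by positivity)
    (g := T.tilde fun j x => u j x • v j) ?_)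
    (ENNReal.mul_lt_top ENNReal.ofReal_lt_top (hspec.trans_lt
      (ENNReal.mul_lt_top hT (ENNReal.prod_lt_top fun j _ => hfin j))))
  filter_upwards [h.scalar hul huQ v, T.tilde_smul hul v] with x hx hx2
  by_cases hxQ : x ∈ Q'.set
  · obtain ⟨s, hs, heq⟩ := hx hxQ
    rw [hPn] at hs
    rw [hPu, ← hx2] at heq
    simp only [hxQ, indicator_of_mem]
    set e := Matrix.toEuclideanLin (tensorWeight W x) (tensor v)
    set t := Matrix.toEuclideanLin (tensorWeight W x) (T.tilde (fun j x => u j x • v j) x)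
    have h2 : ((P : 𝕜) - α * s) • e = (((1 - α) * C : ℝ) : 𝕜) • t := by
      rw [← map_smul, ← map_smul, sub_smul, heq, smul_smul]
      simp
    have h3 := congrArg norm h2
    have hpos : 0 < (1 - α) * C := mul_pos (by linarith) hC
    rw [norm_smul, norm_smul, RCLike.norm_ofReal, abs_of_pos hpos] at h3
    have h4 : (1 - α) * P ≤ ‖(P : 𝕜) - α * s‖ := by
      have h5 := norm_sub_norm_le (P : 𝕜) (α * s)
      rw [norm_mul, RCLike.norm_ofReal, RCLike.norm_ofReal, abs_of_pos hPpos, abs_of_pos h0] at h5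
      nlinarith
    have h6 : (1 - α) * P * ‖e‖ ≤ (1 - α) * C * ‖t‖ := by
      rw [← h3]
      gcongr
    rw [div_mul_eq_mul_div, le_div_iff₀ hPpos]
    have h7 : 0 < 1 - α := by linarith
    refine le_of_mul_le_mul_left ?_ h7
    linarith
  · simp only [hxQ, not_false_eq_true, indicator_of_notMem, map_zero, norm_zero]
    positivity

end WeightedNorm

/-! ### Averages of convex bodies -/

section ConvexBody

variable {𝕜 : Type*} [RCLike 𝕜]

/-- A bounded set in a finite-dimensional space is contained in a multiple of the symmetric convex
hull of a few of its points. -/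
theorem exists_bounded_coefficients (r : ℕ) : ∃ c : ℝ, 0 ≤ c ∧
    ∀ {E : Type*} [NormedAddCommGroup E] [InnerProductSpace 𝕜 E] [FiniteDimensional 𝕜 E]
      (P : E →ₗ[𝕜] E), Module.finrank 𝕜 (LinearMap.range P) ≤ r → ∀ s : Set E, s.Nonempty →
      (∃ R : ℝ, ∀ w ∈ s, ‖P w‖ ≤ R) →
      ∃ v : Fin r → E, (∀ i, v i ∈ s) ∧
        ∀ w ∈ s, ∃ a : Fin r → 𝕜, (∀ i, ‖a i‖ ≤ c) ∧ P w = ∑ i, a i • P (v i) := by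
  induction r with
  | zero =>
    refine ⟨0, le_rfl, fun P hP s _ _ => ⟨Fin.elim0, fun i => i.elim0, fun w _ =>
      ⟨Fin.elim0, fun i => i.elim0, ?_⟩⟩⟩
    have h0 : LinearMap.range P = ⊥ := Submodule.finrank_eq_zero.1 (Nat.le_zero.1 hP)
    rw [LinearMap.range_eq_bot.1 h0]
    simp
  | succ r ih =>
    obtain ⟨c, hc0, hc⟩ := ih
    -- The first two terms bound the coefficient of the new point, the last one the coefficients
    -- from the induction. The map `P` carries the induction: its rank drops while the chosen points
    -- stay in the original set `s`.
    refine ⟨2 + 2 * (r * c) + c, by positivity, fun {E} _ _ _ P hP s hs ⟨R, hR⟩ => ?_⟩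
    by_cases hz : ∀ w ∈ s, P w = 0
    · obtain ⟨w0, hw0⟩ := hs
      exact ⟨fun _ => w0, fun _ => hw0, fun w hw => ⟨0, fun i => by simp; positivity,
        by simp [hz w hw]⟩⟩
    push Not at hz
    obtain ⟨w1, hw1, hPw1⟩ := hz
    set B := sSup ((fun w => ‖P w‖) '' s) with hB
    have hbdd : BddAbove ((fun w => ‖P w‖) '' s) := ⟨R, by rintro _ ⟨w, hw, rfl⟩; exact hR w hw⟩
    have hle : ∀ w ∈ s, ‖P w‖ ≤ B := fun w hw => le_csSup hbdd ⟨w, hw, rfl⟩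
    have hBpos : 0 < B := (norm_pos_iff.2 hPw1).trans_le (hle w1 hw1)
    -- A maximizer of `‖P w‖` need not exist. A point with more than half the supremum suffices, and
    -- keeps the coefficient along `P v0` below 2 on `s`.
    obtain ⟨_, ⟨v0, hv0, rfl⟩, hlt⟩ := exists_lt_of_lt_csSup (hs.image _) (half_lt_self hBpos)
    set b := P v0 with hb
    have hbpos : 0 < ‖b‖ := (half_pos hBpos).trans hlt
    have hbne : b ≠ 0 := norm_pos_iff.1 hbpos
    have hbK : ((‖b‖ : 𝕜)) ^ 2 ≠ 0 := pow_ne_zero _ (by simpa using hbne)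
    set ℓ : E →ₗ[𝕜] 𝕜 := ((‖b‖ : 𝕜) ^ 2)⁻¹ • ((innerSL 𝕜 b).toLinearMap ∘ₗ P) with hℓ
    have hℓa : ∀ w, ℓ w = ((‖b‖ : 𝕜) ^ 2)⁻¹ * inner 𝕜 b (P w) := fun w => by simp [hℓ]
    have hℓb : ∀ w ∈ s, ‖ℓ w‖ ≤ 2 := by
      intro w hw
      rw [hℓa, norm_mul, norm_inv, norm_pow, RCLike.norm_ofReal, abs_norm, inv_mul_le_iff₀
        (by positivity)]
      refine (norm_inner_le_norm _ _).trans ?_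
      have := hle w hw
      have h2 : B / 2 < ‖b‖ := hlt
      nlinarith
    -- Removing the component along `b` makes the range orthogonal to `b`, so it loses at least one
    -- dimension.
    set P' : E →ₗ[𝕜] E := P - ℓ.smulRight b with hP'
    have hP'a : ∀ w, P' w = P w - ℓ w • b := fun w => by simp [hP']
    have hort : ∀ w, inner 𝕜 b (P' w) = 0 := by
      intro w
      rw [hP'a, inner_sub_right, inner_smul_right, inner_self_eq_norm_sq_to_K, hℓa, mul_right_comm,
        inv_mul_cancel₀ hbK, one_mul, sub_self]
    have hrange : LinearMap.range P' < LinearMap.range P := by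
      refine lt_of_le_of_ne ?_ fun heq => ?_
      · rintro _ ⟨w, rfl⟩
        rw [hP'a, hb, ← map_smul, ← map_sub]
        exact ⟨_, rfl⟩
      · have : b ∈ LinearMap.range P' := heq ▸ ⟨v0, rfl⟩
        obtain ⟨w, hw⟩ := this
        have h2 := hort w
        rw [hw, inner_self_eq_zero] at h2
        exact hbne h2
    have hfr : Module.finrank 𝕜 (LinearMap.range P') ≤ r := by
      have := Submodule.finrank_lt_finrank_of_lt hrange
      omega
    obtain ⟨v, hv, hspan⟩ := hc P' hfr s hs ⟨R + 2 * ‖b‖, fun w hw => by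
      rw [hP'a]
      refine (norm_sub_le _ _).trans (add_le_add (hR w hw) ?_)
      rw [norm_smul]
      exact mul_le_mul_of_nonneg_right (hℓb w hw) (norm_nonneg _)⟩
    refine ⟨Fin.cons v0 v, fun i => ?_, fun w hw => ?_⟩
    · refine Fin.cases ?_ (fun i => ?_) i
      · simpa using hv0
      · simpa using hv i
    · obtain ⟨a, ha, haw⟩ := hspan w hw
      -- Writing `P' (v i)` as `P (v i) - ℓ (v i) • b` moves the removed components into the
      -- coefficient of `v0`.
      refine ⟨Fin.cons (ℓ w - ∑ i, a i * ℓ (v i)) a, fun i => ?_, ?_⟩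
      · refine Fin.cases ?_ (fun i => ?_) i
        · simp only [Fin.cons_zero]
          refine (norm_sub_le _ _).trans ?_
          have h1 : ‖∑ i, a i * ℓ (v i)‖ ≤ r * (c * 2) := by
            refine (norm_sum_le_of_le _ (f := fun i => a i * ℓ (v i)) (n := fun _ => c * 2)
              fun i _ => ?_).trans_eq (by simp)
            rw [norm_mul]
            exact mul_le_mul (ha i) (hℓb _ (hv i)) (norm_nonneg _) hc0
          have h2 := hℓb w hw
          linarith
        · simp only [Fin.cons_succ]
          refine (ha i).trans ?_
          have : 0 ≤ (r : ℝ) * c := by positivity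
          linarith
      · rw [Fin.sum_univ_succ]
        simp only [Fin.cons_zero, Fin.cons_succ]
        have h1 : P w = P' w + ℓ w • b := by rw [hP'a]; abel
        rw [h1, haw]
        simp only [hP'a, smul_sub, Finset.sum_sub_distrib, sub_smul, Finset.sum_smul, smul_smul]
        rw [← hb]
        abel

/-- The averages of `φ f` over multipliers with `|φ| ≤ 1` form a bounded set, so finitely many of
them generate it with bounded coefficients. The point is that the `φ i` depend only on `f` and `Q`
and serve all `A` at once, so that later `A` may be the weight at a varying point. -/
theorem exists_average_norm_le (k : ℕ) : ∃ c : ℝ, 0 ≤ c ∧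
    ∀ {d : ℕ} (Q : Cube d) (f : Rd d → Hil 𝕜 k), IsLinfc f →
      ∃ φ : Fin k → Rd d → 𝕜, (∀ i, AEStronglyMeasurable (φ i) (volume : Measure (Rd d))) ∧
        (∀ i x, ‖φ i x‖ ≤ 1) ∧
        ∀ A : Hil 𝕜 k →ₗ[𝕜] Hil 𝕜 k,
          ⨍ y in Q.set, ‖A (f y)‖ ≤ c * ∑ i, ‖A (⨍ y in Q.set, φ i y • f y)‖ := by
  obtain ⟨c, hc0, hc⟩ := exists_bounded_coefficients (𝕜 := 𝕜) k
  refine ⟨k * c, by positivity, fun {d} Q f hf => ?_⟩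
  set s : Set (Hil 𝕜 k) := {v | ∃ φ : Rd d → 𝕜,
    AEStronglyMeasurable φ (volume : Measure (Rd d)) ∧ (∀ x, ‖φ x‖ ≤ 1) ∧
      v = ⨍ y in Q.set, φ y • f y} with hs
  have hvol := Q.vol_pos
  have hbd : ∃ R : ℝ, ∀ w ∈ s, ‖(LinearMap.id : Hil 𝕜 k →ₗ[𝕜] Hil 𝕜 k) w‖ ≤ R := by
    refine ⟨Q.vol⁻¹ * ∫ y in Q.set, ‖f y‖, ?_⟩
    rintro _ ⟨φ, hφm, hφ, rfl⟩
    rw [LinearMap.id_apply, Q.setAverage_eq, norm_smul, Real.norm_of_nonneg (by positivity)]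
    gcongr
    refine norm_integral_le_of_norm_le hf.integrable.norm.integrableOn (ae_of_all _ fun y => ?_)
    rw [norm_smul]
    exact mul_le_of_le_one_left (norm_nonneg _) (hφ y)
  obtain ⟨v, hv, hspan⟩ := hc (LinearMap.id : Hil 𝕜 k →ₗ[𝕜] Hil 𝕜 k)
    ((Submodule.finrank_le _).trans (by simp)) s ⟨_, 0, aestronglyMeasurable_const, by simp, rfl⟩ hbd
  choose φ hφm hφ hφv using hv
  refine ⟨φ, hφm, hφ, fun A => ?_⟩
  simp only [← hφv]
  have hAf : ∀ l, IsLinfc (fun y => A (f y) l) := fun l =>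
    hf.clm_comp ((EuclideanSpace.proj (𝕜 := 𝕜) l).comp (LinearMap.toContinuousLinearMap A))
  have hcoord : ∀ l, ⨍ y in Q.set, ‖A (f y) l‖ ≤ c * ∑ i, ‖A (v i)‖ := by
    intro l
    -- The conjugate phase of a coordinate of `A f` turns the average of its modulus into that
    -- coordinate of `A` applied to one element of `s`. Summing over the `k` coordinates gives the
    -- constant `k * c`.
    set ψ : Rd d → 𝕜 := fun y => star (A (f y) l) / (‖A (f y) l‖ : 𝕜) with hψ
    have hψm : AEStronglyMeasurable ψ (volume : Measure (Rd d)) :=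
      ((continuous_star.comp_aestronglyMeasurable (hAf l).aestronglyMeasurable).aemeasurable.div
        (RCLike.continuous_ofReal.comp_aestronglyMeasurable
          (hAf l).aestronglyMeasurable.norm).aemeasurable).aestronglyMeasurable
    have hψ1 : ∀ y, ‖ψ y‖ ≤ 1 := by
      intro y
      rw [hψ, norm_div, norm_star, RCLike.norm_ofReal, abs_norm]
      exact div_self_le_one _
    obtain ⟨a, ha, haw⟩ := hspan _ ⟨ψ, hψm, hψ1, rfl⟩
    simp only [LinearMap.id_apply] at haw
    have h1 : ((⨍ y in Q.set, ‖A (f y) l‖ : ℝ) : 𝕜) = A (⨍ y in Q.set, ψ y • f y) l := by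
      have hint : Integrable (fun y => ψ y • f y) (volume.restrict Q.set) :=
        (hf.mul_bdd hψm hψ1).integrable.integrableOn
      have h2 := ((EuclideanSpace.proj (𝕜 := 𝕜) l).comp
        (LinearMap.toContinuousLinearMap A)).integral_comp_comm hint
      have h3 : ∀ y, ((EuclideanSpace.proj (𝕜 := 𝕜) l).comp
          (LinearMap.toContinuousLinearMap A)) (ψ y • f y) = ((‖A (f y) l‖ : ℝ) : 𝕜) := by
        intro y
        simp only [ContinuousLinearMap.comp_apply, LinearMap.coe_toContinuousLinearMap', map_smul,
          smul_eq_mul, hψ]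
        change star (A (f y) l) / ((‖A (f y) l‖ : ℝ) : 𝕜) * A (f y) l = _
        by_cases h0 : A (f y) l = 0
        · simp [h0]
        · have h0' : ((‖A (f y) l‖ : ℝ) : 𝕜) ≠ 0 := by simpa using h0
          rw [div_mul_eq_mul_div, div_eq_iff h0', RCLike.star_def, RCLike.conj_mul, pow_two]
      simp only [h3] at h2
      rw [Q.setAverage_eq, Q.setAverage_eq, smul_eq_mul, RCLike.ofReal_mul, ← integral_ofReal, h2,
        RCLike.real_smul_eq_coe_smul (K := 𝕜), map_smul]
      simp
    have h4 : ⨍ y in Q.set, ‖A (f y) l‖ ≤ ‖A (⨍ y in Q.set, ψ y • f y)‖ := by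
      refine (le_abs_self _).trans ?_
      rw [← RCLike.norm_ofReal (K := 𝕜), h1]
      exact PiLp.norm_apply_le _ _
    refine h4.trans ?_
    rw [haw, map_sum, Finset.mul_sum]
    refine (norm_sum_le _ _).trans (Finset.sum_le_sum fun i _ => ?_)
    rw [map_smul, norm_smul]
    exact mul_le_mul_of_nonneg_right (ha i) (norm_nonneg _)
  have hAn : Integrable (fun y => ‖A (f y)‖) (volume.restrict Q.set) :=
    (hf.clm_comp (LinearMap.toContinuousLinearMap A)).integrable.norm.integrableOn
  calc ⨍ y in Q.set, ‖A (f y)‖ ≤ ∑ l, ⨍ y in Q.set, ‖A (f y) l‖ := by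
        simp only [Q.setAverage_eq, ← Finset.smul_sum]
        refine smul_le_smul_of_nonneg_left ?_ (by positivity)
        rw [← integral_finsetSum _ fun l _ => (hAf l).integrable.norm.integrableOn]
        refine integral_mono hAn
          (integrable_finsetSum _ fun l _ => (hAf l).integrable.norm.integrableOn) fun y => ?_
        conv_lhs => rw [← (EuclideanSpace.basisFun (Fin k) 𝕜).sum_repr (A (f y))]
        refine (norm_sum_le _ _).trans (Finset.sum_le_sum fun i _ => ?_)
        simp [norm_smul]
    _ ≤ ∑ _l : Fin k, c * ∑ i, ‖A (v i)‖ := Finset.sum_le_sum fun l _ => hcoord l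
    _ = _ := by simp; ring

end ConvexBody

/-! ### Averages over `Q` on the cube `Q'` -/

section StepAverage

variable {𝕜 : Type*} [RCLike 𝕜] {d m : ℕ} {n : Fin m → ℕ} {X : Fin m → BFS 𝕜 d}
  {W : ∀ j, Rd d → Matrix (Fin (n j)) (Fin (n j)) 𝕜} {T : CZOperator 𝕜 d m} {α C : ℝ}
  {Q Q' : Cube d}

theorem norm_smul_le_of_norm_le_one {k : ℕ} {φ : 𝕜} (hφ : ‖φ‖ ≤ 1) (A : Hil 𝕜 k →ₗ[𝕜] Hil 𝕜 k)
    (v : Hil 𝕜 k) : ‖A (φ • v)‖ ≤ ‖A v‖ := by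
  rw [map_smul, norm_smul]
  exact mul_le_of_le_one_left (norm_nonneg _) hφ

/-- Apply `W(x)` to property (b): on elementary tensors its norm factorizes, and the error integral
separates into averages. The factor `1 - α` is simply dropped. -/
theorem AverageRepresentation.norm_tensor_average_le (h : AverageRepresentation n T α C Q Q')
    (h0 : 0 < α) (h1 : α < 1) (hC : 0 < C)
    {f : ∀ j, Rd d → Hil 𝕜 (n j)} (hf : ∀ j, IsLinfc (f j))
    (hfQ : ∀ j, Function.support (f j) ⊆ Q.set) :
    ∀ᵐ x, x ∈ Q'.set →
      ‖Matrix.toEuclideanLin (tensorWeight W x) (tensor fun j => ⨍ y in Q.set, f j y)‖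
        ≤ C * ‖Matrix.toEuclideanLin (tensorWeight W x) (T.tilde f x)‖
          + α * ∏ j, ⨍ y in Q.set, ‖Matrix.toEuclideanLin (W j x) (f j y)‖ := by
  obtain ⟨S, -, hS, hrep⟩ := h
  filter_upwards [AverageRepresentation.ae_bound hS, hrep f hf hfQ] with x hx1 hx2 hxQ
  rw [hx2 hxQ, map_add, map_smul, map_smul]
  refine (norm_add_le _ _).trans ?_
  rw [norm_smul, norm_smul, RCLike.norm_ofReal, RCLike.norm_ofReal, abs_of_pos h0,
    abs_of_pos (mul_pos (by linarith) hC)]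
  gcongr
  · nlinarith
  · exact norm_map_setIntegral_smul_le
      (LinearMap.toContinuousLinearMap (Matrix.toEuclideanLin (tensorWeight W x))) (hx1 hxQ)
      (fun j => ((hf j).clm_comp (LinearMap.toContinuousLinearMap
        (Matrix.toEuclideanLin (W j x)))).integrable.norm.integrableOn)
      (fun y => (norm_tensorWeight_tensor W x _).le)

theorem weightedNrm_add_le {K : ℝ≥0} (hK : IsQuasiConst X K) (hW : ∀ j, IsMatrixWeight (W j))
    {f g : Rd d → HilT 𝕜 n} (hf : AEStronglyMeasurable f (volume : Measure (Rd d)))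
    (hg : AEStronglyMeasurable g (volume : Measure (Rd d))) :
    weightedNrm (prodNrm X) (tensorWeight W) (fun x => f x + g x)
      ≤ K * (weightedNrm (prodNrm X) (tensorWeight W) f
        + weightedNrm (prodNrm X) (tensorWeight W) g) := by
  refine le_trans (prodNrm_mono X (ae_of_all _ fun x => ?_)) (hK _ _
    (RCLike.continuous_ofReal.comp_aestronglyMeasurable
      (aestronglyMeasurable_toEuclideanLin (tensorWeight_aemeasurable hW) hf).norm)
    (RCLike.continuous_ofReal.comp_aestronglyMeasurable
      (aestronglyMeasurable_toEuclideanLin (tensorWeight_aemeasurable hW) hg).norm))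
  simp only
  rw [← RCLike.ofReal_add, RCLike.norm_ofReal, RCLike.norm_ofReal, abs_norm,
    abs_of_nonneg (by positivity), map_add]
  exact norm_add_le _ _

/-- Tuples of bounded functions supported in `Q`. -/
def domCube (Q : Cube d) (f : ∀ j, Rd d → Hil 𝕜 (n j)) : Prop :=
  ∀ j, IsLinfc (f j) ∧ Function.support (f j) ⊆ Q.set

/-- The operator `f ↦ 1_{Q'} ⨂_j ⟨f_j⟩_Q`. -/
noncomputable def shiftedAvg (Q Q' : Cube d) (f : ∀ j, Rd d → Hil 𝕜 (n j)) : Rd d → HilT 𝕜 n :=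
  Q'.set.indicator (fun _ => tensor (fun j => ⨍ y in Q.set, f j y))

theorem aestronglyMeasurable_shiftedAvg (f : ∀ j, Rd d → Hil 𝕜 (n j)) :
    AEStronglyMeasurable (shiftedAvg Q Q' f) (volume : Measure (Rd d)) :=
  aestronglyMeasurable_const.indicator Q'.measurableSet

/-- The norm of `f ↦ 1_{Q'} ⨂_j ⟨f_j⟩_Q` on bounded functions supported in `Q`. -/
noncomputable def shiftedNorm (Q Q' : Cube d) (X : Fin m → BFS 𝕜 d)
    (W : ∀ j, Rd d → Matrix (Fin (n j)) (Fin (n j)) 𝕜) : ℝ≥0∞ :=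
  multiNorm (domCube Q) (shiftedAvg Q Q') (fun j => weightedNrm (X j).nrm (W j))
    (weightedNrm (prodNrm X) (tensorWeight W))

theorem enorm_tensor_average_le (hW : ∀ j, IsMatrixWeight (W j))
    {f : ∀ j, Rd d → Hil 𝕜 (n j)} (hf : domMeas f)
    (hfin : ∀ j, weightedNrm (X j).nrm (W j) (f j) < ⊤) :
    ‖tensor fun j => ⨍ y in Q.set, f j y‖ₑ ≤ (∏ j, ENNReal.ofReal (Q.vol⁻¹)
      * (X j).dualNrm (Q.set.indicator (fun x => (invOpNorm (W j) x : 𝕜))))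
        * ∏ j, weightedNrm (X j).nrm (W j) (f j) := by
  rw [← ofReal_norm, norm_tensor, ENNReal.ofReal_prod_of_nonneg fun j _ => norm_nonneg _,
    ← Finset.prod_mul_distrib]
  refine Finset.prod_le_prod' fun j _ => ?_
  rw [ofReal_norm]
  exact enorm_setAverage_le (X j) (hW j) Q (hf j) (hfin j)

/-- The averages are finite by duality and the constants on `Q'` have finite norm. The bound is only
qualitative; it permits the absorption in `shiftedNorm_le`. -/
theorem shiftedNorm_lt_top (hm : 0 < m) {K : ℝ≥0} (hK : IsQuasiConst X K)
    (hW : ∀ j, IsMatrixWeight (W j))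
    (hdual : ∀ j, (X j).dualNrm (Q.set.indicator (fun x => (invOpNorm (W j) x : 𝕜))) < ⊤)
    (hfin : ∀ v : ∀ j, Hil 𝕜 (n j),
      weightedNrm (prodNrm X) (tensorWeight W) (Q'.set.indicator fun _ => tensor v) < ⊤) :
    shiftedNorm Q Q' X W < ⊤ := by
  set B : ℝ≥0∞ := ((max 1 K : ℝ≥0) : ℝ≥0∞) ^ Fintype.card (∀ j, Fin (n j))
        * ∑ k : ∀ j, Fin (n j), weightedNrm (prodNrm X) (tensorWeight W)
          (Q'.set.indicator fun _ => tensor fun j => EuclideanSpace.single (k j) (1 : 𝕜)) with hB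
  have hBtop : B < ⊤ := ENNReal.mul_lt_top (ENNReal.pow_lt_top ENNReal.coe_lt_top)
    (ENNReal.sum_lt_top.2 fun k _ => hfin _)
  refine lt_of_le_of_lt (sInf_le (a := (∏ j, ENNReal.ofReal (Q.vol⁻¹)
      * (X j).dualNrm (Q.set.indicator (fun x => (invOpNorm (W j) x : 𝕜)))) * B) ?_)
    (ENNReal.mul_lt_top (ENNReal.prod_lt_top fun j _ =>
      ENNReal.mul_lt_top ENNReal.ofReal_lt_top (hdual j)) hBtop)
  intro f hf hffin
  refine (weightedNrm_indicator_le_of_basis hm hK hW Q' _).trans ?_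
  rw [mul_right_comm]
  exact mul_le_mul_left (enorm_tensor_average_le hW (fun j => (hf j).1.aestronglyMeasurable)
    hffin) _

/-- The error term in property (b) is again controlled by averages over `Q` of functions dominated
by the original ones. So the norm is at most the main term plus a small multiple of itself, the
smallness of `α` being measured by `hα`. -/
theorem shiftedNorm_le (hm : 0 < m) {c : Fin m → ℝ} (hc0 : ∀ j, 0 ≤ c j)
    (hc : ∀ (j) (f : Rd d → Hil 𝕜 (n j)), IsLinfc f →
      ∃ φ : Fin (n j) → Rd d → 𝕜,
        (∀ i, AEStronglyMeasurable (φ i) (volume : Measure (Rd d))) ∧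
        (∀ i x, ‖φ i x‖ ≤ 1) ∧
        ∀ A : Hil 𝕜 (n j) →ₗ[𝕜] Hil 𝕜 (n j),
          ⨍ y in Q.set, ‖A (f y)‖ ≤ c j * ∑ i, ‖A (⨍ y in Q.set, φ i y • f y)‖)
    {K : ℝ≥0} (hK : IsQuasiConst X K) (h0 : 0 < α) (h1 : α < 1)
    (hα : (K : ℝ≥0∞) * (ENNReal.ofReal (α * ∏ j, c j)
      * (((max 1 K : ℝ≥0) : ℝ≥0∞) ^ Fintype.card (∀ j, Fin (n j))
        * Fintype.card (∀ j, Fin (n j)))) ≤ 2⁻¹)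
    (h : AverageRepresentation n T α C Q Q') (hC : 0 < C) (hW : ∀ j, IsMatrixWeight (W j))
    (hdual : ∀ j, (X j).dualNrm (Q.set.indicator (fun x => (invOpNorm (W j) x : 𝕜))) < ⊤)
    (hT : tildeNorm T X W < ⊤) :
    shiftedNorm Q Q' X W ≤ 2 * (K * (ENNReal.ofReal C * tildeNorm T X W)) := by
  set M := shiftedNorm Q Q' X W with hM
  have hMtop : M < ⊤ := shiftedNorm_lt_top hm hK hW hdual fun v =>
    h.weightedNrm_tensor_lt_top hm h0 h1 hC hW hT v
  -- Subtracting half of `M` from both sides is legitimate because `M` is finite.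
  suffices hle : M ≤ K * (ENNReal.ofReal C * tildeNorm T X W) + 2⁻¹ * M by
    have h2 : M = 2⁻¹ * M + 2⁻¹ * M := by
      rw [← add_mul, ENNReal.inv_two_add_inv_two, one_mul]
    have h3 : 2⁻¹ * M ≤ K * (ENNReal.ofReal C * tildeNorm T X W) := by
      have hfin : 2⁻¹ * M ≠ ⊤ := (ENNReal.mul_lt_top (by simp) hMtop).ne
      rw [← ENNReal.add_le_add_iff_right hfin]
      calc 2⁻¹ * M + 2⁻¹ * M = M := h2.symm
        _ ≤ _ := hle
    calc M = 2 * (2⁻¹ * M) := by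
          rw [← mul_assoc, ENNReal.mul_inv_cancel two_ne_zero ENNReal.ofNat_ne_top, one_mul]
      _ ≤ _ := by gcongr
  refine sInf_le fun f hf hffin => ?_
  have hfl : ∀ j, IsLinfc (f j) := fun j => (hf j).1
  choose φ hφm hφ1 hφ using fun j => hc j (f j) (hfl j)
  -- One tuple for each choice of a multiplier in every slot. The multipliers have modulus at most
  -- one, so these tuples stay in the domain with no larger norms.
  set F : (∀ j, Fin (n j)) → ∀ j, Rd d → Hil 𝕜 (n j) := fun i j y => φ j (i j) y • f j y with hF
  have hFl : ∀ i, domCube Q (F i) := fun i j => ⟨(hfl j).mul_bdd (hφm j (i j)) (hφ1 j (i j)),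
    fun x hx => (hf j).2 fun hx0 => hx (by simp [hF, hx0])⟩
  have hFle : ∀ i j, weightedNrm (X j).nrm (W j) (F i j) ≤ weightedNrm (X j).nrm (W j) (f j) :=
    fun i j => weightedNrm_mono (X j) (hW j) (hFl i j).1.aestronglyMeasurable
      (hfl j).aestronglyMeasurable
      (ae_of_all _ fun x => norm_smul_le_of_norm_le_one (hφ1 j (i j) x) _ _)
  set P := ∏ j, weightedNrm (X j).nrm (W j) (f j) with hP
  have hFM : ∀ i, weightedNrm (prodNrm X) (tensorWeight W) (shiftedAvg Q Q' (F i)) ≤ M * P := by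
    intro i
    refine (multiNorm_spec hMtop (hFl i) fun j => (hFle i j).trans_lt (hffin j)).trans ?_
    exact mul_le_mul_right (Finset.prod_le_prod' fun j _ => hFle i j) _
  set G1 : Rd d → 𝕜 := fun x =>
    (C : 𝕜) * ((‖Matrix.toEuclideanLin (tensorWeight W x) (T.tilde f x)‖ : ℝ) : 𝕜) with hG1
  set G2 : Rd d → 𝕜 := fun x => ((α * ∏ j, c j : ℝ) : 𝕜) *
    ((∑ i, ‖Matrix.toEuclideanLin (tensorWeight W x) (shiftedAvg Q Q' (F i) x)‖ : ℝ) : 𝕜) with hG2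
  have hG1m : AEStronglyMeasurable G1 (volume : Measure (Rd d)) :=
    (RCLike.continuous_ofReal.comp_aestronglyMeasurable
      (aestronglyMeasurable_toEuclideanLin (tensorWeight_aemeasurable hW)
        (T.aestronglyMeasurable_tilde hfl)).norm).const_mul _
  have hG2m : AEStronglyMeasurable G2 (volume : Measure (Rd d)) :=
    (RCLike.continuous_ofReal.comp_aestronglyMeasurable
      (Finset.aestronglyMeasurable_fun_sum _ fun i _ =>
        (aestronglyMeasurable_toEuclideanLin (tensorWeight_aemeasurable hW)
          (aestronglyMeasurable_shiftedAvg (Q := Q) (Q' := Q') (F i))).norm)).const_mul _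
  have hcprod : 0 ≤ ∏ j, c j := Finset.prod_nonneg fun j _ => hc0 j
  have hpt : weightedNrm (prodNrm X) (tensorWeight W) (shiftedAvg Q Q' f)
      ≤ prodNrm X (fun x => G1 x + G2 x) := by
    refine prodNrm_mono X ?_
    filter_upwards [h.norm_tensor_average_le (W := W) h0 h1 hC hfl fun j => (hf j).2] with x hx
    have hnn : 0 ≤ C * ‖Matrix.toEuclideanLin (tensorWeight W x) (T.tilde f x)‖ +
        α * (∏ j, c j) *
        ∑ i, ‖Matrix.toEuclideanLin (tensorWeight W x) (shiftedAvg Q Q' (F i) x)‖ := by positivity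
    simp only [hG1, hG2]
    rw [← RCLike.ofReal_mul, ← RCLike.ofReal_mul, ← RCLike.ofReal_add, RCLike.norm_ofReal,
      RCLike.norm_ofReal, abs_norm, abs_of_nonneg hnn]
    by_cases hxQ : x ∈ Q'.set
    · simp only [shiftedAvg, hxQ, indicator_of_mem]
      refine (hx hxQ).trans ?_
      rw [mul_assoc α]
      gcongr
      calc ∏ j, ⨍ y in Q.set, ‖Matrix.toEuclideanLin (W j x) (f j y)‖
          ≤ ∏ j, (c j * ∑ i, ‖Matrix.toEuclideanLin (W j x) (⨍ y in Q.set, φ j i y • f j y)‖) := by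
            refine Finset.prod_le_prod (fun j _ => ?_) fun j _ => hφ j _
            rw [Q.setAverage_eq]
            exact mul_nonneg (inv_nonneg.2 Q.vol_pos.le) (integral_nonneg fun _ => norm_nonneg _)
        _ = _ := by
            -- The product of the `m` sums becomes a sum over multi-indices, and each product of
            -- norms is the norm of an elementary tensor.
            rw [Finset.prod_mul_distrib, Finset.prod_univ_sum]
            simp only [norm_tensorWeight_tensor, hF, Fintype.piFinset_univ]
    · simp only [shiftedAvg, hxQ, not_false_eq_true, indicator_of_notMem, map_zero, norm_zero,
        Finset.sum_const_zero, mul_zero, add_zero]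
      positivity
  have hB1 : prodNrm X G1 ≤ ENNReal.ofReal C * (tildeNorm T X W * P) :=
    (prodNrm_ofReal_mul_le X hm hC.le _).trans (by
      gcongr
      exact multiNorm_spec hT hfl hffin)
  have hB2 : prodNrm X G2 ≤ ENNReal.ofReal (α * ∏ j, c j) *
      (((max 1 K : ℝ≥0) : ℝ≥0∞) ^ Fintype.card (∀ j, Fin (n j))
        * (Fintype.card (∀ j, Fin (n j)) * (M * P))) := by
    refine (prodNrm_ofReal_mul_le X hm (by positivity) _).trans ?_
    gcongr
    refine (weightedNrm_sum_le hm hK hW Finset.univ fun i =>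
      aestronglyMeasurable_shiftedAvg (Q := Q) (Q' := Q') (F i)).trans ?_
    rw [Finset.card_univ]
    gcongr
    refine (Finset.sum_le_sum fun i _ => hFM i).trans_eq ?_
    simp
  calc weightedNrm (prodNrm X) (tensorWeight W) (shiftedAvg Q Q' f)
      ≤ K * (prodNrm X G1 + prodNrm X G2) := hpt.trans (hK G1 G2 hG1m hG2m)
    _ ≤ K * (ENNReal.ofReal C * (tildeNorm T X W * P) + ENNReal.ofReal (α * ∏ j, c j) *
      (((max 1 K : ℝ≥0) : ℝ≥0∞) ^ Fintype.card (∀ j, Fin (n j))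
        * (Fintype.card (∀ j, Fin (n j)) * (M * P)))) := by gcongr
    _ = (K * (ENNReal.ofReal C * tildeNorm T X W) + K * (ENNReal.ofReal (α * ∏ j, c j)
      * (((max 1 K : ℝ≥0) : ℝ≥0∞) ^ Fintype.card (∀ j, Fin (n j))
        * Fintype.card (∀ j, Fin (n j)))) * M) * P := by ring
    _ ≤ _ := by gcongr

/-- Damped truncations of a function. -/
theorem exists_truncation {V : Type*} [NormedAddCommGroup V] [NormedSpace ℝ V] [NormedSpace 𝕜 V]
    {f : Rd d → V} (hf : AEStronglyMeasurable f (volume : Measure (Rd d)))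
    (hint : IntegrableOn f Q.set) : ∃ F : ℕ → Rd d → V,
      (∀ N, IsLinfc (F N)) ∧ (∀ N, Function.support (F N) ⊆ Q.set) ∧
      (∀ N x, ∃ t : 𝕜, ‖t‖ ≤ 1 ∧ F N x = t • f x) ∧
      Tendsto (fun N => ⨍ y in Q.set, F N y) atTop (𝓝 (⨍ y in Q.set, f y)) := by
  -- This damping factor keeps `‖t f‖` below `N + 1` and tends to one pointwise.
  set t : ℕ → Rd d → ℝ := fun N x => (1 + ‖f x‖ / (N + 1))⁻¹ with ht
  have hpos : ∀ (N : ℕ) x, 0 < 1 + ‖f x‖ / ((N : ℝ) + 1) := fun N x => by positivity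
  have ht0 : ∀ N x, 0 ≤ t N x := fun N x => (inv_pos.2 (hpos N x)).le
  have ht1 : ∀ N x, t N x ≤ 1 := fun N x => inv_le_one_of_one_le₀ (by
    have : 0 ≤ ‖f x‖ / ((N : ℝ) + 1) := by positivity
    linarith)
  have htm : ∀ N, AEStronglyMeasurable (t N) (volume : Measure (Rd d)) := fun N =>
    (aemeasurable_const.add (hf.norm.aemeasurable.div_const _)).inv.aestronglyMeasurable
  have hFm : ∀ N, AEStronglyMeasurable (Q.set.indicator fun x => (t N x : 𝕜) • f x)
      (volume : Measure (Rd d)) := fun N =>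
    ((RCLike.continuous_ofReal.comp_aestronglyMeasurable (htm N)).smul hf).indicator
      Q.measurableSet
  have hnorm : ∀ N x, ‖(t N x : 𝕜) • f x‖ = t N x * ‖f x‖ := fun N x => by
    rw [norm_smul, RCLike.norm_ofReal, abs_of_nonneg (ht0 N x)]
  refine ⟨fun N => Q.set.indicator fun x => (t N x : 𝕜) • f x, fun N => ?_,
    fun N => support_indicator_subset, fun N x => ?_, ?_⟩
  · refine isLinfc_of_bound (B := N + 1) (hFm N) support_indicator_subset fun x => ?_
    refine (norm_indicator_le_norm_self _ _).trans ?_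
    rw [hnorm, ht, inv_mul_le_iff₀ (hpos N x)]
    have : (1 + ‖f x‖ / ((N : ℝ) + 1)) * (N + 1) = (N + 1) + ‖f x‖ := by
      field_simp
    rw [this]
    have : (0 : ℝ) ≤ (N : ℝ) + 1 := by positivity
    linarith
  · by_cases hxQ : x ∈ Q.set
    · refine ⟨(t N x : 𝕜), ?_, by simp [hxQ]⟩
      rw [RCLike.norm_ofReal, abs_of_nonneg (ht0 N x)]
      exact ht1 N x
    · exact ⟨0, by simp, by simp [hxQ]⟩
  · simp only [Q.setAverage_eq]
    refine Tendsto.const_smul ?_ _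
    refine tendsto_integral_of_dominated_convergence (fun x => ‖f x‖)
      (fun N => (hFm N).restrict) hint.norm (fun N => ae_of_all _ fun x => ?_) ?_
    · refine (norm_indicator_le_norm_self _ _).trans ?_
      rw [hnorm]
      exact mul_le_of_le_one_left (norm_nonneg _) (ht1 N x)
    · filter_upwards [ae_restrict_mem Q.measurableSet] with x hxQ
      simp only [hxQ, indicator_of_mem]
      have h1 : Tendsto (fun N : ℕ => t N x) atTop (𝓝 1) := by
        have h2 : Tendsto (fun N : ℕ => 1 + ‖f x‖ / ((N : ℝ) + 1)) atTop (𝓝 (1 + 0)) :=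
          tendsto_const_nhds.add (tendsto_const_nhds.div_atTop
            (tendsto_atTop_add_const_right _ _ tendsto_natCast_atTop_atTop))
        simpa using h2.inv₀ (by norm_num)
      simpa using ((RCLike.continuous_ofReal (K := 𝕜).tendsto 1).comp h1).smul_const (f x)

/-- Damping does not increase the weighted norms, and the averages of the truncations converge in a
finite-dimensional space. The remainder is a vanishing constant tensor on `Q'`; separating it costs
one quasi-triangle constant `K`. -/
theorem weightedNrm_shiftedAvg_le (hm : 0 < m) {K : ℝ≥0} (hK : IsQuasiConst X K)
    (hW : ∀ j, IsMatrixWeight (W j))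
    (hdual : ∀ j, (X j).dualNrm (Q.set.indicator (fun x => (invOpNorm (W j) x : 𝕜))) < ⊤)
    (hfinv : ∀ v : ∀ j, Hil 𝕜 (n j),
      weightedNrm (prodNrm X) (tensorWeight W) (Q'.set.indicator fun _ => tensor v) < ⊤)
    {f : ∀ j, Rd d → Hil 𝕜 (n j)} (hf : domMeas f)
    (hffin : ∀ j, weightedNrm (X j).nrm (W j) (f j) < ⊤) :
    weightedNrm (prodNrm X) (tensorWeight W) (shiftedAvg Q Q' f)
      ≤ K * (shiftedNorm Q Q' X W * ∏ j, weightedNrm (X j).nrm (W j) (f j)) := by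
  have hM := shiftedNorm_lt_top hm hK hW hdual hfinv
  have hint : ∀ j, IntegrableOn (f j) Q.set := fun j =>
    ⟨(hf j).restrict, (lintegral_enorm_le_dualNrm_mul (X j) (hW j) Q (hf j) (hffin j)).trans_lt
      (ENNReal.mul_lt_top (hffin j) (hdual j))⟩
  choose F hFl hFQ hFt hFlim using fun j => exists_truncation (𝕜 := 𝕜) (Q := Q) (hf j) (hint j)
  set B : ℝ≥0∞ := ((max 1 K : ℝ≥0) : ℝ≥0∞) ^ Fintype.card (∀ j, Fin (n j))
        * ∑ k : ∀ j, Fin (n j), weightedNrm (prodNrm X) (tensorWeight W)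
          (Q'.set.indicator fun _ => tensor fun j => EuclideanSpace.single (k j) (1 : 𝕜)) with hB
  have hBtop : B ≠ ⊤ := (ENNReal.mul_lt_top (ENNReal.pow_lt_top ENNReal.coe_lt_top)
    (ENNReal.sum_lt_top.2 fun k _ => hfinv _)).ne
  set a := tensor fun j => ⨍ y in Q.set, f j y with ha
  set aN : ℕ → HilT 𝕜 n := fun N => tensor fun j => ⨍ y in Q.set, F j N y with haN
  have hlim : Tendsto aN atTop (𝓝 a) :=
    (continuous_tensor.tendsto _).comp (tendsto_pi_nhds.2 fun j => hFlim j)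
  have hlim2 : Tendsto (fun N => ‖a - aN N‖ₑ * B) atTop (𝓝 0) := by
    have h1 : Tendsto (fun N => ‖a - aN N‖ₑ) atTop (𝓝 ‖a - a‖ₑ) :=
      (continuous_enorm.tendsto _).comp (tendsto_const_nhds.sub hlim)
    rw [sub_self, enorm_zero] at h1
    simpa using ENNReal.Tendsto.mul_const h1 (Or.inr hBtop)
  have hlim3 := ENNReal.Tendsto.const_mul (a := (K : ℝ≥0∞))
    ((tendsto_const_nhds (x := shiftedNorm Q Q' X W *
      ∏ j, weightedNrm (X j).nrm (W j) (f j))).add hlim2) (Or.inr ENNReal.coe_ne_top)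
  rw [add_zero] at hlim3
  refine ge_of_tendsto' hlim3 fun N => ?_
  have hle : ∀ j, weightedNrm (X j).nrm (W j) (F j N) ≤ weightedNrm (X j).nrm (W j) (f j) :=
    fun j => weightedNrm_mono (X j) (hW j) (hFl j N).aestronglyMeasurable (hf j)
      (ae_of_all _ fun x => by
        obtain ⟨t, ht, htx⟩ := hFt j N x
        rw [htx]
        exact norm_smul_le_of_norm_le_one ht _ _)
  have h1 : weightedNrm (prodNrm X) (tensorWeight W) (shiftedAvg Q Q' fun j => F j N)
      ≤ shiftedNorm Q Q' X W * ∏ j, weightedNrm (X j).nrm (W j) (f j) := by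
    refine (multiNorm_spec hM (fun j => ⟨hFl j N, hFQ j N⟩) fun j =>
      (hle j).trans_lt (hffin j)).trans ?_
    rw [shiftedNorm]
    gcongr with j
    exact hle j
  have h2 := weightedNrm_indicator_le_of_basis (X := X) hm hK hW Q' (a - aN N)
  calc weightedNrm (prodNrm X) (tensorWeight W) (shiftedAvg Q Q' f)
      = weightedNrm (prodNrm X) (tensorWeight W) (fun x => shiftedAvg Q Q' (fun j => F j N) x
        + Q'.set.indicator (fun _ => a - aN N) x) := by
        congr 1
        funext x
        by_cases hxQ : x ∈ Q'.set
        · simp [shiftedAvg, hxQ, ha, haN]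
        · simp [shiftedAvg, hxQ]
    _ ≤ K * (_ + _) := weightedNrm_add_le hK hW (aestronglyMeasurable_shiftedAvg _)
        (aestronglyMeasurable_const.indicator Q'.measurableSet)
    _ ≤ _ := by gcongr

end StepAverage

/-! ### From `Q'` to `Q` -/

section StepLower

variable {𝕜 : Type*} [RCLike 𝕜] {d m : ℕ} {n : Fin m → ℕ} {X : Fin m → BFS 𝕜 d}
  {W : ∀ j, Rd d → Matrix (Fin (n j)) (Fin (n j)) 𝕜} {T : CZOperator 𝕜 d m} {α C : ℝ}
  {Q Q' : Cube d}

theorem prod_le_mul_pow {s : Finset (Fin m)} {a : Fin m → ℝ} {δ I : ℝ} (ha0 : ∀ j, 0 ≤ a j)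
    (haI : ∀ j, a j ≤ I) (hI : 1 ≤ I) (hδ : ∀ j, j ∉ s → a j ≤ δ) (hs : s ≠ Finset.univ) :
    ∏ j, a j ≤ δ * I ^ m := by
  obtain ⟨i, hi⟩ : ∃ i, i ∉ s := by
    by_contra hc
    push Not at hc
    exact hs (Finset.eq_univ_iff_forall.2 hc)
  rw [← Finset.mul_prod_erase _ _ (Finset.mem_univ i)]
  refine mul_le_mul (hδ i hi) ?_ (Finset.prod_nonneg fun j _ => ha0 j) ((ha0 i).trans (hδ i hi))
  calc ∏ j ∈ Finset.univ.erase i, a j ≤ ∏ _j ∈ Finset.univ.erase i, I :=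
        Finset.prod_le_prod (fun j _ => ha0 j) fun j _ => haI j
    _ ≤ I ^ m := by
        rw [Finset.prod_const]
        refine pow_le_pow_right₀ hI ((Finset.card_le_univ _).trans ?_)
        simp

/-- Functions with product one on large subsets `G N` of `Q'` are large on `Q` in the limit. -/
theorem LowerBoundOnCube.eventually_le (hlow : LowerBoundOnCube T C Q Q')
    (hrep : AverageRepresentation n T α C Q Q') (hm : 0 < m) (hn : ∀ j, 0 < n j) (h0 : 0 < α)
    (h1 : α < 1) (hC : 0 < C) {h : Fin m → Rd d → ℝ} {G : ℕ → Set (Rd d)}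
    (hG : ∀ N, NullMeasurableSet (G N) (volume : Measure (Rd d))) (hGQ : ∀ N, G N ⊆ Q'.set)
    (hGlim : ∀ᵐ x, x ∈ Q'.set → ∀ᶠ N in atTop, x ∈ G N)
    (hh : ∀ j, AEStronglyMeasurable (h j) (volume : Measure (Rd d)))
    (hh0 : ∀ N, ∀ x ∈ G N, ∀ j, 0 ≤ h j x) (hhN : ∀ N : ℕ, ∀ x ∈ G N, ∀ j, h j x ≤ N)
    (hh1 : ∀ N, ∀ x ∈ G N, ∏ j, h j x = 1) {I : ℝ}
    (hI : ∀ N j, ∫ x, (G N).indicator (h j) x ≤ I) :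
    ∀ᵐ x, x ∈ Q.set → ∀ᶠ N in atTop,
      1 ≤ 2 * C * ‖T.app (fun j y => (((G N).indicator (h j) y : ℝ) : 𝕜)) x‖ := by
  obtain ⟨M, hM⟩ := hrep.exists_L1_bound hm hn h0 h1 hC
  set u : ℕ → Fin m → Rd d → ℝ := fun N j => (G N).indicator (h j) with hu
  -- Filling the rest of `Q'` with ones restores the exact product condition that property (a)
  -- requires.
  set v : ℕ → Fin m → Rd d → ℝ := fun N _ => (Q'.set \ G N).indicator 1 with hv
  have hu0 : ∀ N j x, 0 ≤ u N j x := fun N j x => indicator_nonneg (fun x hx => hh0 N x hx j) x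
  have hv0 : ∀ N j x, 0 ≤ v N j x := fun N j x => indicator_nonneg (fun _ _ => zero_le_one) x
  have hum : ∀ N j, AEStronglyMeasurable (u N j) (volume : Measure (Rd d)) := fun N j =>
    (hh j).indicator₀ (hG N)
  have hvm : ∀ N j, AEStronglyMeasurable (v N j) (volume : Measure (Rd d)) := fun N j =>
    aestronglyMeasurable_const.indicator₀ (Q'.measurableSet.nullMeasurableSet.diff (hG N))
  have husupp : ∀ N j, Function.support (u N j) ⊆ Q'.set := fun N j =>
    support_indicator_subset.trans (hGQ N)
  have hvsupp : ∀ N j, Function.support (v N j) ⊆ Q'.set := fun N j =>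
    support_indicator_subset.trans sdiff_subset
  have hul : ∀ N j, IsLinfc (u N j) := fun N j =>
    isLinfc_of_bound (B := N) (hum N j) (husupp N j) fun x => by
      rw [Real.norm_of_nonneg (hu0 N j x)]
      exact indicator_apply_le' (fun hx => hhN N x hx j) fun _ => Nat.cast_nonneg N
  have hvl : ∀ N j, IsLinfc (v N j) := fun N j =>
    isLinfc_of_bound (B := 1) (hvm N j) (hvsupp N j) fun x => by
      rw [Real.norm_of_nonneg (hv0 N j x)]
      exact indicator_apply_le' (fun _ => le_rfl) fun _ => zero_le_one
  have hcast : ∀ {f : Rd d → ℝ}, IsLinfc f → IsLinfc (fun x => (f x : 𝕜)) := fun hf =>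
    ⟨hf.1.ofReal, hf.2.comp_left (g := fun t : ℝ => (t : 𝕜)) RCLike.ofReal_zero⟩
  set U : ℕ → Fin m → Rd d → 𝕜 := fun N j x => (u N j x : 𝕜) with hU
  set V : ℕ → Fin m → Rd d → 𝕜 := fun N j x => (v N j x : 𝕜) with hV
  have hprod : ∀ N x, ∏ j, (u N j x + v N j x) = Q'.set.indicator (fun _ => (1 : ℝ)) x := by
    intro N x
    by_cases hx : x ∈ G N
    · simp [hu, hv, hx, hGQ N hx, hh1 N x hx]
    · by_cases hxQ : x ∈ Q'.set
      · simp [hu, hv, hx, hxQ]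
      · simp [hu, hv, hx, hxQ, hm.ne']
  have hlower : ∀ N, ∀ᵐ x, x ∈ Q.set → 1 ≤ C * ‖T.app (fun j y => U N j y + V N j y) x‖ := by
    intro N
    have := hlow (fun j x => u N j x + v N j x) (fun j => (hul N j).add (hvl N j))
      (fun j x => add_nonneg (hu0 N j x) (hv0 N j x))
      (fun j => (Function.support_add _ _).trans (union_subset (husupp N j) (hvsupp N j)))
      (hprod N)
    simpa [hU, hV] using this
  set δ : ℕ → ℝ := fun N => ∫ x, v N ⟨0, hm⟩ x with hδ
  have hδlim : Tendsto δ atTop (𝓝 0) := by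
    have hb : Integrable (Q'.set.indicator (fun _ => (1 : ℝ))) (volume : Measure (Rd d)) :=
      (integrable_indicator_iff Q'.measurableSet).2 (integrableOn_const Q'.volume_lt_top.ne)
    have := tendsto_integral_of_dominated_convergence (f := fun _ : Rd d => (0 : ℝ)) _
      (fun N => hvm N ⟨0, hm⟩) hb (fun N => ae_of_all _ fun x => ?_) ?_
    · simpa using this
    · rw [Real.norm_of_nonneg (hv0 N ⟨0, hm⟩ x)]
      exact indicator_le_indicator_of_subset sdiff_subset (fun _ => zero_le_one) x
    · filter_upwards [hGlim] with x hx
      refine tendsto_const_nhds.congr' ?_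
      by_cases hxQ : x ∈ Q'.set
      · filter_upwards [hx hxQ] with N hN
        simp [hv, hN]
      · exact Eventually.of_forall fun N => by simp [hv, hxQ]
  set J : ℝ := max 1 (max I Q'.vol) with hJ
  have hδJ : ∀ N, δ N ≤ J := by
    intro N
    have : δ N ≤ ∫ x, Q'.set.indicator (fun _ => (1 : ℝ)) x := by
      refine integral_mono (hvl N ⟨0, hm⟩).integrable
        ((integrable_indicator_iff Q'.measurableSet).2 (integrableOn_const Q'.volume_lt_top.ne))
        fun x => indicator_le_indicator_of_subset sdiff_subset (fun _ => zero_le_one) x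
    rw [integral_indicator Q'.measurableSet] at this
    simp only [integral_const, smul_eq_mul, mul_one, measureReal_restrict_apply_univ] at this
    exact this.trans ((le_max_right _ _).trans (le_max_right _ _))
  -- Each mixed term has some slot holding the filler, whose integral `δ N` tends to zero, while all
  -- the integrals are at most `J`. Property (a) alone gives no such upper bound, so the `L¹` bound
  -- from property (b) enters.
  have hpw : ∀ N (s : Finset (Fin m)), ∀ᵐ x, x ∈ Q.set → s ≠ Finset.univ →
      ‖T.app (s.piecewise (U N) (V N)) x‖ ≤ |M x| * (δ N * J ^ m) := by
    intro N s
    have hsupp : ∀ j, Function.support (s.piecewise (U N) (V N) j) ⊆ Q'.set := by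
      intro j
      by_cases hj : j ∈ s
      · simp only [hj, Finset.piecewise_eq_of_mem]
        exact fun x hx => husupp N j fun h0 => hx (by simp [hU, h0])
      · simp only [hj, not_false_eq_true, Finset.piecewise_eq_of_notMem]
        exact fun x hx => hvsupp N j fun h0 => hx (by simp [hV, h0])
    filter_upwards [hM _ (isLinfc_piecewise (fun j => hcast (hul N j)) (fun j => hcast (hvl N j)) s)
      hsupp] with x hx hxQ hs
    have hint : ∀ j, ∫ y, ‖s.piecewise (U N) (V N) j y‖
        = if j ∈ s then ∫ y, u N j y else δ N := by
      intro j
      split_ifs with hj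
      · simp only [hj, Finset.piecewise_eq_of_mem, hU, RCLike.norm_ofReal]
        exact integral_congr_ae (ae_of_all _ fun y => abs_of_nonneg (hu0 N j y))
      · simp only [hj, not_false_eq_true, Finset.piecewise_eq_of_notMem, hV, RCLike.norm_ofReal]
        exact integral_congr_ae (ae_of_all _ fun y => abs_of_nonneg (hv0 N j y))
    refine (hx hxQ).trans (mul_le_mul (le_abs_self _) ?_
      (Finset.prod_nonneg fun j _ => integral_nonneg fun _ => norm_nonneg _) (abs_nonneg _))
    refine prod_le_mul_pow (s := s) (fun j => integral_nonneg fun _ => norm_nonneg _)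
      (fun j => ?_) (le_max_left _ _) (fun j hj => ?_) hs
    · rw [hint]
      split_ifs
      · exact (hI N j).trans ((le_max_left _ _).trans (le_max_right _ _))
      · exact hδJ N
    · rw [hint, if_neg hj]
  filter_upwards [ae_all_iff.2 hlower, ae_all_iff.2 fun N => ae_all_iff.2 (hpw N),
    ae_all_iff.2 fun N => T.app_add (fun j => hcast (hul N j)) (fun j => hcast (hvl N j))]
    with x hx1 hx2 hx3 hxQ
  have hlim : Tendsto (fun N => C * ∑ _s : Finset (Fin m), |M x| * (δ N * J ^ m)) atTop (𝓝 0) := by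
    have : Tendsto (fun N => C * ∑ _s : Finset (Fin m), |M x| * (δ N * J ^ m)) atTop
        (𝓝 (C * ∑ _s : Finset (Fin m), |M x| * (0 * J ^ m))) :=
      (tendsto_finsetSum _ fun s _ => (hδlim.mul_const _).const_mul _).const_mul _
    simpa using this
  -- Once the mixed terms contribute less than one half, the main term keeps at least one half;
  -- hence the factor 2 in the statement.
  filter_upwards [hlim.eventually (gt_mem_nhds (show (0 : ℝ) < 1 / 2 by norm_num))] with N hN
  have h2 := hx1 N hxQ
  have h3 : ‖T.app (fun j y => U N j y + V N j y) x‖ ≤ ‖T.app (U N) x‖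
      + ∑ _s : Finset (Fin m), |M x| * (δ N * J ^ m) := by
    rw [hx3 N, ← Finset.add_sum_erase _ _ (Finset.mem_univ Finset.univ)]
    refine (norm_add_le _ _).trans (add_le_add ?_ ((norm_sum_le _ _).trans ?_))
    · rw [Finset.piecewise_univ]
    · calc ∑ s ∈ Finset.univ.erase Finset.univ, ‖T.app (s.piecewise (U N) (V N)) x‖
          ≤ ∑ _s ∈ (Finset.univ : Finset (Finset (Fin m))).erase Finset.univ,
            |M x| * (δ N * J ^ m) :=
            Finset.sum_le_sum fun s hs => hx2 N s hxQ (Finset.ne_of_mem_erase hs)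
        _ ≤ _ := Finset.sum_le_sum_of_subset_of_nonneg (Finset.erase_subset _ _) fun _ _ _ =>
            mul_nonneg (abs_nonneg _) (mul_nonneg (integral_nonneg fun y => hv0 N ⟨0, hm⟩ y)
              (pow_nonneg (zero_le_one.trans (le_max_left _ _)) _))
  have h4 := mul_le_mul_of_nonneg_left h3 hC.le
  rw [mul_add] at h4
  change 1 ≤ 2 * C * ‖T.app (U N) x‖
  linarith

/-- The factors `g j` are turned into scalar functions with product one on `Q'`, to which property
(a) applies. Multiplied by `v j` they have weighted norm at most that of `g j`, and `T̃` of them is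
a scalar function times `tensor v`. -/
theorem LowerBoundOnCube.weightedNrm_le_of_factorization (hlow : LowerBoundOnCube T C Q Q')
    (hrep : AverageRepresentation n T α C Q Q') (hm : 0 < m) (hn : ∀ j, 0 < n j) (h0 : 0 < α)
    (h1 : α < 1) (hC : 0 < C) (hX : ∀ j, (X j).Fatou) (hW : ∀ j, IsMatrixWeight (W j))
    (hdual : ∀ (j) (Q : Cube d),
      (X j).dualNrm (Q.set.indicator (fun x => (invOpNorm (W j) x : 𝕜))) < ⊤)
    (hT : tildeWeakNorm T X W < ⊤) {v : ∀ j, Hil 𝕜 (n j)} (hv : ∀ j, v j ≠ 0)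
    {g : Fin m → Rd d → ℝ} (hg : ∀ j, AEStronglyMeasurable (g j) (volume : Measure (Rd d)))
    (hg0 : ∀ j x, 0 ≤ g j x) (hgfin : ∀ j, (X j).nrm (fun x => (g j x : 𝕜)) < ⊤)
    (hle : ∀ᵐ x, x ∈ Q'.set →
      ∏ j, ‖Matrix.toEuclideanLin (W j x) (v j)‖ ≤ ∏ j, g j x) :
    weightedNrm (prodNrm X) (tensorWeight W) (Q.set.indicator fun _ => tensor v)
      ≤ ENNReal.ofReal (2 * C) * tildeWeakNorm T X W
        * ∏ j, (X j).nrm (fun x => (g j x : 𝕜)) := by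
  set ρ : Fin m → Rd d → ℝ := fun j x => ‖Matrix.toEuclideanLin (W j x) (v j)‖ with hρ
  have hρm : ∀ j, AEStronglyMeasurable (ρ j) (volume : Measure (Rd d)) := fun j =>
    (aestronglyMeasurable_toEuclideanLin (hW j).meas aestronglyMeasurable_const).norm
  have hρpos : ∀ᵐ x, ∀ j, 0 < ρ j x := by
    filter_upwards [ae_all_iff.2 fun j => (hW j).posDef] with x hx j
    exact toEuclideanLin_ne_zero (hx j) (hv j)
  have hm' : (m : ℝ) ≠ 0 := by exact_mod_cast hm.ne'
  set r : Fin m → Rd d → ℝ := fun j x => g j x / ρ j x with hr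
  have hrm : ∀ j, AEStronglyMeasurable (r j) (volume : Measure (Rd d)) := fun j =>
    ((hg j).aemeasurable.div (hρm j).aemeasurable).aestronglyMeasurable
  have hr0 : ∀ j x, 0 ≤ r j x := fun j x => div_nonneg (hg0 j x) (norm_nonneg _)
  have hrρ : ∀ j x, r j x * ρ j x ≤ g j x := by
    intro j x
    simp only [hr]
    by_cases h0 : ρ j x = 0
    · simpa [h0] using hg0 j x
    · rw [div_mul_cancel₀ _ h0]
  -- The `m`-th root normalizes the product to one. Where the `r j` have product at least one, it
  -- also makes `h j ≤ r j`.
  set h : Fin m → Rd d → ℝ := fun j x => r j x / (∏ i, r i x) ^ (1 / m : ℝ) with hh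
  have hhm : ∀ j, AEStronglyMeasurable (h j) (volume : Measure (Rd d)) := fun j =>
    ((hrm j).aemeasurable.div ((Finset.aemeasurable_fun_prod _ fun i _ =>
      (hrm i).aemeasurable).pow_const _)).aestronglyMeasurable
  -- On `G N` all the pointwise properties hold and `h` is bounded, so the restrictions are
  -- admissible test functions. These sets exhaust `Q'` up to a null set.
  set G : ℕ → Set (Rd d) := fun N => Q'.set ∩ ({x | ∀ j, 0 < ρ j x} ∩
    ({x | ∏ j, ρ j x ≤ ∏ j, g j x} ∩ {x | ∀ j, h j x ≤ N})) with hG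
  have hGm : ∀ N, NullMeasurableSet (G N) (volume : Measure (Rd d)) := by
    intro N
    refine Q'.measurableSet.nullMeasurableSet.inter (NullMeasurableSet.inter ?_
      (NullMeasurableSet.inter ?_ ?_))
    · have : {x | ∀ j, 0 < ρ j x} = ⋂ j, {x | 0 < ρ j x} := by ext; simp
      rw [this]
      exact NullMeasurableSet.iInter fun j =>
        nullMeasurableSet_lt aemeasurable_const (hρm j).aemeasurable
    · exact nullMeasurableSet_le (Finset.aemeasurable_fun_prod _ fun i _ => (hρm i).aemeasurable)
        (Finset.aemeasurable_fun_prod _ fun i _ => (hg i).aemeasurable)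
    · have : {x | ∀ j, h j x ≤ (N : ℝ)} = ⋂ j, {x | h j x ≤ N} := by ext; simp
      rw [this]
      exact NullMeasurableSet.iInter fun j =>
        nullMeasurableSet_le (hhm j).aemeasurable aemeasurable_const
  have hR : ∀ N, ∀ x ∈ G N, 1 ≤ ∏ j, r j x := by
    rintro N x ⟨-, hx1, hx2, -⟩
    simp only [hr, Finset.prod_div_distrib]
    rw [one_le_div (Finset.prod_pos fun j _ => hx1 j)]
    exact hx2
  have hhr : ∀ N, ∀ x ∈ G N, ∀ j, h j x ≤ r j x := fun N x hx j =>
    div_le_self (hr0 j x) (Real.one_le_rpow (hR N x hx) (by positivity))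
  have hh0 : ∀ N, ∀ x ∈ G N, ∀ j, 0 ≤ h j x := fun N x hx j =>
    div_nonneg (hr0 j x) (Real.rpow_nonneg (zero_le_one.trans (hR N x hx)) _)
  have hh1 : ∀ N, ∀ x ∈ G N, ∏ j, h j x = 1 := by
    intro N x hx
    have hpos : 0 < ∏ j, r j x := zero_lt_one.trans_le (hR N x hx)
    simp only [hh, Finset.prod_div_distrib, Finset.prod_const, Finset.card_univ, Fintype.card_fin]
    rw [← Real.rpow_natCast, ← Real.rpow_mul hpos.le, one_div, inv_mul_cancel₀ hm', Real.rpow_one,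
      div_self hpos.ne']
  have hGlim : ∀ᵐ x, x ∈ Q'.set → ∀ᶠ N in atTop, x ∈ G N := by
    filter_upwards [hle, hρpos] with x hx1 hx2 hxQ
    have h3 : ∀ᶠ N : ℕ in atTop, ∀ j, h j x ≤ N :=
      eventually_all.2 fun j => (tendsto_natCast_atTop_atTop (R := ℝ)).eventually_ge_atTop (h j x)
    filter_upwards [h3] with N hN
    exact ⟨hxQ, hx2, hx1 hxQ, hN⟩
  -- The function `r j • v j` has finite weighted norm because `r j * ρ j ≤ g j`, so duality makes
  -- it integrable on `Q'`. This provides the uniform bound `I`.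
  have hrint : ∀ j, IntegrableOn (r j) Q'.set := by
    intro j
    have hfm : AEStronglyMeasurable (fun x => (r j x : 𝕜) • v j) (volume : Measure (Rd d)) :=
      (RCLike.continuous_ofReal.comp_aestronglyMeasurable (hrm j)).smul_const _
    have hffin : weightedNrm (X j).nrm (W j) (fun x => (r j x : 𝕜) • v j) < ⊤ := by
      refine lt_of_le_of_lt ((X j).nrm_mono
        (aestronglyMeasurable_toEuclideanLin (hW j).meas hfm).norm (hg j)
        (ae_of_all _ fun x => ?_)) (hgfin j)
      rw [map_smul, norm_smul, RCLike.norm_ofReal, abs_of_nonneg (hr0 j x), abs_of_nonneg (hg0 j x),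
        abs_of_nonneg (mul_nonneg (hr0 j x) (norm_nonneg _))]
      exact hrρ j x
    have h1 : IntegrableOn (fun x => (r j x : 𝕜) • v j) Q'.set :=
      ⟨hfm.restrict, (lintegral_enorm_le_dualNrm_mul (X j) (hW j) Q' hfm hffin).trans_lt
        (ENNReal.mul_lt_top hffin (hdual j Q'))⟩
    have h2 := h1.norm.div_const ‖v j‖
    refine h2.congr (ae_of_all _ fun x => ?_)
    simp only
    rw [norm_smul, mul_div_assoc, div_self (norm_ne_zero_iff.2 (hv j)), mul_one,
      RCLike.norm_ofReal, abs_of_nonneg (hr0 j x)]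
  set I := ∑ j, ∫ x in Q'.set, r j x with hI
  have hIle : ∀ N j, ∫ x, (G N).indicator (h j) x ≤ I := by
    intro N j
    calc ∫ x, (G N).indicator (h j) x ≤ ∫ x, Q'.set.indicator (r j) x := by
          refine integral_mono_of_nonneg
            (ae_of_all _ fun x => indicator_nonneg (fun x hx => hh0 N x hx j) x)
            ((integrable_indicator_iff Q'.measurableSet).2 (hrint j)) (ae_of_all _ fun x => ?_)
          by_cases hx : x ∈ G N
          · have hxQ : x ∈ Q'.set := hx.1
            simpa [hx, hxQ] using hhr N x hx j
          · simp only [hx, not_false_eq_true, indicator_of_notMem]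
            exact indicator_nonneg (fun x _ => hr0 j x) x
      _ = ∫ x in Q'.set, r j x := integral_indicator Q'.measurableSet
      _ ≤ I := Finset.single_le_sum (f := fun j => ∫ x in Q'.set, r j x)
          (fun j _ => integral_nonneg fun x => hr0 j x) (Finset.mem_univ j)
  have hev := hlow.eventually_le hrep hm hn h0 h1 hC hGm (fun N => inter_subset_left) hGlim hhm
    hh0 (fun N x hx => hx.2.2.2) hh1 hIle
  set U : ℕ → Fin m → Rd d → 𝕜 := fun N j y => (((G N).indicator (h j) y : ℝ) : 𝕜) with hU
  have hind0 : ∀ N j x, 0 ≤ (G N).indicator (h j) x := fun N j x =>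
    indicator_nonneg (fun x hx => hh0 N x hx j) x
  have hUn : ∀ N j x, ‖U N j x‖ = (G N).indicator (h j) x := fun N j x => by
    rw [hU, RCLike.norm_ofReal, abs_of_nonneg (hind0 N j x)]
  have hUl : ∀ N j, IsLinfc (U N j) := by
    intro N j
    refine isLinfc_of_bound (Q := Q') (B := N)
      (RCLike.continuous_ofReal.comp_aestronglyMeasurable ((hhm j).indicator₀ (hGm N))) ?_ ?_
    · intro x hx
      by_contra hxQ
      exact hx (by simp [hU, show x ∉ G N from fun h => hxQ h.1])
    · intro x
      rw [hUn]
      exact indicator_apply_le' (fun hx => hx.2.2.2 j) fun _ => Nat.cast_nonneg N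
  have hUfin : ∀ N j, weightedNrm (X j).nrm (W j) (fun x => U N j x • v j)
      ≤ (X j).nrm (fun x => (g j x : 𝕜)) := by
    intro N j
    refine (X j).nrm_mono (aestronglyMeasurable_toEuclideanLin (hW j).meas
      ((hUl N j).aestronglyMeasurable.smul_const _)).norm (hg j) (ae_of_all _ fun x => ?_)
    rw [map_smul, norm_smul, hUn, abs_of_nonneg (hg0 j x),
      abs_of_nonneg (mul_nonneg (hind0 N j x) (norm_nonneg _))]
    by_cases hx : x ∈ G N
    · simp only [hx, indicator_of_mem]
      exact (mul_le_mul_of_nonneg_right (hhr N x hx j) (norm_nonneg _)).trans (hrρ j x)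
    · simpa [hx] using hg0 j x
  -- Requiring the lower bound for all `N ≥ k` makes these sets increase. They exhaust `Q` up to a
  -- null set.
  set E : ℕ → Set (Rd d) := fun k => {x | x ∈ Q.set ∧ ∀ N ≥ k, 1 ≤ 2 * C * ‖T.app (U N) x‖}
    with hE
  have hEmono : Monotone E := fun k l hkl x hx => ⟨hx.1, fun N hN => hx.2 N (hkl.trans hN)⟩
  set b := ENNReal.ofReal (2 * C) * tildeWeakNorm T X W
        * ∏ j, (X j).nrm (fun x => (g j x : 𝕜)) with hb
  have hEb : ∀ k, weightedNrm (prodNrm X) (tensorWeight W) ((E k).indicator fun _ => tensor v)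
      ≤ b := by
    intro k
    have hspec := multiNorm_spec hT (f := fun j x => U k j x • v j)
      (fun j => isLinfc_smul_const (hUl k j) (v j)) fun j => (hUfin k j).trans_lt (hgfin j)
    -- On `E k` the value of `T̃` is `tensor v` times a scalar of modulus at least `1 / (2 * C)`, so
    -- the fixed vector `e` belongs to its symmetric hull. This is exactly what the weak norm
    -- measures.
    set e : HilT 𝕜 n := ((2 * C : ℝ) : 𝕜)⁻¹ • tensor v with he
    have hstep := weightedNrm_prodNrm_le (X := X) (V := tensorWeight W) hm (c := 2 * C)
      (by positivity) (f := (E k).indicator fun _ => tensor v)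
      (g := {x | e ∈ symHull (𝕜 := 𝕜) (T.tilde (fun j x => U k j x • v j) x)}.indicator
        fun _ => e) ?_
    · refine hstep.trans ?_
      rw [hb, mul_assoc]
      gcongr
      refine le_trans (le_iSup (fun u : HilT 𝕜 n => weightedNrm (prodNrm X) (tensorWeight W)
        ({x | u ∈ symHull (𝕜 := 𝕜) (T.tilde (fun j x => U k j x • v j) x)}.indicator
        fun _ => u)) e) (hspec.trans ?_)
      refine mul_le_mul_right (Finset.prod_le_prod' fun j _ => hUfin k j) _
    · filter_upwards [T.tilde_smul (hUl k) v] with x hx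
      by_cases hxE : x ∈ E k
      · have h3 := hxE.2 k le_rfl
        have hC2 : ((2 * C : ℝ) : 𝕜) ≠ 0 := by
          rw [RCLike.ofReal_ne_zero]; positivity
        have hT0 : T.app (U k) x ≠ 0 := by
          intro h0
          rw [h0, norm_zero, mul_zero] at h3
          linarith
        have hmem : e ∈ symHull (𝕜 := 𝕜) (T.tilde (fun j x => U k j x • v j) x) := by
          rw [hx]
          have h4 := smul_mem_symHull (𝕜 := 𝕜) (T.app (U k) x • tensor v)
            (c := (((2 * C : ℝ) : 𝕜) * T.app (U k) x)⁻¹) (by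
              rw [norm_inv, norm_mul, RCLike.norm_ofReal, abs_of_pos (by positivity)]
              exact inv_le_one_of_one_le₀ h3)
          rwa [smul_smul, mul_inv, mul_assoc, inv_mul_cancel₀ hT0, mul_one] at h4
        rw [indicator_of_mem hxE, indicator_of_mem (s := {x | e ∈ symHull (𝕜 := 𝕜)
          (T.tilde (fun j x => U k j x • v j) x)}) hmem, he, map_smul, norm_smul, norm_inv,
          RCLike.norm_ofReal, abs_of_pos (by positivity), ← mul_assoc,
          mul_inv_cancel₀ (by positivity), one_mul]
      · simp only [hxE, not_false_eq_true, indicator_of_notMem, map_zero, norm_zero]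
        positivity
  -- The norms of the inverse weights serve as the positive functions embedding each `X j` into a
  -- weighted `L¹` on `Q`.
  refine prodNrm_le_of_monotone hm hX Q.measurableSet (w := fun j => invOpNorm (W j))
    (fun j => (aemeasurable_invOpNorm (hW j)).restrict)
    (fun j => ae_restrict_of_ae (by
      filter_upwards [(hW j).posDef] with x hx
      exact invOpNorm_pos hx (hn j)))
    (fun j => hdual j Q)
    (f := fun k x => ((‖Matrix.toEuclideanLin (tensorWeight W x)
      ((E k).indicator (fun _ => tensor v) x)‖ : ℝ) : 𝕜)) (fun x k l hkl => ?_)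
    (fun k x hx => ?_) ?_ hEb
  · simp only [RCLike.norm_ofReal, abs_norm]
    by_cases hx : x ∈ E k
    · simp [hx, hEmono hkl hx]
    · simp [hx]
  · simp [show x ∉ E k from fun h => hx h.1]
  · filter_upwards [hev] with x hx
    by_cases hxQ : x ∈ Q.set
    · obtain ⟨k, hk⟩ := eventually_atTop.1 (hx hxQ)
      refine ⟨k, ?_⟩
      have hxE : x ∈ E k := ⟨hxQ, hk⟩
      simp [hxQ, hxE]
    · exact ⟨0, by simp [hxQ]⟩

/-- Take the infimum over all factorizations on `Q'`. Finiteness ensures that there is at least one,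
so the constant can be moved inside the infimum even if it vanishes; a vanishing `v j` makes the
tensor zero. -/
theorem LowerBoundOnCube.weightedNrm_indicator_tensor_le (hlow : LowerBoundOnCube T C Q Q')
    (hrep : AverageRepresentation n T α C Q Q') (hm : 0 < m) (hn : ∀ j, 0 < n j) (h0 : 0 < α)
    (h1 : α < 1) (hC : 0 < C) (hX : ∀ j, (X j).Fatou) (hW : ∀ j, IsMatrixWeight (W j))
    (hdual : ∀ (j) (Q : Cube d),
      (X j).dualNrm (Q.set.indicator (fun x => (invOpNorm (W j) x : 𝕜))) < ⊤)
    (hT : tildeWeakNorm T X W < ⊤) (v : ∀ j, Hil 𝕜 (n j))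
    (hfin : weightedNrm (prodNrm X) (tensorWeight W) (Q'.set.indicator fun _ => tensor v) < ⊤) :
    weightedNrm (prodNrm X) (tensorWeight W) (Q.set.indicator fun _ => tensor v)
      ≤ ENNReal.ofReal (2 * C) * tildeWeakNorm T X W
        * weightedNrm (prodNrm X) (tensorWeight W) (Q'.set.indicator fun _ => tensor v) := by
  by_cases hv : ∀ j, v j ≠ 0
  · rw [weightedNrm, prodNrm, sInf_lt_iff] at hfin
    obtain ⟨a0, ha0, -⟩ := hfin
    conv_rhs => rw [weightedNrm, prodNrm, sInf_eq_iInf']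
    rw [ENNReal.mul_iInf' (fun htop => absurd htop
      (ENNReal.mul_lt_top ENNReal.ofReal_lt_top hT).ne) fun _ => ⟨⟨a0, ha0⟩⟩]
    refine le_iInf ?_
    rintro ⟨a, g, hg, hg0, hgfin, hle, rfl⟩
    refine hlow.weightedNrm_le_of_factorization hrep hm hn h0 h1 hC hX hW hdual hT hv hg hg0 hgfin ?_
    filter_upwards [hle] with x hx hxQ
    rw [RCLike.norm_ofReal, abs_norm, indicator_of_mem hxQ, norm_tensorWeight_tensor] at hx
    exact hx
  · push Not at hv
    obtain ⟨j, hj⟩ := hv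
    have : tensor v = 0 := by
      rw [← norm_eq_zero, norm_tensor]
      exact Finset.prod_eq_zero (Finset.mem_univ j) (by simp [hj])
    rw [this]
    refine le_trans (le_of_eq ?_) zero_le
    simp [weightedNrm, prodNrm_zero X hm]

end StepLower

/-! ### Products of Banach function spaces -/

section MainInequality

variable {𝕜 : Type*} [RCLike 𝕜] {d m : ℕ} {n : Fin m → ℕ}

theorem tildeWeakNorm_le_tildeNorm (hm : 0 < m) (T : CZOperator 𝕜 d m) (X : Fin m → BFS 𝕜 d)
    (W : ∀ j, Rd d → Matrix (Fin (n j)) (Fin (n j)) 𝕜) :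
    tildeWeakNorm T X W ≤ tildeNorm T X W := by
  refine sInf_le_sInf fun B hB f hf hfin => le_trans (iSup_le fun u => ?_) (hB f hf hfin)
  have := weightedNrm_prodNrm_le (X := X) (V := tensorWeight W) hm (c := 1) zero_le_one
    (f := {x | u ∈ symHull (𝕜 := 𝕜) (T.tilde f x)}.indicator fun _ => u) (g := T.tilde f)
    (ae_of_all _ fun x => ?_)
  · simpa using this
  · rw [one_mul]
    by_cases hx : u ∈ symHull (𝕜 := 𝕜) (T.tilde f x)
    · rw [indicator_of_mem (s := {x | u ∈ symHull (𝕜 := 𝕜) (T.tilde f x)}) hx]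
      exact norm_map_le_of_mem_symHull
        (LinearMap.toContinuousLinearMap (Matrix.toEuclideanLin (tensorWeight W x))) hx
    · rw [indicator_of_notMem (s := {x | u ∈ symHull (𝕜 := 𝕜) (T.tilde f x)}) hx, map_zero,
        norm_zero]
      exact norm_nonneg _

/-- The tensor product is then the zero space. The case is separate because the main argument needs
nonzero vectors in every slot. -/
theorem avgNorm_eq_zero_of_dim_eq_zero (hm : 0 < m) {j : Fin m} (hj : n j = 0) (Q : Cube d)
    (X : Fin m → BFS 𝕜 d) (W : ∀ j, Rd d → Matrix (Fin (n j)) (Fin (n j)) 𝕜) :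
    avgNorm Q X W = 0 := by
  refine nonpos_iff_eq_zero.1 (sInf_le fun f _ _ => ?_)
  have hE : IsEmpty (∀ j, Fin (n j)) := ⟨fun k => (hj ▸ k j : Fin 0).elim0⟩
  have h0 : ∀ v : HilT 𝕜 n, v = 0 := fun v => by ext k; exact hE.elim k
  rw [zero_mul, nonpos_iff_eq_zero, weightedNrm]
  have : ∀ x, ‖Matrix.toEuclideanLin (tensorWeight W x) (avgOp Q f x)‖ = 0 := fun x => by
    rw [h0 (Matrix.toEuclideanLin (tensorWeight W x) (avgOp Q f x)), norm_zero]
  simp only [this, RCLike.ofReal_zero]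
  exact prodNrm_zero X hm

/-- The averaged tensor is elementary, so it can be moved from `Q` to `Q'` at cost `2 * C` and the
weak norm, and then bounded there at cost `2 * K * C` and the strong norm, with a further `K` from
truncation. -/
theorem avgNorm_le {X : Fin m → BFS 𝕜 d} {W : ∀ j, Rd d → Matrix (Fin (n j)) (Fin (n j)) 𝕜}
    {T : CZOperator 𝕜 d m} {α C : ℝ} {Q Q' : Cube d}
    (hm : 0 < m) (hn : ∀ j, 0 < n j) {c : Fin m → ℝ} (hc0 : ∀ j, 0 ≤ c j)
    (hc : ∀ (j) (f : Rd d → Hil 𝕜 (n j)), IsLinfc f →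
      ∃ φ : Fin (n j) → Rd d → 𝕜,
        (∀ i, AEStronglyMeasurable (φ i) (volume : Measure (Rd d))) ∧
        (∀ i x, ‖φ i x‖ ≤ 1) ∧
        ∀ A : Hil 𝕜 (n j) →ₗ[𝕜] Hil 𝕜 (n j),
          ⨍ y in Q.set, ‖A (f y)‖ ≤ c j * ∑ i, ‖A (⨍ y in Q.set, φ i y • f y)‖)
    {K : ℝ≥0} (hK : IsQuasiConst X K) (h0 : 0 < α) (h1 : α < 1)
    (hα : (K : ℝ≥0∞) * (ENNReal.ofReal (α * ∏ j, c j)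
      * (((max 1 K : ℝ≥0) : ℝ≥0∞) ^ Fintype.card (∀ j, Fin (n j))
        * Fintype.card (∀ j, Fin (n j)))) ≤ 2⁻¹)
    (hlow : LowerBoundOnCube T C Q Q') (hrep : AverageRepresentation n T α C Q Q') (hC : 0 < C)
    (hX : ∀ j, (X j).Fatou) (hW : ∀ j, IsMatrixWeight (W j))
    (hdual : ∀ (j) (Q : Cube d),
      (X j).dualNrm (Q.set.indicator (fun x => (invOpNorm (W j) x : 𝕜))) < ⊤)
    (hT : tildeNorm T X W < ⊤) :
    avgNorm Q X W ≤ 4 * K ^ 2 * ENNReal.ofReal C ^ 2 * tildeWeakNorm T X W * tildeNorm T X W := by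
  refine sInf_le fun f hf hffin => ?_
  have hfinv : ∀ v : ∀ j, Hil 𝕜 (n j),
      weightedNrm (prodNrm X) (tensorWeight W) (Q'.set.indicator fun _ => tensor v) < ⊤ :=
    fun v => hrep.weightedNrm_tensor_lt_top hm h0 h1 hC hW hT v
  have hT' := (tildeWeakNorm_le_tildeNorm hm T X W).trans_lt hT
  have e1 := hlow.weightedNrm_indicator_tensor_le hrep hm hn h0 h1 hC hX hW hdual hT'
    (fun j => ⨍ y in Q.set, f j y) (hfinv _)
  have e2 := weightedNrm_shiftedAvg_le (Q := Q) (Q' := Q') hm hK hW (fun j => hdual j Q) hfinv hf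
    hffin
  have e3 := shiftedNorm_le hm hc0 hc hK h0 h1 hα hrep hC hW (fun j => hdual j Q) hT
  calc weightedNrm (prodNrm X) (tensorWeight W) (avgOp Q f)
      ≤ ENNReal.ofReal (2 * C) * tildeWeakNorm T X W
        * weightedNrm (prodNrm X) (tensorWeight W) (shiftedAvg Q Q' f) := e1
    _ ≤ ENNReal.ofReal (2 * C) * tildeWeakNorm T X W
        * (K * (2 * (K * (ENNReal.ofReal C * tildeNorm T X W))
          * ∏ j, weightedNrm (X j).nrm (W j) (f j))) := by
        refine mul_le_mul_right (e2.trans ?_) _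
        gcongr
    _ = _ := by
        rw [ENNReal.ofReal_mul zero_le_two, ENNReal.ofReal_ofNat]
        ring

theorem exists_avgNorm_bound (𝕜 : Type*) [RCLike 𝕜] (hm : 0 < m) (n : Fin m → ℕ) (K : ℝ≥0) :
    ∃ α : ℝ, 0 < α ∧ α < 1 ∧ ∃ c : ℝ≥0,
      ∀ (d : ℕ) (T : CZOperator 𝕜 d m) (C : ℝ → ℝ), DirNonDegWith n T C →
        ∀ X : Fin m → BFS 𝕜 d, (∀ j, (X j).Fatou) → IsQuasiConst X K →
        ∀ W : (∀ j, Rd d → Matrix (Fin (n j)) (Fin (n j)) 𝕜),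
          (∀ j, IsMatrixWeight (W j)) →
          (∀ (j) (Q : Cube d),
            (X j).dualNrm (Q.set.indicator (fun x => (invOpNorm (W j) x : 𝕜))) < ⊤) →
          tildeNorm T X W < ⊤ →
          ∀ Q : Cube d, avgNorm Q X W
            ≤ c * ENNReal.ofReal (C α) ^ 2 * tildeWeakNorm T X W * tildeNorm T X W := by
  by_cases hn : ∀ j, 0 < n j
  · choose c hc0 hc using fun j => exists_average_norm_le (𝕜 := 𝕜) (n j)
    set N := Fintype.card (∀ j, Fin (n j))
    set B : ℝ := K * ((∏ j, c j) * ((max 1 K : ℝ≥0) ^ N * N)) with hB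
    have hP : 0 ≤ ∏ j, c j := Finset.prod_nonneg fun j _ => hc0 j
    have hB0 : 0 ≤ B := by positivity
    have hα0 : 0 < (2 * (B + 1))⁻¹ := by positivity
    -- `B` collects the constants multiplying `α` in the absorption, so this `α` makes their product
    -- at most one half. Adding 1 keeps `α` below one when `B` is zero. All of it depends on `K` and
    -- the dimensions only.
    refine ⟨(2 * (B + 1))⁻¹, hα0, inv_lt_one_of_one_lt₀ (by linarith), 4 * K ^ 2,
      fun d T C hTC X hX hK W hW hdual hT Q => ?_⟩
    have hα1 : (2 * (B + 1))⁻¹ < 1 := inv_lt_one_of_one_lt₀ (by linarith)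
    obtain ⟨hC, hQ⟩ := hTC _ hα0 hα1
    obtain ⟨Q', hlow, hrep⟩ := hQ Q
    have key : (K : ℝ≥0∞) * (ENNReal.ofReal ((2 * (B + 1))⁻¹ * ∏ j, c j)
        * (((max 1 K : ℝ≥0) : ℝ≥0∞) ^ N * N)) ≤ 2⁻¹ := by
      have e1 : ∀ p : ℝ, 0 ≤ p → (K : ℝ≥0∞) * (ENNReal.ofReal p
          * (((max 1 K : ℝ≥0) : ℝ≥0∞) ^ N * N))
          = ENNReal.ofReal (K * (p * (((max 1 K : ℝ≥0) : ℝ) ^ N * N))) := by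
        intro p hp
        rw [ENNReal.ofReal_mul (by positivity), ENNReal.ofReal_mul (by positivity),
          ENNReal.ofReal_mul (by positivity), ENNReal.ofReal_pow (by positivity),
          ENNReal.ofReal_coe_nnreal, ENNReal.ofReal_coe_nnreal, ENNReal.ofReal_natCast]
      rw [e1 _ (by positivity), show (2⁻¹ : ℝ≥0∞) = ENNReal.ofReal (2⁻¹) by
        rw [ENNReal.ofReal_inv_of_pos two_pos, ENNReal.ofReal_ofNat]]
      refine ENNReal.ofReal_le_ofReal ?_
      rw [show K * ((2 * (B + 1))⁻¹ * (∏ j, c j) * (((max 1 K : ℝ≥0) : ℝ) ^ N * N))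
        = (2 * (B + 1))⁻¹ * B by rw [hB]; ring, mul_inv, mul_assoc]
      refine mul_le_of_le_one_right (by norm_num) ?_
      rw [inv_mul_le_iff₀ (by positivity)]
      linarith
    have := avgNorm_le hm hn hc0 (fun j f hf => hc j Q f hf) hK hα0 hα1 key hlow hrep hC hX hW
      hdual hT
    simpa using this
  · push Not at hn
    obtain ⟨j, hj⟩ := hn
    exact ⟨1 / 2, by norm_num, by norm_num, 0, fun d T C _ X _ _ W _ _ _ Q => by
      rw [avgNorm_eq_zero_of_dim_eq_zero hm (Nat.le_zero.1 hj)]; simp⟩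

end MainInequality

/-! ### Lebesgue spaces as Banach function spaces -/

section Lebesgue

variable {𝕜 : Type*} [RCLike 𝕜] {d m : ℕ}

theorem exists_limit_of_cauchy_eLpNorm {p : ℝ≥0∞} (hp : 1 ≤ p) {f : ℕ → Rd d → 𝕜}
    (hf : ∀ k, AEStronglyMeasurable (f k) (volume : Measure (Rd d)) ∧ eLpNorm (f k) p volume < ⊤)
    (hcau : ∀ ε : ℝ≥0∞, 0 < ε → ∃ N, ∀ k ≥ N, ∀ l ≥ N,
      eLpNorm (fun x => f k x - f l x) p volume < ε) :
    ∃ g, AEStronglyMeasurable g (volume : Measure (Rd d)) ∧ eLpNorm g p volume < ⊤ ∧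
      Tendsto (fun k => eLpNorm (fun x => f k x - g x) p volume) atTop (𝓝 0) := by
  have : Fact (1 ≤ p) := ⟨hp⟩
  set F : ℕ → Lp 𝕜 p (volume : Measure (Rd d)) := fun k => MemLp.toLp (f k) (hf k) with hF
  have hdist : ∀ k l, edist (F k) (F l) = eLpNorm (fun x => f k x - f l x) p volume := fun k l =>
    Lp.edist_toLp_toLp _ _ _ _
  have hC : CauchySeq F := by
    rw [EMetric.cauchySeq_iff]
    intro ε hε
    obtain ⟨N, hN⟩ := hcau ε hε
    exact ⟨N, fun k hk l hl => by rw [hdist]; exact hN k hk l hl⟩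
  obtain ⟨g, hg⟩ := cauchySeq_tendsto_of_complete hC
  refine ⟨g, Lp.aestronglyMeasurable g, Lp.eLpNorm_lt_top g, ?_⟩
  have h2 := (tendsto_iff_edist_tendsto_0).1 hg
  refine h2.congr fun k => ?_
  rw [Lp.edist_def]
  refine eLpNorm_congr_ae ?_
  filter_upwards [(MemLp.coeFn_toLp (hf k) : _ =ᵐ[volume] f k)] with x hx
  simp only [Pi.sub_apply, hF]
  rw [hx]

/-- On each ball, test against `g / (1 + ‖g‖)`: it is bounded with compact support, so it lies in
`L^p`, and its pairing with `g` has a nonnegative integrand. -/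
theorem ae_eq_zero_of_integral_mul_star {p : ℝ≥0∞} {g : Rd d → 𝕜}
    (hg : AEStronglyMeasurable g (volume : Measure (Rd d)))
    (h : ∀ f, AEStronglyMeasurable f (volume : Measure (Rd d)) → eLpNorm f p volume < ⊤ →
      Integrable (fun x => f x * star (g x)) ∧ ∫ x, f x * star (g x) = 0) :
    g =ᵐ[volume] 0 := by
  have key : ∀ R : ℕ, ∀ᵐ x, x ∈ Metric.closedBall (0 : Rd d) R → g x = 0 := by
    intro R
    set B := Metric.closedBall (0 : Rd d) R with hB
    have hBm : MeasurableSet B := Metric.isClosed_closedBall.measurableSet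
    set f : Rd d → 𝕜 := B.indicator fun x => ((1 + ‖g x‖ : ℝ) : 𝕜)⁻¹ * g x with hf
    have hfm : AEStronglyMeasurable f (volume : Measure (Rd d)) := by
      refine AEStronglyMeasurable.indicator ?_ hBm
      exact ((RCLike.continuous_ofReal.comp_aestronglyMeasurable
        (aestronglyMeasurable_const.add hg.norm)).aemeasurable.inv.mul
          hg.aemeasurable).aestronglyMeasurable
    have hpos : ∀ x, 0 < 1 + ‖g x‖ := fun x => by positivity
    have hf1 : ∀ x, ‖f x‖ ≤ 1 := fun x => by
      refine (norm_indicator_le_norm_self _ _).trans ?_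
      rw [norm_mul, norm_inv, RCLike.norm_ofReal, abs_of_pos (hpos x), inv_mul_le_iff₀ (hpos x)]
      linarith
    have hfl : IsLinfc f := ⟨memLp_top_of_bound hfm 1 (ae_of_all _ hf1),
      HasCompactSupport.of_support_subset_isCompact (isCompact_closedBall _ _)
        support_indicator_subset⟩
    obtain ⟨hint, h0⟩ := h f hfm (hfl.memLp p).2
    set F : Rd d → ℝ := B.indicator fun x => (1 + ‖g x‖)⁻¹ * ‖g x‖ ^ 2 with hFdef
    have hfF : (fun x => f x * star (g x)) = fun x => ((F x : ℝ) : 𝕜) := by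
      funext x
      by_cases hx : x ∈ B
      · simp only [hf, hFdef, hx, indicator_of_mem]
        rw [mul_assoc, RCLike.star_def, RCLike.mul_conj]
        push_cast
        rfl
      · simp [hf, hFdef, hx]
    rw [hfF] at hint h0
    have hFint : Integrable F := by
      have := hint.re
      simpa using this
    rw [integral_ofReal] at h0
    have h1 : ∫ x, F x = 0 := by exact_mod_cast h0
    rw [integral_eq_zero_iff_of_nonneg
      (fun x => indicator_nonneg (fun x _ => by positivity) x) hFint] at h1
    filter_upwards [h1] with x hx hxB
    have h2 : (1 + ‖g x‖)⁻¹ * ‖g x‖ ^ 2 = 0 := by simpa [hFdef, hxB] using hx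
    rcases mul_eq_zero.1 h2 with h3 | h3
    · exact absurd h3 (inv_ne_zero (hpos x).ne')
    · simpa using h3
  filter_upwards [ae_all_iff.2 key] with x hx
  obtain ⟨R, hR⟩ := exists_nat_ge ‖x‖
  exact hx R (by simpa using hR)

/-- The space `L^p`, `1 ≤ p ≤ ∞`. -/
noncomputable def lebesgueBFS (𝕜 : Type*) [RCLike 𝕜] (d : ℕ) (p : ℝ≥0∞) (hp : 1 ≤ p) :
    BFS 𝕜 d where
  nrm f := eLpNorm f p volume
  nrm_eq_zero _ hf := eLpNorm_eq_zero_iff hf (zero_lt_one.trans_le hp).ne'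
  nrm_smul c f _ := eLpNorm_const_smul c f p volume
  nrm_add _ _ hf hg := eLpNorm_add_le hf hg hp
  ideal _ _ _ _ h := eLpNorm_mono_ae h
  complete _ hf hcau := exists_limit_of_cauchy_eLpNorm hp hf hcau
  nondegenerate _ hg h := ae_eq_zero_of_integral_mul_star hg h

theorem lebesgueBFS_fatou {p : ℝ≥0∞} (hp : 1 ≤ p) : (lebesgueBFS 𝕜 d p hp).Fatou :=
  fun _ g hf hlim => Lp.eLpNorm_lim_le_liminf_eLpNorm (fun k => (hf k).1) g hlim

theorem inv_add_inv_conjExp {p : ℝ≥0∞} (hp : 1 ≤ p) : p⁻¹ + (conjExp p)⁻¹ = 1 := by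
  rw [conjExp, inv_inv]
  exact add_tsub_cancel_of_le (ENNReal.inv_le_one.2 hp)

theorem dualNrm_lebesgueBFS_le {p : ℝ≥0∞} (hp : 1 ≤ p) {g : Rd d → 𝕜}
    (hg : AEStronglyMeasurable g (volume : Measure (Rd d))) :
    (lebesgueBFS 𝕜 d p hp).dualNrm g ≤ eLpNorm g (conjExp p) volume := by
  refine iSup₂_le fun f hf => iSup_le fun hf1 => ?_
  have : ENNReal.HolderTriple p (conjExp p) 1 := ⟨by rw [inv_add_inv_conjExp hp, inv_one]⟩
  have h1 := eLpNorm_smul_le_mul_eLpNorm (p := p) (q := conjExp p) (r := 1) hg hf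
  rw [eLpNorm_one_eq_lintegral_enorm] at h1
  simp only [Pi.smul_apply', smul_eq_mul, enorm_mul] at h1
  refine h1.trans ?_
  calc eLpNorm f p volume * eLpNorm g (conjExp p) volume
      ≤ 1 * eLpNorm g (conjExp p) volume := by
        gcongr
        exact hf1
    _ = _ := one_mul _

theorem eLpNorm_finset_prod_le (p : Fin m → ℝ≥0∞) {g : Fin m → Rd d → ℝ}
    (hg : ∀ j, AEStronglyMeasurable (g j) (volume : Measure (Rd d))) (s : Finset (Fin m)) :
    eLpNorm (fun x => ∏ j ∈ s, g j x) (∑ j ∈ s, (p j)⁻¹)⁻¹ volume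
      ≤ ∏ j ∈ s, eLpNorm (g j) (p j) volume := by
  induction s using Finset.induction_on with
  | empty =>
    simp only [Finset.prod_empty, Finset.sum_empty, ENNReal.inv_zero]
    rw [eLpNorm_exponent_top]
    exact (eLpNormEssSup_le_of_ae_bound (C := 1) (ae_of_all _ fun x => by simp)).trans (by simp)
  | insert a s ha ih =>
    simp only [Finset.prod_insert ha, Finset.sum_insert ha]
    have : ENNReal.HolderTriple (p a) (∑ j ∈ s, (p j)⁻¹)⁻¹ ((p a)⁻¹ + ∑ j ∈ s, (p j)⁻¹)⁻¹ :=
      ⟨by rw [inv_inv, inv_inv]⟩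
    refine (eLpNorm_smul_le_mul_eLpNorm (p := p a) (q := (∑ j ∈ s, (p j)⁻¹)⁻¹)
      (Finset.aestronglyMeasurable_fun_prod s fun j _ => hg j) (hg a)).trans ?_
    gcongr

theorem prod_rpow_eq {ι : Type*} (s : Finset ι) (E : ℝ≥0∞) {a : ι → ℝ} (ha : ∀ j, 0 ≤ a j) :
    ∏ j ∈ s, E ^ a j = E ^ (∑ j ∈ s, a j) := by
  classical
  induction s using Finset.induction_on with
  | empty => simp
  | insert i s hi ih =>
    rw [Finset.prod_insert hi, Finset.sum_insert hi, ih,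
      ENNReal.rpow_add_of_nonneg _ _ (ha i) (Finset.sum_nonneg fun j _ => ha j)]

theorem eLpNorm_ofReal_comp {p : ℝ≥0∞} (f : Rd d → ℝ) :
    eLpNorm (fun x => (f x : 𝕜)) p (volume : Measure (Rd d)) = eLpNorm f p volume :=
  eLpNorm_congr_norm_ae (ae_of_all _ fun x => by simp)

theorem totalExp_pos {p : Fin m → ℝ≥0∞} (hp : ∀ j, 1 < p j) : 0 < totalExp p := by
  rw [totalExp, ENNReal.inv_pos]
  refine (ENNReal.sum_lt_top.2 fun j _ => ?_).ne
  exact ENNReal.inv_lt_top.2 (zero_lt_one.trans (hp j))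

/-- Hölder's inequality bounds every factorization from below, and the factors `‖f‖ ^ (p / p_j)`
attain equality. -/
theorem prodNrm_lebesgueBFS {p : Fin m → ℝ≥0∞} (hp : ∀ j, 1 < p j) (htot : totalExp p < ⊤)
    {f : Rd d → 𝕜} (hf : AEStronglyMeasurable f (volume : Measure (Rd d))) :
    prodNrm (fun j => lebesgueBFS 𝕜 d (p j) (hp j).le) f = eLpNorm f (totalExp p) volume := by
  refine le_antisymm ?_ (le_sInf ?_)
  · rcases eq_or_ne (eLpNorm f (totalExp p) volume) ⊤ with htop | htop
    · rw [htop]; exact le_top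
    have hpos := totalExp_pos hp
    set P := (totalExp p).toReal with hP
    have hP0 : 0 < P := ENNReal.toReal_pos hpos.ne' htot.ne
    set a : Fin m → ℝ := fun j => P * ((p j)⁻¹).toReal with ha
    have ha0 : ∀ j, 0 ≤ a j := fun j => by positivity
    have hinv : ∀ j, (p j)⁻¹ ≠ ⊤ := fun j =>
      (ENNReal.inv_lt_top.2 (zero_lt_one.trans (hp j))).ne
    have hasum : ∑ j, a j = 1 := by
      rw [ha, ← Finset.mul_sum, ← ENNReal.toReal_sum fun j _ => hinv j]
      have : ∑ j, (p j)⁻¹ = (totalExp p)⁻¹ := by rw [totalExp, inv_inv]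
      rw [this, ENNReal.toReal_inv]
      exact mul_inv_cancel₀ hP0.ne'
    set g : Fin m → Rd d → ℝ := fun j x => ‖f x‖ ^ a j with hg
    have hgm : ∀ j, AEStronglyMeasurable (g j) (volume : Measure (Rd d)) := fun j =>
      (hf.norm.aemeasurable.pow_const _).aestronglyMeasurable
    have hgn : ∀ j, eLpNorm (g j) (p j) volume ≤ eLpNorm f (totalExp p) volume ^ a j := by
      intro j
      -- The exponent vanishes exactly when `p j = ∞`; that factor is the constant one.
      rcases (ha0 j).eq_or_lt with h0 | h0
      · have hpj : p j = ⊤ := by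
          by_contra hne
          have : 0 < ((p j)⁻¹).toReal :=
            ENNReal.toReal_pos (ENNReal.inv_ne_zero.2 hne) (hinv j)
          exact absurd h0 (mul_pos hP0 this).ne
        rw [hpj, ← h0, ENNReal.rpow_zero, eLpNorm_exponent_top]
        exact (eLpNormEssSup_le_of_ae_bound (C := 1)
          (ae_of_all _ fun x => by simp [hg, ← h0])).trans (by simp)
      · rw [hg, eLpNorm_norm_rpow f h0]
        have hpj : p j ≠ ⊤ := by
          rintro htop
          simp [ha, htop] at h0
        have : p j * ENNReal.ofReal (a j) = totalExp p := by
          rw [ha, ENNReal.ofReal_mul hP0.le, ENNReal.ofReal_toReal (hinv j),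
            ENNReal.ofReal_toReal htot.ne, mul_comm, mul_assoc,
            ENNReal.inv_mul_cancel (zero_lt_one.trans (hp j)).ne' hpj, mul_one]
        rw [this]
    have hgn' : ∀ j, (lebesgueBFS 𝕜 d (p j) (hp j).le).nrm (fun x => (g j x : 𝕜))
        ≤ eLpNorm f (totalExp p) volume ^ a j := fun j =>
      (eLpNorm_ofReal_comp (𝕜 := 𝕜) (g j)).trans_le (hgn j)
    refine (prodNrm_le (fun j => lebesgueBFS 𝕜 d (p j) (hp j).le) hgm
      (fun j x => Real.rpow_nonneg (norm_nonneg _) _)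
      (fun j => (hgn' j).trans_lt (ENNReal.rpow_lt_top_of_nonneg (ha0 j) htop))
      (ae_of_all _ fun x => ?_)).trans ?_
    · simp only [hg]
      rcases (norm_nonneg (f x)).eq_or_lt with h0 | h0
      · rw [← h0]
        exact Finset.prod_nonneg fun j _ => Real.rpow_nonneg le_rfl _
      · rw [← Real.rpow_sum_of_pos h0, hasum, Real.rpow_one]
    · refine (Finset.prod_le_prod' fun j _ => hgn' j).trans_eq ?_
      rw [prod_rpow_eq _ _ ha0, hasum, ENNReal.rpow_one]
  · rintro _ ⟨g, hg, hg0, -, hfg, rfl⟩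
    calc eLpNorm f (totalExp p) volume ≤ eLpNorm (fun x => ∏ j, g j x) (totalExp p) volume := by
          refine eLpNorm_mono_ae ?_
          filter_upwards [hfg] with x hx
          rwa [Real.norm_of_nonneg (Finset.prod_nonneg fun j _ => hg0 j x)]
      _ ≤ ∏ j, eLpNorm (g j) (p j) volume := eLpNorm_finset_prod_le p hg Finset.univ
      _ = _ := Finset.prod_congr rfl fun j _ => (eLpNorm_ofReal_comp (𝕜 := 𝕜) (g j)).symm

theorem isQuasiConst_lebesgueBFS {p : Fin m → ℝ≥0∞} (hp : ∀ j, 1 < p j) (htot : totalExp p < ⊤) :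
    IsQuasiConst (fun j => lebesgueBFS 𝕜 d (p j) (hp j).le)
      (ENNReal.LpAddConst (totalExp p)).toNNReal := by
  intro f g hf hg
  rw [prodNrm_lebesgueBFS hp htot hf, prodNrm_lebesgueBFS hp htot hg,
    prodNrm_lebesgueBFS hp htot (f := fun x => f x + g x) (hf.add hg), ENNReal.coe_toNNReal (ENNReal.LpAddConst_lt_top _).ne]
  exact eLpNorm_add_le' hf hg _

variable {n : Fin m → ℕ}

theorem weightedNrm_eLpNorm {I : Type*} [Fintype I] [DecidableEq I] (p : ℝ≥0∞)
    (W : Rd d → Matrix I I 𝕜) (f : Rd d → EuclideanSpace 𝕜 I) :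
    weightedNrm (fun g => eLpNorm g p volume) W f = lebNorm p W f :=
  eLpNorm_congr_norm_ae (ae_of_all _ fun x => by simp)

theorem weightedNrm_prodNrm_lebesgueBFS {p : Fin m → ℝ≥0∞} (hp : ∀ j, 1 < p j)
    (htot : totalExp p < ⊤) {W : ∀ j, Rd d → Matrix (Fin (n j)) (Fin (n j)) 𝕜}
    (hW : ∀ j, IsMatrixWeight (W j)) {f : Rd d → HilT 𝕜 n}
    (hf : AEStronglyMeasurable f (volume : Measure (Rd d))) :
    weightedNrm (prodNrm fun j => lebesgueBFS 𝕜 d (p j) (hp j).le) (tensorWeight W) f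
      = lebNorm (totalExp p) (tensorWeight W) f := by
  rw [← weightedNrm_eLpNorm, weightedNrm, prodNrm_lebesgueBFS hp htot
    (RCLike.continuous_ofReal.comp_aestronglyMeasurable
      (aestronglyMeasurable_toEuclideanLin (tensorWeight_aemeasurable hW) hf).norm)]
  rfl

theorem multiNorm_congr {I : Type*} [Fintype I] {V : I → Type*} {U : Type*}
    {D : (∀ j, V j) → Prop} {A : (∀ j, V j) → U} {N₁ N₂ : ∀ j, V j → ℝ≥0∞} {M₁ M₂ : U → ℝ≥0∞}
    (hN : N₁ = N₂) (hM : ∀ f, D f → M₁ (A f) = M₂ (A f)) :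
    multiNorm D A N₁ M₁ = multiNorm D A N₂ M₂ := by
  subst hN
  unfold multiNorm
  congr 1
  ext B
  exact forall_congr' fun f => forall_congr' fun hf => by rw [hM f hf]

/-- Local integrability of the inverse weights gives the duality hypothesis by Hölder. The weak norm
is replaced by the strong one, which yields the square. -/
theorem exists_muckenhouptConst_bound (𝕜 : Type*) [RCLike 𝕜] (hm : 0 < m) (n : Fin m → ℕ)
    {p : Fin m → ℝ≥0∞} (hp : ∀ j, 1 < p j) (htot : totalExp p < ⊤) :
    ∃ α : ℝ, 0 < α ∧ α < 1 ∧ ∃ c : ℝ≥0,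
      ∀ (d : ℕ) (T : CZOperator 𝕜 d m) (C : ℝ → ℝ), DirNonDegWith n T C →
        ∀ W : (∀ j, Rd d → Matrix (Fin (n j)) (Fin (n j)) 𝕜),
          (∀ j, IsMatrixWeight (W j)) →
          (∀ j, InvLocallyIntegrable (conjExp (p j)) (W j)) →
          tildeLebNorm T p W < ⊤ →
          MuckenhouptCondition p W ∧
          muckenhouptConst p W ≤ c * ENNReal.ofReal (C α) ^ 2 * tildeLebNorm T p W ^ 2 := by
  obtain ⟨α, h0, h1, c, hc⟩ :=
    exists_avgNorm_bound 𝕜 hm n (ENNReal.LpAddConst (totalExp p)).toNNReal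
  refine ⟨α, h0, h1, c, fun d T C hTC W hW hinv hT => ?_⟩
  set X : Fin m → BFS 𝕜 d := fun j => lebesgueBFS 𝕜 d (p j) (hp j).le with hX
  have hsrc : (fun j => weightedNrm (X j).nrm (W j)) = fun j => lebNorm (p j) (W j) := by
    funext j f
    exact weightedNrm_eLpNorm (p j) (W j) f
  have htilde : tildeNorm T X W = tildeLebNorm T p W :=
    multiNorm_congr hsrc fun f hf =>
      weightedNrm_prodNrm_lebesgueBFS hp htot hW (T.aestronglyMeasurable_tilde hf)
  have havg : ∀ Q : Cube d, avgNorm Q X W = multiNorm domMeas (avgOp Q)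
      (fun j => lebNorm (p j) (W j)) (lebNorm (totalExp p) (tensorWeight W)) := fun Q =>
    multiNorm_congr hsrc fun f _ => weightedNrm_prodNrm_lebesgueBFS hp htot hW
      (aestronglyMeasurable_const.indicator Q.measurableSet)
  have hdual : ∀ (j) (Q : Cube d),
      (X j).dualNrm (Q.set.indicator (fun x => (invOpNorm (W j) x : 𝕜))) < ⊤ := by
    intro j Q
    refine (dualNrm_lebesgueBFS_le (hp j).le
      ((RCLike.continuous_ofReal.comp_aestronglyMeasurable
        (aemeasurable_invOpNorm (hW j)).aestronglyMeasurable).indicator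
          Q.measurableSet)).trans_lt ?_
    rw [eLpNorm_indicator_eq_eLpNorm_restrict Q.measurableSet]
    refine lt_of_le_of_lt (le_of_eq ?_) (hinv j Q)
    exact eLpNorm_congr_norm_ae (ae_of_all _ fun x => by simp)
  rw [← htilde] at hT ⊢
  have hle : muckenhouptConst p W ≤ c * ENNReal.ofReal (C α) ^ 2 * tildeNorm T X W ^ 2 := by
    refine iSup_le fun Q => ?_
    rw [← havg Q]
    refine (hc d T C hTC X (fun j => lebesgueBFS_fatou (hp j).le)
      (isQuasiConst_lebesgueBFS hp htot) W hW hdual hT Q).trans ?_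
    rw [pow_two (tildeNorm T X W), ← mul_assoc]
    gcongr
    exact tildeWeakNorm_le_tildeNorm hm T X W
  exact ⟨⟨hinv, hle.trans_lt (ENNReal.mul_lt_top (ENNReal.mul_lt_top ENNReal.coe_lt_top
    (ENNReal.pow_lt_top ENNReal.ofReal_lt_top)) (ENNReal.pow_lt_top hT))⟩, hle⟩

end Lebesgue

/-! ### The multilinear Riesz transform -/

section Riesz

variable {d m : ℕ}

/-- The real-valued kernel of the multilinear Riesz transform. -/
noncomputable def rieszReal (hd : 0 < d) (x : Rd d) (y : Fin m → Rd d) : ℝ :=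
  (∑ j : Fin m, (x ⟨0, hd⟩ - y j ⟨0, hd⟩)) / (∑ j : Fin m, ‖x - y j‖) ^ (m * d + 1)

theorem rieszKernel_cons (𝕜 : Type*) [RCLike 𝕜] (hd : 0 < d) (x : Rd d) (y : Fin m → Rd d) :
    rieszKernel 𝕜 hd (Fin.cons (α := fun _ => Rd d) x y) = (rieszReal hd x y : 𝕜) := by
  simp [rieszKernel, rieszReal]

theorem measurable_rieszReal (hd : 0 < d) :
    Measurable (Function.uncurry (rieszReal (m := m) hd)) := by
  unfold rieszReal Function.uncurry
  fun_prop

/-- The cube with the same side length, shifted by `A` side lengths in the first direction. -/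
noncomputable def Cube.shift (hd : 0 < d) (A : ℝ) (Q : Cube d) : Cube d where
  corner := Q.corner + EuclideanSpace.single ⟨0, hd⟩ (A * Q.side)
  side := Q.side
  side_pos := Q.side_pos

theorem Cube.vol_shift (hd : 0 < d) (A : ℝ) (Q : Cube d) : (Q.shift hd A).vol = Q.vol := by
  rw [Cube.vol_eq, Cube.vol_eq]
  rfl

theorem norm_le_sum_abs (x : Rd d) : ‖x‖ ≤ ∑ i, |x i| := by
  conv_lhs => rw [← (EuclideanSpace.basisFun (Fin d) ℝ).sum_repr x]
  refine (norm_sum_le _ _).trans (Finset.sum_le_sum fun i _ => ?_)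
  simp [norm_smul]

theorem Cube.sub_mem_shift (hd : 0 < d) {A : ℝ} (hA : 1 < A) {Q : Cube d} {a b : Rd d}
    (ha : a ∈ (Q.shift hd A).set) (hb : b ∈ Q.set) :
    ((A - 1) * Q.side ≤ a ⟨0, hd⟩ - b ⟨0, hd⟩ ∧ a ⟨0, hd⟩ - b ⟨0, hd⟩ ≤ (A + 1) * Q.side) ∧
    (A - 1) * Q.side ≤ ‖a - b‖ ∧ ‖a - b‖ ≤ (A + d) * Q.side := by
  have hs := Q.side_pos
  have h0 := ha ⟨0, hd⟩
  have h1 := hb ⟨0, hd⟩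
  simp only [Cube.shift, WithLp.ofLp_add, Pi.add_apply, PiLp.single_apply,
    if_true] at h0
  have hlow : (A - 1) * Q.side ≤ a ⟨0, hd⟩ - b ⟨0, hd⟩ := by linarith
  refine ⟨⟨hlow, by linarith⟩, hlow.trans ?_, ?_⟩
  · exact (le_abs_self _).trans (by simpa using PiLp.norm_apply_le (a - b) ⟨0, hd⟩)
  · refine (norm_le_sum_abs _).trans ?_
    have : ∀ i : Fin d, |(a - b) i| ≤ Q.side + if i = ⟨0, hd⟩ then A * Q.side else 0 := by
      intro i
      have h2 := ha i
      have h3 := hb i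
      simp only [Cube.shift, WithLp.ofLp_add, Pi.add_apply, PiLp.single_apply] at h2
      have h4 : 0 < A * Q.side := by positivity
      simp only [WithLp.ofLp_sub, Pi.sub_apply]
      split_ifs at h2 ⊢ with hi <;> rw [abs_le] <;> constructor <;> linarith
    refine (Finset.sum_le_sum fun i _ => this i).trans (le_of_eq ?_)
    rw [Finset.sum_add_distrib]
    simp
    ring

theorem Cube.notMem_shift (hd : 0 < d) {A : ℝ} (hA : 1 < A) {Q : Cube d} {a : Rd d}
    (ha : a ∈ (Q.shift hd A).set) : a ∉ Q.set := fun hb => by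
  have h := (Cube.sub_mem_shift hd hA ha hb).1.1
  have : 0 < (A - 1) * Q.side := mul_pos (by linarith) Q.side_pos
  linarith

/-- Lower bound for the kernel on shifted unit cubes. -/
noncomputable def rieszLow (d m : ℕ) (A : ℝ) : ℝ := m * (A - 1) / (m * (A + d)) ^ (m * d + 1)

/-- Upper bound for the kernel on shifted unit cubes. -/
noncomputable def rieszHigh (d m : ℕ) (A : ℝ) : ℝ := m * (A + 1) / (m * (A - 1)) ^ (m * d + 1)

theorem div_pow_bounds (hm : 0 < m) {A s : ℝ} (hA : 1 < A) (hs : 0 < s) {N D : ℝ}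
    (hN : m * ((A - 1) * s) ≤ N) (hN' : N ≤ m * ((A + 1) * s))
    (hD : m * ((A - 1) * s) ≤ D) (hD' : D ≤ m * ((A + d) * s)) :
    rieszLow d m A * ((s ^ d) ^ m)⁻¹ ≤ N / D ^ (m * d + 1) ∧
    N / D ^ (m * d + 1) ≤ rieszHigh d m A * ((s ^ d) ^ m)⁻¹ := by
  have hA1 : 0 < A - 1 := by linarith
  have hm' : (0 : ℝ) < m := by exact_mod_cast hm
  have hD0 : 0 < D := lt_of_lt_of_le (by positivity) hD
  have hN0 : 0 < N := lt_of_lt_of_le (by positivity) hN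
  have hAd : 0 < A + d := by positivity
  -- The kernel is homogeneous of degree `-md`, so side lengths enter only through the power of the
  -- volume.
  have key : ∀ u v : ℝ, 0 < v → m * u / (m * v) ^ (m * d + 1) * ((s ^ d) ^ m)⁻¹
      = m * (u * s) / (m * (v * s)) ^ (m * d + 1) := by
    intro u v hv
    have e : ((s : ℝ) ^ d) ^ m * s = s ^ (m * d + 1) := by
      rw [← pow_mul, pow_succ, mul_comm d m]
    rw [← mul_assoc (m : ℝ) v s, mul_pow _ s, ← e]
    field_simp
  constructor
  · rw [rieszLow, key _ _ hAd]
    gcongr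
  · rw [rieszHigh, key _ _ hA1]
    gcongr

/-- The quotient of the upper and lower bounds is `(A + 1) / (A - 1)` times a fixed power of `(A +
d) / (A - 1)`, which tends to one as `A` grows. -/
theorem exists_ratio_le (hm : 0 < m) (d : ℕ) {r : ℝ} (hr : 1 < r) :
    ∃ A : ℝ, 1 < A ∧ rieszHigh d m A ≤ r * rieszLow d m A := by
  have h1 : ∀ c : ℝ, Tendsto (fun A : ℝ => (A + c) / (A - 1)) atTop (𝓝 1) := by
    intro c
    have hA : Tendsto (fun A : ℝ => 1 + (c + 1) / (A - 1)) atTop (𝓝 (1 + 0)) := by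
      refine tendsto_const_nhds.add (tendsto_const_nhds.div_atTop ?_)
      exact tendsto_atTop_add_const_right _ _ tendsto_id
    rw [add_zero] at hA
    refine hA.congr' ?_
    filter_upwards [eventually_gt_atTop 1] with A hA
    have : A - 1 ≠ 0 := by linarith
    field_simp
    ring
  have h2 : Tendsto (fun A : ℝ => (A + 1) / (A - 1) * ((A + d) / (A - 1)) ^ (m * d + 1)) atTop
      (𝓝 (1 * 1 ^ (m * d + 1))) := (h1 1).mul ((h1 d).pow _)
  rw [one_pow, one_mul] at h2
  obtain ⟨A, hA, hA1⟩ := ((h2.eventually_le_const hr).and (eventually_gt_atTop 1)).exists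
  refine ⟨A, hA1, ?_⟩
  have hA2 : 0 < A - 1 := by linarith
  have hm' : (0 : ℝ) < m := by exact_mod_cast hm
  have hAd : 0 < A + d := by positivity
  have hlow : 0 < rieszLow d m A := by unfold rieszLow; positivity
  have : rieszHigh d m A
      = (A + 1) / (A - 1) * ((A + d) / (A - 1)) ^ (m * d + 1) * rieszLow d m A := by
    unfold rieszHigh rieszLow
    rw [mul_pow, mul_pow, div_pow]
    field_simp
  rw [this]
  exact mul_le_mul_of_nonneg_right hA hlow.le

theorem rieszLow_pos (hm : 0 < m) {A : ℝ} (hA : 1 < A) : 0 < rieszLow d m A := by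
  have hA2 : 0 < A - 1 := by linarith
  have hm' : (0 : ℝ) < m := by exact_mod_cast hm
  unfold rieszLow
  positivity

theorem rieszReal_bounds (hm : 0 < m) (hd : 0 < d) {A : ℝ} (hA : 1 < A) {Q : Cube d} {x : Rd d}
    {y : Fin m → Rd d} (hx : x ∈ (Q.shift hd A).set) (hy : ∀ j, y j ∈ Q.set) :
    rieszLow d m A * (Q.vol ^ m)⁻¹ ≤ rieszReal hd x y ∧
      rieszReal hd x y ≤ rieszHigh d m A * (Q.vol ^ m)⁻¹ := by
  have h := fun j => Cube.sub_mem_shift hd hA hx (hy j)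
  rw [Q.vol_eq]
  refine div_pow_bounds hm hA Q.side_pos ?_ ?_ ?_ ?_
  · simpa using Finset.card_nsmul_le_sum Finset.univ _ _ fun j _ => (h j).1.1
  · simpa using Finset.sum_le_card_nsmul Finset.univ _ _ fun j _ => (h j).1.2
  · simpa using Finset.card_nsmul_le_sum Finset.univ _ _ fun j _ => (h j).2.1
  · simpa using Finset.sum_le_card_nsmul Finset.univ _ _ fun j _ => (h j).2.2

/-- Exchanging the roles of the two cubes reverses every first-coordinate difference, so the kernel
changes sign and obeys the same bounds. -/
theorem neg_rieszReal_bounds (hm : 0 < m) (hd : 0 < d) {A : ℝ} (hA : 1 < A) {Q : Cube d}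
    {x : Rd d} {y : Fin m → Rd d} (hx : x ∈ Q.set) (hy : ∀ j, y j ∈ (Q.shift hd A).set) :
    rieszLow d m A * (Q.vol ^ m)⁻¹ ≤ -rieszReal hd x y ∧
      -rieszReal hd x y ≤ rieszHigh d m A * (Q.vol ^ m)⁻¹ := by
  have h := fun j => Cube.sub_mem_shift hd hA (hy j) hx
  rw [Q.vol_eq, rieszReal, ← neg_div, ← Finset.sum_neg_distrib]
  simp only [neg_sub, norm_sub_rev x]
  refine div_pow_bounds hm hA Q.side_pos ?_ ?_ ?_ ?_
  · simpa using Finset.card_nsmul_le_sum Finset.univ _ _ fun j _ => (h j).1.1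
  · simpa using Finset.sum_le_card_nsmul Finset.univ _ _ fun j _ => (h j).1.2
  · simpa using Finset.card_nsmul_le_sum Finset.univ _ _ fun j _ => (h j).2.1
  · simpa using Finset.sum_le_card_nsmul Finset.univ _ _ fun j _ => (h j).2.2

/-- By Hölder's inequality, the integrals of functions with product `1_Q` have product at least
`|Q|^m`. -/
theorem Cube.vol_pow_le_prod_integral (hm : 0 < m) (Q : Cube d) {h : Fin m → Rd d → ℝ}
    (hh : ∀ j, IsLinfc (h j)) (h0 : ∀ j x, 0 ≤ h j x)
    (hprod : ∀ x, ∏ j, h j x = Q.set.indicator (fun _ => (1 : ℝ)) x) :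
    Q.vol ^ m ≤ ∏ j, ∫ x, h j x := by
  have hm' : (m : ℝ) ≠ 0 := by exact_mod_cast hm.ne'
  have key := ENNReal.lintegral_prod_norm_pow_le (μ := (volume : Measure (Rd d))) Finset.univ
    (f := fun j x => ENNReal.ofReal (h j x)) (p := fun _ => (m : ℝ)⁻¹)
    (fun j _ => (hh j).aestronglyMeasurable.aemeasurable.ennreal_ofReal) (by simp [hm'])
    (fun _ _ => by positivity)
  have h1 : ∀ x, ∏ j, ENNReal.ofReal (h j x) ^ (m : ℝ)⁻¹
      = Q.set.indicator (fun _ => (1 : ℝ≥0∞)) x := by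
    intro x
    rw [ENNReal.prod_rpow_of_nonneg (by positivity),
      ← ENNReal.ofReal_prod_of_nonneg fun j _ => h0 j x, hprod]
    by_cases hx : x ∈ Q.set
    · simp [hx]
    · simp [hx, hm]
  have h2 : ∀ j, ∫⁻ x, ENNReal.ofReal (h j x) = ENNReal.ofReal (∫ x, h j x) := fun j =>
    (ofReal_integral_eq_lintegral_ofReal (hh j).integrable (ae_of_all _ (h0 j))).symm
  simp only [h1, h2, lintegral_indicator_const Q.measurableSet, one_mul] at key
  rw [ENNReal.prod_rpow_of_nonneg (by positivity),
    ← ENNReal.ofReal_prod_of_nonneg fun j _ => integral_nonneg (h0 j)] at key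
  have h3 := ENNReal.rpow_le_rpow key (Nat.cast_nonneg m)
  rw [← ENNReal.rpow_mul, inv_mul_cancel₀ hm', ENNReal.rpow_one, ENNReal.rpow_natCast] at h3
  have h4 := ENNReal.toReal_mono ENNReal.ofReal_ne_top h3
  rwa [ENNReal.toReal_pow, ENNReal.toReal_ofReal
    (Finset.prod_nonneg fun j _ => integral_nonneg (h0 j))] at h4

variable {𝕜 : Type*} [RCLike 𝕜]

/-- For `x` outside `Q` the integrand vanishes on the diagonal, so knowing the kernel off the
diagonal is enough. -/
theorem CZOperator.app_eq_integral_riesz (hm : 0 < m) (hd : 0 < d) {T : CZOperator 𝕜 d m}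
    (hT : ∀ y, y ∉ fullDiagonal d m → T.kernel y = rieszKernel 𝕜 hd y) {Q : Cube d}
    {f : Fin m → Rd d → 𝕜} (hf : ∀ j, IsLinfc (f j)) (hQ : ∀ j, Function.support (f j) ⊆ Q.set) :
    ∀ᵐ x, x ∉ Q.set →
      T.app f x = ∫ y : Fin m → Rd d, (rieszReal hd x y : 𝕜) * ∏ j, f j (y j) := by
  filter_upwards [T.representation f hf] with x hx hxQ
  have hts : tsupport (f ⟨0, hm⟩) ⊆ Q.set := closure_minimal (hQ _) Q.isClosed
  rw [CZOperator.app, hx fun h => hxQ (hts (mem_iInter.1 h _))]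
  refine integral_congr_ae (ae_of_all _ fun y => ?_)
  by_cases h0 : f ⟨0, hm⟩ (y ⟨0, hm⟩) = 0
  · have : ∏ j, f j (y j) = 0 := Finset.prod_eq_zero (Finset.mem_univ _) h0
    simp [this]
  · dsimp only
    rw [hT, rieszKernel_cons]
    intro hdiag
    have := hdiag 0 (Fin.succ ⟨0, hm⟩)
    simp only [Fin.cons_zero, Fin.cons_succ] at this
    exact hxQ (this ▸ hQ _ h0)

theorem prod_eq_zero_of_notMem {Q : Cube d} {f : Fin m → Rd d → 𝕜}
    (hQ : ∀ j, Function.support (f j) ⊆ Q.set) {y : Fin m → Rd d} (hy : ¬ ∀ j, y j ∈ Q.set) :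
    ∏ j, f j (y j) = 0 := by
  push Not at hy
  obtain ⟨j, hj⟩ := hy
  exact Finset.prod_eq_zero (Finset.mem_univ j) (by_contra fun h => hj (hQ j h))

/-- The kernel is negative from `Q'` to `Q` with size at least `rieszLow` over the volume power, so
no cancellation occurs. Hölder's inequality bounds the product of the integrals of the `h j` from
below. -/
theorem lowerBoundOnCube_riesz (hm : 0 < m) (hd : 0 < d) {T : CZOperator 𝕜 d m}
    (hT : ∀ y, y ∉ fullDiagonal d m → T.kernel y = rieszKernel 𝕜 hd y) {A : ℝ} (hA : 1 < A)
    (Q : Cube d) : LowerBoundOnCube T (rieszLow d m A)⁻¹ Q (Q.shift hd A) := by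
  intro h hh h0 hQ hprod
  have hh' : ∀ j, IsLinfc (fun y => (h j y : 𝕜)) := fun j => ⟨(hh j).1.ofReal,
    (hh j).2.comp_left (g := fun r : ℝ => (r : 𝕜)) (by simp)⟩
  have hQ' : ∀ j, Function.support (fun y => (h j y : 𝕜)) ⊆ (Q.shift hd A).set := fun j y hy =>
    hQ j (by simpa using hy)
  filter_upwards [CZOperator.app_eq_integral_riesz hm hd hT hh' hQ'] with x hx hxQ
  have hxQ' : x ∉ (Q.shift hd A).set := fun hx' => Cube.notMem_shift hd hA hx' hxQ
  have hlow := rieszLow_pos (d := d) hm hA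
  have hvol : 0 < Q.vol ^ m := pow_pos Q.vol_pos m
  have hint : Integrable fun y : Fin m → Rd d => ∏ j, h j (y j) :=
    Integrable.fintype_prod fun j => (hh j).integrable
  have hnn : ∀ y : Fin m → Rd d, 0 ≤ ∏ j, h j (y j) := fun y =>
    Finset.prod_nonneg fun j _ => h0 j _
  have hb : ∀ y : Fin m → Rd d,
      rieszLow d m A * (Q.vol ^ m)⁻¹ * ∏ j, h j (y j) ≤ -rieszReal hd x y * ∏ j, h j (y j) ∧
      -rieszReal hd x y * ∏ j, h j (y j) ≤ rieszHigh d m A * (Q.vol ^ m)⁻¹ * ∏ j, h j (y j) := by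
    intro y
    by_cases hy : ∀ j, y j ∈ (Q.shift hd A).set
    · obtain ⟨h1, h2⟩ := neg_rieszReal_bounds hm hd hA hxQ hy
      exact ⟨mul_le_mul_of_nonneg_right h1 (hnn y), mul_le_mul_of_nonneg_right h2 (hnn y)⟩
    · simp [prod_eq_zero_of_notMem (𝕜 := ℝ) hQ hy]
  have hint2 : Integrable fun y : Fin m → Rd d => -rieszReal hd x y * ∏ j, h j (y j) := by
    refine (hint.const_mul (rieszHigh d m A * (Q.vol ^ m)⁻¹)).mono'
      (((measurable_rieszReal hd).comp
        measurable_prodMk_left).neg.aestronglyMeasurable.mul hint.aestronglyMeasurable)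
      (ae_of_all _ fun y => ?_)
    obtain ⟨h1, h2⟩ := hb y
    rw [Real.norm_of_nonneg (le_trans (mul_nonneg (by positivity) (hnn y)) h1)]
    exact h2
  have hI : rieszLow d m A * (Q.vol ^ m)⁻¹ * ∏ j, ∫ y, h j y
      ≤ ∫ y : Fin m → Rd d, -rieszReal hd x y * ∏ j, h j (y j) := by
    rw [← integral_fintype_prod_volume_eq_prod (f := fun j y => h j y), ← integral_const_mul]
    exact integral_mono (hint.const_mul _) hint2 fun y => (hb y).1
  have hT' : T.app (fun j y => (h j y : 𝕜)) x
      = ((-∫ y : Fin m → Rd d, -rieszReal hd x y * ∏ j, h j (y j) : ℝ) : 𝕜) := by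
    rw [hx hxQ', ← integral_neg, ← integral_ofReal]
    refine integral_congr_ae (ae_of_all _ fun y => ?_)
    simp
  have hlo : rieszLow d m A ≤ ∫ y : Fin m → Rd d, -rieszReal hd x y * ∏ j, h j (y j) := by
    refine le_trans ?_ hI
    have hv := (Q.shift hd A).vol_pow_le_prod_integral hm hh h0 hprod
    rw [Cube.vol_shift] at hv
    calc rieszLow d m A = rieszLow d m A * (Q.vol ^ m)⁻¹ * Q.vol ^ m := by field_simp
      _ ≤ _ := by gcongr
  rw [hT', RCLike.norm_ofReal, abs_neg, inv_mul_eq_div, one_le_div hlow]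
  exact hlo.trans (le_abs_self _)

theorem integrable_tensor {n : Fin m → ℕ} {f : ∀ j, Rd d → Hil 𝕜 (n j)}
    (hf : ∀ j, IsLinfc (f j)) :
    Integrable fun y : Fin m → Rd d => tensor fun j => f j (y j) := by
  have hmeas : AEStronglyMeasurable (fun y : Fin m → Rd d => tensor fun j => f j (y j)) := by
    refine continuous_tensor.comp_aestronglyMeasurable
      (aemeasurable_pi_lambda _ fun j => ?_).aestronglyMeasurable
    exact ((hf j).aestronglyMeasurable.comp_quasiMeasurePreserving
      (Measure.quasiMeasurePreserving_eval _ j)).aemeasurable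
  refine (Integrable.fintype_prod fun j => (hf j).integrable.norm).mono' hmeas
    (ae_of_all _ fun y => ?_)
  rw [norm_tensor]

/-- With `C` the inverse lower bound, `C` times the kernel lies between `1` and `(1 + α) / (1 - α)`
times `|Q|^{-m}`. The remainder after subtracting `1 - α` times it is therefore at most `α
|Q|^{-m}`. -/
theorem averageRepresentation_riesz (hm : 0 < m) (hd : 0 < d) (n : Fin m → ℕ)
    {T : CZOperator 𝕜 d m}
    (hT : ∀ y, y ∉ fullDiagonal d m → T.kernel y = rieszKernel 𝕜 hd y) {A α : ℝ} (hA : 1 < A)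
    (h0 : 0 < α) (h1 : α < 1) (hAα : rieszHigh d m A ≤ (1 + α) / (1 - α) * rieszLow d m A)
    (Q : Cube d) :
    AverageRepresentation n T α (rieszLow d m A)⁻¹ Q (Q.shift hd A) := by
  have hlow := rieszLow_pos (d := d) hm hA
  have hvol : 0 < Q.vol ^ m := pow_pos Q.vol_pos m
  have hα : 0 < 1 - α := by linarith
  set C := (rieszLow d m A)⁻¹ with hC
  have hCpos : 0 < C := inv_pos.2 hlow
  -- The error kernel is forced by the required identity; only its size has to be checked.
  set s : Rd d → (Fin m → Rd d) → ℝ := fun x y =>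
    α⁻¹ * ((Q.vol ^ m)⁻¹ - (1 - α) * C * rieszReal hd x y) with hs
  have hsm : Measurable (Function.uncurry s) :=
    (measurable_const.sub ((measurable_rieszReal hd).const_mul _)).const_mul _
  have hpi : MeasurableSet (Set.pi Set.univ fun _ : Fin m => Q.set) :=
    MeasurableSet.univ_pi fun _ => Q.measurableSet
  have hsb : ∀ x ∈ (Q.shift hd A).set, ∀ y : Fin m → Rd d, (∀ j, y j ∈ Q.set) →
      |s x y| ≤ (Q.vol ^ m)⁻¹ := by
    intro x hx y hy
    obtain ⟨hl, hu⟩ := rieszReal_bounds hm hd hA hx hy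
    have hl' : (Q.vol ^ m)⁻¹ ≤ C * rieszReal hd x y := by
      calc (Q.vol ^ m)⁻¹ = C * (rieszLow d m A * (Q.vol ^ m)⁻¹) := by
            rw [hC, inv_mul_cancel_left₀ hlow.ne']
        _ ≤ _ := by gcongr
    have hu' : (1 - α) * (C * rieszReal hd x y) ≤ (1 + α) * (Q.vol ^ m)⁻¹ := by
      calc (1 - α) * (C * rieszReal hd x y)
          ≤ (1 - α) * (C * ((1 + α) / (1 - α) * rieszLow d m A * (Q.vol ^ m)⁻¹)) := by
            gcongr
            exact hu.trans (by gcongr)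
        _ = _ := by rw [hC]; field_simp
    rw [hs]
    dsimp only
    rw [abs_mul, abs_of_pos (inv_pos.2 h0), inv_mul_le_iff₀ h0, abs_le]
    constructor <;> nlinarith
  refine ⟨fun x y => (s x y : 𝕜), ?_, ?_, fun f hf hQ => ?_⟩
  · exact (RCLike.measurable_ofReal.comp hsm).aestronglyMeasurable
  · refine ae_restrict_of_forall_mem ((Cube.measurableSet _).prod hpi) fun z hz => ?_
    simp only [Function.uncurry, RCLike.norm_ofReal]
    exact hsb z.1 hz.1 z.2 fun j => hz.2 j (mem_univ j)
  have hcomp : ∀ k : ∀ j, Fin (n j), ∀ j, IsLinfc fun y => f j y (k j) := fun k j =>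
    (hf j).clm_comp (EuclideanSpace.proj (𝕜 := 𝕜) (k j))
  have hcompQ : ∀ k : ∀ j, Fin (n j), ∀ j, Function.support (fun y => f j y (k j)) ⊆ Q.set :=
    fun k j y hy => hQ j fun h => hy (by simp [h])
  have happ := ae_all_iff.2 fun k : ∀ j, Fin (n j) =>
    CZOperator.app_eq_integral_riesz hm hd hT (hcomp k) (hcompQ k)
  filter_upwards [happ] with x hx hxQ
  have hxQ' := Cube.notMem_shift hd hA hxQ
  have hsx : Integrable (fun y => (s x y : 𝕜) • tensor fun j => f j (y j))
      (volume.restrict (Set.pi Set.univ fun _ : Fin m => Q.set)) := by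
    refine ((integrable_tensor hf).norm.integrableOn.const_mul (Q.vol ^ m)⁻¹).mono' ?_ ?_
    · exact ((RCLike.measurable_ofReal (𝕜 := 𝕜)).comp (hsm.comp
        measurable_prodMk_left)).aestronglyMeasurable.smul
        (integrable_tensor hf).aestronglyMeasurable.restrict
    · refine ae_restrict_of_forall_mem hpi fun y hy => ?_
      rw [norm_smul, RCLike.norm_ofReal]
      gcongr
      exact hsb x hxQ y fun j => hy j (mem_univ j)
  ext k
  have hP : Integrable fun y : Fin m → Rd d => ∏ j, f j (y j) (k j) :=
    Integrable.fintype_prod (f := fun j y => f j y (k j)) fun j => (hcomp k j).integrable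
  have hzero : ∀ (g : (Fin m → Rd d) → 𝕜) (y), y ∉ Set.pi Set.univ (fun _ : Fin m => Q.set) →
      g y * ∏ j, f j (y j) (k j) = 0 := fun g y hy => by
    rw [prod_eq_zero_of_notMem (hcompQ k) fun h => hy fun j _ => h j, mul_zero]
  have hR : Integrable fun y : Fin m → Rd d =>
      (rieszReal hd x y : 𝕜) * ∏ j, f j (y j) (k j) := by
    refine (hP.norm.const_mul (rieszHigh d m A * (Q.vol ^ m)⁻¹)).mono'
      ((RCLike.measurable_ofReal.comp ((measurable_rieszReal hd).comp
        measurable_prodMk_left)).aestronglyMeasurable.mul hP.aestronglyMeasurable)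
      (ae_of_all _ fun y => ?_)
    by_cases hy : ∀ j, y j ∈ Q.set
    · obtain ⟨hl, hu⟩ := rieszReal_bounds hm hd hA hxQ hy
      rw [norm_mul, RCLike.norm_ofReal, abs_of_nonneg (le_trans (by positivity) hl)]
      gcongr
    · rw [prod_eq_zero_of_notMem (hcompQ k) hy]
      simp
  have hproj : ((∫ y in Set.pi Set.univ fun _ : Fin m => Q.set,
      (s x y : 𝕜) • tensor fun j => f j (y j)) : HilT 𝕜 n) k
      = ∫ y : Fin m → Rd d, (s x y : 𝕜) * ∏ j, f j (y j) (k j) := by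
    rw [← setIntegral_eq_integral_of_forall_compl_eq_zero (hzero fun y => (s x y : 𝕜))]
    exact ((EuclideanSpace.proj (𝕜 := 𝕜) k).integral_comp_comm hsx).symm
  have hs_int : ∫ y : Fin m → Rd d, (s x y : 𝕜) * ∏ j, f j (y j) (k j)
      = (α : 𝕜)⁻¹ * ((((Q.vol ^ m)⁻¹ : ℝ) : 𝕜) * (∏ j, ∫ y, f j y (k j))
        - (((1 - α) * C : ℝ) : 𝕜) *
          ∫ y : Fin m → Rd d, (rieszReal hd x y : 𝕜) * ∏ j, f j (y j) (k j)) := by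
    rw [← integral_fintype_prod_volume_eq_prod (f := fun j y => f j y (k j)),
      ← integral_const_mul, ← integral_const_mul,
      ← integral_sub (hP.const_mul _) (hR.const_mul _), ← integral_const_mul]
    refine integral_congr_ae (ae_of_all _ fun y => ?_)
    simp only [hs]
    push_cast
    ring
  have havg : ∀ j, (⨍ y in Q.set, f j y) (k j) = ((Q.vol⁻¹ : ℝ) : 𝕜) * ∫ y, f j y (k j) := by
    intro j
    rw [Q.setAverage_eq, setIntegral_eq_integral_of_forall_compl_eq_zero fun y hy =>
      by_contra fun h => hy (hQ j h), PiLp.smul_apply, RCLike.real_smul_eq_coe_mul]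
    congr 1
    exact ((EuclideanSpace.proj (𝕜 := 𝕜) (k j)).integral_comp_comm (hf j).integrable).symm
  have hα' : (α : 𝕜) ≠ 0 := by exact_mod_cast h0.ne'
  simp only [PiLp.add_apply, PiLp.smul_apply, smul_eq_mul, hproj, hs_int]
  rw [mul_inv_cancel_left₀ hα', CZOperator.tilde]
  dsimp only
  rw [hx k hxQ', add_sub_cancel, tensor_apply]
  simp only [havg, Finset.prod_mul_distrib]
  simp

theorem directionallyNonDegenerate_riesz (hm : 0 < m) (hd : 0 < d) (n : Fin m → ℕ)
    (T : CZOperator 𝕜 d m)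
    (hT : ∀ y, y ∉ fullDiagonal d m → T.kernel y = rieszKernel 𝕜 hd y) :
    DirectionallyNonDegenerate n T := by
  have h : ∀ α : ℝ, ∃ A : ℝ, 0 < α → α < 1 →
      1 < A ∧ rieszHigh d m A ≤ (1 + α) / (1 - α) * rieszLow d m A := by
    intro α
    by_cases hα : 0 < α ∧ α < 1
    · have hr : 1 < (1 + α) / (1 - α) := by
        rw [one_lt_div (by linarith)]
        linarith
      obtain ⟨A, hA⟩ := exists_ratio_le hm d hr
      exact ⟨A, fun _ _ => hA⟩
    -- Outside the range of `α` the value is arbitrary.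
    · exact ⟨0, fun h0 h1 => absurd ⟨h0, h1⟩ hα⟩
  choose A hA using h
  refine ⟨fun α => (rieszLow d m (A α))⁻¹, fun α h0 h1 => ?_⟩
  obtain ⟨hA1, hA2⟩ := hA α h0 h1
  exact ⟨inv_pos.2 (rieszLow_pos hm hA1), fun Q => ⟨Q.shift hd (A α),
    lowerBoundOnCube_riesz hm hd hT hA1 Q,
    averageRepresentation_riesz hm hd n hT hA1 h0 h1 hA2 Q⟩⟩

end Riesz

end MatrixCZ

theorem mainTheorem10 (𝕜 : Type*) [RCLike 𝕜] (m : ℕ) (hm : 0 < m) (n : Fin m → ℕ) :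
    -- matrix-weighted Lebesgue spaces
    (∀ p : Fin m → ℝ≥0∞, (∀ j, 1 < p j) → totalExp p < ⊤ →
      ∃ α : ℝ, 0 < α ∧ α < 1 ∧ ∃ c : ℝ≥0,
        ∀ (d : ℕ), 0 < d → ∀ (T : CZOperator 𝕜 d m) (C : ℝ → ℝ), DirNonDegWith n T C →
        ∀ W : (∀ j, Rd d → Matrix (Fin (n j)) (Fin (n j)) 𝕜),
          (∀ j, IsMatrixWeight (W j)) →
          (∀ j, InvLocallyIntegrable (conjExp (p j)) (W j)) →
          tildeLebNorm T p W < ⊤ →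
          MuckenhouptCondition p W ∧
          muckenhouptConst p W ≤ c * ENNReal.ofReal (C α) ^ 2 * tildeLebNorm T p W ^ 2) ∧
    -- matrix-weighted products of Banach function spaces
    (∀ K : ℝ≥0,
      ∃ α : ℝ, 0 < α ∧ α < 1 ∧ ∃ c : ℝ≥0,
        ∀ (d : ℕ), 0 < d → ∀ (T : CZOperator 𝕜 d m) (C : ℝ → ℝ), DirNonDegWith n T C →
        ∀ X : Fin m → BFS 𝕜 d, (∀ j, (X j).Fatou) → IsQuasiConst X K →
        ∀ W : (∀ j, Rd d → Matrix (Fin (n j)) (Fin (n j)) 𝕜),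
          (∀ j, IsMatrixWeight (W j)) →
          (∀ (j) (Q : Cube d),
            (X j).dualNrm (Q.set.indicator (fun x => (invOpNorm (W j) x : 𝕜))) < ⊤) →
          tildeNorm T X W < ⊤ →
          ⨆ Q : Cube d, avgNorm Q X W
            ≤ c * ENNReal.ofReal (C α) ^ 2 * tildeWeakNorm T X W * tildeNorm T X W) ∧
    -- the multilinear Riesz transform
    (∀ (d : ℕ) (hd : 0 < d) (T : CZOperator 𝕜 d m),
      (∀ y, y ∉ fullDiagonal d m → T.kernel y = rieszKernel 𝕜 hd y) →
      DirectionallyNonDegenerate n T) := by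
  refine ⟨fun p hp htot => ?_, fun K => ?_, fun d hd T hT =>
    directionallyNonDegenerate_riesz hm hd n T hT⟩
  · obtain ⟨α, h0, h1, c, h⟩ := exists_muckenhouptConst_bound 𝕜 hm n hp htot
    exact ⟨α, h0, h1, c, fun d _ => h d⟩
  · obtain ⟨α, h0, h1, c, h⟩ := exists_avgNorm_bound 𝕜 hm n K
    exact ⟨α, h0, h1, c, fun d _ T C hT X hX hK W hW hdual hfin =>
      iSup_le (h d T C hT X hX hK W hW hdual hfin)⟩
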